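/- **Setting.** Let $\mathcal X,\mathcal Y,\hat{\mathcal X},\hat{\mathcal Y}$ be finite alphabets, let $P_{XY}$ be a probability mass function (pmf) on $\mathcal X\times\mathcal Y$, and let $(X^n,Y^n)$ be i.i.d. with law $P_{XY}$. Let $d_X:\mathcal X\times\hat{\mathcal X}\to[0,\infty)$ and $d_Y:\mathcal Y\times\hat{\mathcal Y}\to[0,\infty)$ be distortion measures such that each $x$ has some $\hat x$ with $d_X(x,\hat x)=0$ and each $y$ has some $\hat y$ with $d_Y(y,\hat y)=0$; distortions of strings are per-letter averages. Let $D_1,D_2>0$ and $\epsilon\in(0,1)$. Logarithms are to base $2$ and $\exp(t):=2^t$. An $(n,M_0,M_1,M_2)$-code consists of encoders $f_i:\mathcal X^n\times\mathcal Y^n\to\{1,\dots,M_i\}$, $i=0,1,2$, and decoders producing $\hat X^n\in\hat{\mathcal X}^n$ from $(f_0,f_1)$ and $\hat Y^n\in\hat{\mathcal Y}^n$ from $(f_0,f_2)$. For a pmf $Q$ on $\mathcal X\times\mathcal Y$, let $\mathcal R(D_1,D_2|Q)$ be the closure of the set of triplets $(R_0,R_1,R_2)$ for which there is a sequence of codes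 with $\limsup_n\frac1n\log M_i\le R_i$ ($i=0,1,2$), $\limsup_n\mathbb E[d_X(X^n,\hat X^n)]\le D_1$ and $\limsup_n\mathbb E[d_Y(Y^n,\hat Y^n)]\le D_2$, where the source is i.i.d. with law $Q$. Let $$\mathsf R_0(R_1,R_2,D_1,D_2|Q):=\min\{R_0:(R_0,R_1,R_2)\in\mathcal R(D_1,D_2|Q)\}$$ ($\infty$ if there is no such $R_0$) be the minimum common rate. The optimal second-order region $\mathcal L(R_0,R_1,R_2,D_1,D_2,\epsilon)$ is the closure of the set of triplets $(L_0,L_1,L_2)\in\mathbb R^3$ for which there is a sequence of $(n,M_0,M_1,M_2)$-codes for the source $P_{XY}$ with $\limsup_n\frac1{\sqrt n}(\log M_i-nR_i)\le L_i$ ($i=0,1,2$) and $\limsup_n\Pr\big(d_X(X^n,\hat X^n)>D_1\text{ or }d_Y(Y^n,\hat Y^n)>D_2\big)\le\epsilon$. **Assumptions.** Let $(R_0^*,R_1^*,R_2^*)\in\mathcal R(D_1,D_2|P_{XY})$ satisfy: 1. $R_0^*=\mathsf R_0(R_1^*,R_2^*,D_1,D_2|P_{XY})$ is positive and finite. 2.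 For $i=1,2$ the derivatives $$\lambda_i^*:=-\frac{\partial\mathsf R_0(R_1,R_2,D_1,D_2|P_{XY})}{\partial R_i}\bigg|_{(R_1^*,R_2^*)},\qquad \gamma_i^*:=-\frac{\partial\mathsf R_0(R_1^*,R_2^*,D_1',D_2'|P_{XY})}{\partial D_i'}\bigg|_{(D_1,D_2)}$$ exist and are positive. 3. The map $(R_1,R_2,Q)\mapsto\mathsf R_0(R_1,R_2,D_1,D_2|Q)$, with $Q$ ranging over pmfs on the support of $P_{XY}$, is twice differentiable with bounded Hessian in a neighborhood of $(R_1^*,R_2^*,P_{XY})$. **Tilted information density.** An optimal test channel consists of a finite alphabet $\mathcal W$ and conditional pmfs $P^*_{W|XY},P^*_{\hat X|XW},P^*_{\hat Y|YW}$ such that, for $(X,Y)\sim P_{XY}$, $\mathbb E[d_X(X,\hat X)]\le D_1$, $\mathbb E[d_Y(Y,\hat Y)]\le D_2$, $I(X;\hat X|W)\le R_1^*$, $I(Y;\hat Y|W)\le R_2^*$ and $I(X,Y;W)=\mathsf R_0(R_1^*,R_2^*,D_1,D_2|P_{XY})$. With the induced pmfs $P_W^*,P^*_{\hat X|W},P^*_{\hat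 Y|W}$ put $$\jmath(x,D_1|w):=-\log\sum_{\hat x}P^*_{\hat X|W}(\hat x|w)\exp\Big(\tfrac{\gamma_1^*}{\lambda_1^*}(D_1-d_X(x,\hat x))\Big),$$ $$\jmath(y,D_2|w):=-\log\sum_{\hat y}P^*_{\hat Y|W}(\hat y|w)\exp\Big(\tfrac{\gamma_2^*}{\lambda_2^*}(D_2-d_Y(y,\hat y))\Big),$$ $$\jmath(x,y):=-\log\sum_wP_W^*(w)\exp\Big(\lambda_1^*(R_1^*-\jmath(x,D_1|w))+\lambda_2^*(R_2^*-\jmath(y,D_2|w))\Big),$$ and let $\mathrm V:=\mathrm{Var}[\jmath(X,Y)]$ with $(X,Y)\sim P_{XY}$. **Theorem.** Under these assumptions an optimal test channel exists, and for every optimal test channel $$\mathcal L(R_0^*,R_1^*,R_2^*,D_1,D_2,\epsilon)=\Big\{(L_0,L_1,L_2)\in\mathbb R^3:\ L_0+\lambda_1^*L_1+\lambda_2^*L_2\ge\sqrt{\mathrm V}\,\mathrm Q^{-1}(\epsilon)\Big\},$$ where $\mathrm Q(t)=\int_t^\infty\frac1{\sqrt{2\pi}}e^{-u^2/2}\,du$.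 -/

import Mathlib

namespace GrayWyner

noncomputable section

/-- Per-letter average distortion `(1/n) ∑ d (x i) (xh i)` of two strings of length `n`. -/
def avgDist {A B : Type*} (d : A → B → ℝ) {n : ℕ} (a : Fin n → A) (b : Fin n → B) : ℝ :=
  (∑ i, d (a i) (b i)) / n

/-- An `(n, M₀, M₁, M₂)`-code: three encoders that see both source strings, and two decoders,
each of which sees the common message and its own private message. -/
structure Code (X Y Xh Yh : Type*) (n M₀ M₁ M₂ : ℕ) where
  enc₀ : (Fin n → X) → (Fin n → Y) → Fin M₀
  enc₁ : (Fin n → X) → (Fin n → Y) → Fin M₁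
  enc₂ : (Fin n → X) → (Fin n → Y) → Fin M₂
  dec₁ : Fin M₀ → Fin M₁ → (Fin n → Xh)
  dec₂ : Fin M₀ → Fin M₂ → (Fin n → Yh)

namespace Code

variable {X Y Xh Yh : Type*} {n M₀ M₁ M₂ : ℕ}

/-- The reproduction of the first source string. -/
def outX (c : Code X Y Xh Yh n M₀ M₁ M₂) (x : Fin n → X) (y : Fin n → Y) : Fin n → Xh :=
  c.dec₁ (c.enc₀ x y) (c.enc₁ x y)

/-- The reproduction of the second source string. -/
def outY (c : Code X Y Xh Yh n M₀ M₁ M₂) (x : Fin n → X) (y : Fin n → Y) : Fin n → Yh :=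
  c.dec₂ (c.enc₀ x y) (c.enc₂ x y)

variable [Fintype X] [Fintype Y]

/-- Expected distortion of the first reproduction, for `(Xᵢ, Yᵢ)` i.i.d. with pmf `P`. -/
def expDistX (c : Code X Y Xh Yh n M₀ M₁ M₂) (dX : X → Xh → ℝ) (P : X × Y → ℝ) : ℝ :=
  ∑ x : Fin n → X, ∑ y : Fin n → Y, (∏ i, P (x i, y i)) * avgDist dX x (c.outX x y)

/-- Expected distortion of the second reproduction, for `(Xᵢ, Yᵢ)` i.i.d. with pmf `P`. -/
def expDistY (c : Code X Y Xh Yh n M₀ M₁ M₂) (dY : Y → Yh → ℝ) (P : X × Y → ℝ) : ℝ :=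
  ∑ x : Fin n → X, ∑ y : Fin n → Y, (∏ i, P (x i, y i)) * avgDist dY y (c.outY x y)

/-- The probability that at least one of the two distortions exceeds its level,
for `(Xᵢ, Yᵢ)` i.i.d. with pmf `P`. -/
def excessProb (c : Code X Y Xh Yh n M₀ M₁ M₂) (dX : X → Xh → ℝ) (dY : Y → Yh → ℝ)
    (D₁ D₂ : ℝ) (P : X × Y → ℝ) : ℝ :=
  ∑ x : Fin n → X, ∑ y : Fin n → Y,
    if D₁ < avgDist dX x (c.outX x y) ∨ D₂ < avgDist dY y (c.outY x y)
    then ∏ i, P (x i, y i) else 0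

end Code

section Regions

variable {X Y Xh Yh : Type*} [Fintype X] [Fintype Y]

/-- `(R₀, R₁, R₂)` is `(D₁, D₂)`-achievable (expected distortion, rates in bits).
The upper limits are taken in the extended reals. -/
def Achievable (dX : X → Xh → ℝ) (dY : Y → Yh → ℝ) (D₁ D₂ : ℝ) (P : X × Y → ℝ)
    (R : ℝ × ℝ × ℝ) : Prop :=
  ∃ (M₀ M₁ M₂ : ℕ → ℕ) (c : ∀ n, Code X Y Xh Yh n (M₀ n) (M₁ n) (M₂ n)),
    Filter.limsup (fun n : ℕ => ((Real.logb 2 (M₀ n) / n : ℝ) : EReal)) Filter.atTop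
      ≤ (R.1 : EReal) ∧
    Filter.limsup (fun n : ℕ => ((Real.logb 2 (M₁ n) / n : ℝ) : EReal)) Filter.atTop
      ≤ (R.2.1 : EReal) ∧
    Filter.limsup (fun n : ℕ => ((Real.logb 2 (M₂ n) / n : ℝ) : EReal)) Filter.atTop
      ≤ (R.2.2 : EReal) ∧
    Filter.limsup (fun n : ℕ => (((c n).expDistX dX P : ℝ) : EReal)) Filter.atTop
      ≤ (D₁ : EReal) ∧
    Filter.limsup (fun n : ℕ => (((c n).expDistY dY P : ℝ) : EReal)) Filter.atTop
      ≤ (D₂ : EReal)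

/-- The optimal rate region: the closure of the set of achievable rate triplets. -/
def rateRegion (dX : X → Xh → ℝ) (dY : Y → Yh → ℝ) (D₁ D₂ : ℝ) (P : X × Y → ℝ) :
    Set (ℝ × ℝ × ℝ) :=
  closure {R | Achievable dX dY D₁ D₂ P R}

/-- The minimum common rate `𝖱₀(R₁, R₂, D₁, D₂ | P)`. For a pmf `P` the rate region is closed and
its common rates are nonnegative, so the infimum is a minimum whenever there is any such `R₀`;
if there is none (minimum common rate `∞`), the real infimum has the value `0`, so a positive
value is always the true, finite one. -/
def minCommonRate (dX : X → Xh → ℝ) (dY : Y → Yh → ℝ) (R₁ R₂ D₁ D₂ : ℝ) (P : X × Y → ℝ) : ℝ :=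
  sInf {R₀ : ℝ | (R₀, R₁, R₂) ∈ rateRegion dX dY D₁ D₂ P}

/-- `(L₀, L₁, L₂)` is second-order `(R₀, R₁, R₂, D₁, D₂, ε)`-achievable. -/
def SecondOrderAchievable (dX : X → Xh → ℝ) (dY : Y → Yh → ℝ) (R₀ R₁ R₂ D₁ D₂ ε : ℝ)
    (P : X × Y → ℝ) (L : ℝ × ℝ × ℝ) : Prop :=
  ∃ (M₀ M₁ M₂ : ℕ → ℕ) (c : ∀ n, Code X Y Xh Yh n (M₀ n) (M₁ n) (M₂ n)),
    Filter.limsup (fun n : ℕ => (((Real.logb 2 (M₀ n) - n * R₀) / √(n : ℝ) : ℝ) : EReal))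
      Filter.atTop ≤ (L.1 : EReal) ∧
    Filter.limsup (fun n : ℕ => (((Real.logb 2 (M₁ n) - n * R₁) / √(n : ℝ) : ℝ) : EReal))
      Filter.atTop ≤ (L.2.1 : EReal) ∧
    Filter.limsup (fun n : ℕ => (((Real.logb 2 (M₂ n) - n * R₂) / √(n : ℝ) : ℝ) : EReal))
      Filter.atTop ≤ (L.2.2 : EReal) ∧
    Filter.limsup (fun n : ℕ => (((c n).excessProb dX dY D₁ D₂ P : ℝ) : EReal)) Filter.atTop
      ≤ (ε : EReal)

/-- The optimal second-order coding region `𝓛(R₀, R₁, R₂, D₁, D₂, ε)`. -/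
def secondOrderRegion (dX : X → Xh → ℝ) (dY : Y → Yh → ℝ) (R₀ R₁ R₂ D₁ D₂ ε : ℝ)
    (P : X × Y → ℝ) : Set (ℝ × ℝ × ℝ) :=
  closure {L | SecondOrderAchievable dX dY R₀ R₁ R₂ D₁ D₂ ε P L}

end Regions

/-- Mutual information `I(A;B)` in bits of a joint pmf on finite alphabets. -/
def mutualInfo {A B : Type*} [Fintype A] [Fintype B] (p : A → B → ℝ) : ℝ :=
  ∑ a, ∑ b, p a b * Real.logb 2 (p a b / ((∑ b', p a b') * (∑ a', p a' b)))

/-- Conditional mutual information `I(A;B|C)` in bits of a joint pmf on finite alphabets. -/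
def condMutualInfo {A B C : Type*} [Fintype A] [Fintype B] [Fintype C] (p : A → B → C → ℝ) : ℝ :=
  ∑ a, ∑ b, ∑ c, p a b c *
    Real.logb 2 (p a b c * (∑ a', ∑ b', p a' b' c) / ((∑ b', p a b' c) * (∑ a', p a' b c)))

/-- A test channel `P_{W|XY} P_{Xh|XW} P_{Yh|YW}`. -/
structure TestChannel (X Y Xh Yh W : Type*) [Fintype Xh] [Fintype Yh] [Fintype W] where
  chW : X → Y → W → ℝ
  chX : X → W → Xh → ℝ
  chY : Y → W → Yh → ℝ
  chW_mem : ∀ x y, chW x y ∈ stdSimplex ℝ W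
  chX_mem : ∀ x w, chX x w ∈ stdSimplex ℝ Xh
  chY_mem : ∀ y w, chY y w ∈ stdSimplex ℝ Yh

namespace TestChannel

variable {X Y Xh Yh W : Type*} [Fintype X] [Fintype Y] [Fintype Xh] [Fintype Yh] [Fintype W]

/-- `P_{XW}`. -/
def pXW (T : TestChannel X Y Xh Yh W) (P : X × Y → ℝ) (x : X) (w : W) : ℝ :=
  ∑ y, P (x, y) * T.chW x y w

/-- `P_{YW}`. -/
def pYW (T : TestChannel X Y Xh Yh W) (P : X × Y → ℝ) (y : Y) (w : W) : ℝ :=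
  ∑ x, P (x, y) * T.chW x y w

/-- `P_W`. -/
def pW (T : TestChannel X Y Xh Yh W) (P : X × Y → ℝ) (w : W) : ℝ :=
  ∑ x, ∑ y, P (x, y) * T.chW x y w

/-- `P_{Xh|W}(xh | w)`; the value `0` where `P_W(w) = 0` is never used with positive weight. -/
def pXhGivenW (T : TestChannel X Y Xh Yh W) (P : X × Y → ℝ) (w : W) (xh : Xh) : ℝ :=
  (∑ x, T.pXW P x w * T.chX x w xh) / T.pW P w

/-- `P_{Yh|W}(yh | w)`; the value `0` where `P_W(w) = 0` is never used with positive weight. -/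
def pYhGivenW (T : TestChannel X Y Xh Yh W) (P : X × Y → ℝ) (w : W) (yh : Yh) : ℝ :=
  (∑ y, T.pYW P y w * T.chY y w yh) / T.pW P w

/-- `I(X, Y; W)`. -/
def commonInfo (T : TestChannel X Y Xh Yh W) (P : X × Y → ℝ) : ℝ :=
  mutualInfo fun (z : X × Y) (w : W) => P z * T.chW z.1 z.2 w

/-- `I(X; Xh | W)`. -/
def infoX (T : TestChannel X Y Xh Yh W) (P : X × Y → ℝ) : ℝ :=
  condMutualInfo fun (x : X) (xh : Xh) (w : W) => T.pXW P x w * T.chX x w xh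

/-- `I(Y; Yh | W)`. -/
def infoY (T : TestChannel X Y Xh Yh W) (P : X × Y → ℝ) : ℝ :=
  condMutualInfo fun (y : Y) (yh : Yh) (w : W) => T.pYW P y w * T.chY y w yh

/-- `𝔼[dX(X, Xh)]`. -/
def distX (T : TestChannel X Y Xh Yh W) (dX : X → Xh → ℝ) (P : X × Y → ℝ) : ℝ :=
  ∑ x, ∑ w, ∑ xh, T.pXW P x w * T.chX x w xh * dX x xh

/-- `𝔼[dY(Y, Yh)]`. -/
def distY (T : TestChannel X Y Xh Yh W) (dY : Y → Yh → ℝ) (P : X × Y → ℝ) : ℝ :=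
  ∑ y, ∑ w, ∑ yh, T.pYW P y w * T.chY y w yh * dY y yh

/-- `T` is an optimal test channel: it meets the distortion and private-rate constraints, and its
common information equals the minimum common rate. -/
def IsOptimal (T : TestChannel X Y Xh Yh W) (dX : X → Xh → ℝ) (dY : Y → Yh → ℝ)
    (R₁ R₂ D₁ D₂ : ℝ) (P : X × Y → ℝ) : Prop :=
  T.distX dX P ≤ D₁ ∧ T.distY dY P ≤ D₂ ∧ T.infoX P ≤ R₁ ∧ T.infoY P ≤ R₂ ∧
    T.commonInfo P = minCommonRate dX dY R₁ R₂ D₁ D₂ P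

/-- The conditional tilted information density `ȷ(x, D₁ | w)`, with slope `s = γ₁ / lam₁`. -/
def tiltX (T : TestChannel X Y Xh Yh W) (dX : X → Xh → ℝ) (D₁ s : ℝ) (P : X × Y → ℝ)
    (x : X) (w : W) : ℝ :=
  Real.logb 2 (1 / ∑ xh, T.pXhGivenW P w xh * (2 : ℝ) ^ (s * (D₁ - dX x xh)))

/-- The conditional tilted information density `ȷ(y, D₂ | w)`, with slope `s = γ₂ / lam₂`. -/
def tiltY (T : TestChannel X Y Xh Yh W) (dY : Y → Yh → ℝ) (D₂ s : ℝ) (P : X × Y → ℝ)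
    (y : Y) (w : W) : ℝ :=
  Real.logb 2 (1 / ∑ yh, T.pYhGivenW P w yh * (2 : ℝ) ^ (s * (D₂ - dY y yh)))

/-- The Gray-Wyner tilted information density `ȷ(x, y | R₁, R₂, D₁, D₂)` of the test channel `T`
with multipliers `lam₁, lam₂, γ₁, γ₂`. -/
def tilt (T : TestChannel X Y Xh Yh W) (dX : X → Xh → ℝ) (dY : Y → Yh → ℝ)
    (R₁ R₂ D₁ D₂ lam₁ lam₂ γ₁ γ₂ : ℝ) (P : X × Y → ℝ) (z : X × Y) : ℝ :=
  Real.logb 2 (1 / ∑ w, T.pW P w * (2 : ℝ) ^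
    (lam₁ * (R₁ - T.tiltX dX D₁ (γ₁ / lam₁) P z.1 w) +
      lam₂ * (R₂ - T.tiltY dY D₂ (γ₂ / lam₂) P z.2 w)))

/-- The rate-dispersion function: the variance of the tilted information density under `P`. -/
def dispersion (T : TestChannel X Y Xh Yh W) (dX : X → Xh → ℝ) (dY : Y → Yh → ℝ)
    (R₁ R₂ D₁ D₂ lam₁ lam₂ γ₁ γ₂ : ℝ) (P : X × Y → ℝ) : ℝ :=
  ∑ z, P z * (T.tilt dX dY R₁ R₂ D₁ D₂ lam₁ lam₂ γ₁ γ₂ P z -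
    ∑ z', P z' * T.tilt dX dY R₁ R₂ D₁ D₂ lam₁ lam₂ γ₁ γ₂ P z') ^ 2

end TestChannel

/-- The directions along which the pmf `P` can be perturbed within the pmfs on its support:
for small `v` in this space `P + v` is again a pmf with the same support. -/
def tangentSpace {Z : Type*} [Fintype Z] (P : Z → ℝ) : Submodule ℝ (Z → ℝ) where
  carrier := {v | ∑ z, v z = 0 ∧ ∀ z, P z = 0 → v z = 0}
  zero_mem' := by simp
  add_mem' := by
    rintro a b ⟨ha, ha'⟩ ⟨hb, hb'⟩
    refine ⟨?_, fun z hz => ?_⟩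
    · simp [Finset.sum_add_distrib, ha, hb]
    · simp [ha' z hz, hb' z hz]
  smul_mem' := by
    rintro r a ⟨ha, ha'⟩
    refine ⟨?_, fun z hz => ?_⟩
    · simp [← Finset.mul_sum, ha]
    · simp [ha' z hz]

/-- `f` is twice differentiable in a neighborhood of `a`, with bounded second derivative there.
(On a finite-dimensional space all norms on Hessians are equivalent.) -/
def TwiceDiffBoundedNear {E : Type*} [NormedAddCommGroup E] [NormedSpace ℝ E]
    (f : E → ℝ) (a : E) : Prop :=
  ∃ C : ℝ, ∃ U : Set E, IsOpen U ∧ a ∈ U ∧ ∀ z ∈ U,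
    DifferentiableAt ℝ f z ∧ DifferentiableAt ℝ (fderiv ℝ f) z ∧ ‖fderiv ℝ (fderiv ℝ f) z‖ ≤ C

/-- The complementary cumulative distribution function of the standard Gaussian. -/
def gaussQ (t : ℝ) : ℝ := (ProbabilityTheory.gaussianReal 0 1).real (Set.Ioi t)

/-- The inverse of `gaussQ`, which is a bijection of `ℝ` onto `(0, 1)`. -/
def gaussQInv (ε : ℝ) : ℝ := Function.invFun gaussQ ε

end

end GrayWyner

namespace GrayWyner

noncomputable section

open Real

set_option linter.unusedSectionVars false
set_option linter.unusedVariables false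

/-! ### Convex hulls of compact sets and Gibbs' inequality. -/

section Preliminaries

/-! The one-letter object behind everything is `valueSet`: the vectors (I(X,Y;W), I(X;X̂|W),
I(Y;Ŷ|W), E d_X, E d_Y) of all finite test channels. By Bayes' rule it is a translate of a section
of the convex hull of a compact set, hence convex and compact.

Duality. For positive multipliers, minimizing the Lagrangian over `valueSet` amounts to maximizing E
log f over `featureHull`, the convex hull of the functions A(x)^λ₁ B(y)^λ₂, where A and B are
exponential averages of the distortions under reproduction laws. Gibbs' inequality gives one
direction (`TestChannel.neg_log_mixFeature_le`), exponential tilting the other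
(`exists_valueSet_le_of_mem_featureHull`). A log-optimal g satisfies E[f/g] ≤ 1 for every f in the
hull. In homogeneous form this inequality tensorizes (`tensor_power_bound`); applied to the counting
measures of the private codebooks and summed over the common messages it becomes the one-shot
converse `Code.sum_exp_le`. Linearizing the exponential gives the first-order converse, and
separating convex sets then shows that every point of the rate region dominates a vector of
`valueSet`. Conversely every test channel is achievable, so the minimum common rate is a constrained
minimum over `valueSet`.

Hyperplane. The derivatives of the minimum common rate provide points of `valueSet` near each
single-constraint perturbation; by convexity `valueSet` lies above the hyperplane with normal (1,
λ₁, λ₂, γ₁, γ₂). An optimal test channel therefore minimizes the Lagrangian, meets all four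
constraints with equality, and has Lagrangian density equal to -log g on the support of P, where g
is its own feature mixture. Up to units and an additive constant this is the tilted information
density (`TestChannel.tilt_eq`).

Second order. The one-shot converse bounds the excess probability below by the tail of the block sum
of the centred tilted density h, up to a vanishing term. For the direct part, the optimal channel
misses the budgets for the private rates and the distortions by O(√n) on a typical string. Mixing in
the eight channels that realize the perturbations, with weights O(1/√n) depending only on the type
of the string, repairs all four constraints. The repair changes the common rate by the multipliers
times the shortfalls, so the total common rate is again governed by the block sum of h
(`TestChannel.eventually_exists_code`). Typical-class and covering lemmas turn such mixtures into
codes with logarithmic rate overhead, since there are only polynomially many types. The central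
limit theorem evaluates the same tail in both directions. -/

theorem sum_eq_sum_of_embedding {ι κ F : Type*} [Fintype ι] [Fintype κ] [AddCommMonoid F]
    (e : ι ↪ κ) (f : ι → F) (g : κ → F) (h1 : ∀ i, g (e i) = f i)
    (h2 : ∀ j, (¬ ∃ i, e i = j) → g j = 0) : ∑ j, g j = ∑ i, f i := by
  refine (Finset.sum_of_injOn e e.injective.injOn (by simp) ?_ (fun i _ => (h1 i).symm)).symm
  intro j _ hj
  exact h2 j (by simpa using hj)

/-- By Carathéodory's theorem, dim + 1 points always suffice, so the hull is the continuous image of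
a simplex times a finite power of the set. -/
theorem isCompact_convexHull_of_isCompact {E : Type*} [NormedAddCommGroup E] [NormedSpace ℝ E]
    [FiniteDimensional ℝ E] {s : Set E} (hs : IsCompact s) : IsCompact (convexHull ℝ s) := by
  classical
  set N := Module.finrank ℝ E + 1
  let Φ : (Fin N → ℝ) × (Fin N → E) → E := fun p => ∑ i, p.1 i • p.2 i
  have hΦ : Continuous Φ := by fun_prop
  have hc : IsCompact (stdSimplex ℝ (Fin N) ×ˢ (Set.univ.pi fun _ : Fin N => s)) :=
    (isCompact_stdSimplex ℝ (Fin N)).prod (isCompact_univ_pi fun _ => hs)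
  convert hc.image hΦ using 1
  apply Set.Subset.antisymm
  · intro x hx
    obtain ⟨ι, _, z, w, hz, haff, hw, hw1, rfl⟩ := eq_pos_convex_span_of_mem_convexHull hx
    have hcard : Fintype.card ι ≤ Fintype.card (Fin N) := by
      rw [Fintype.card_fin]
      exact haff.card_le_finrank_succ.trans (Nat.succ_le_succ (Submodule.finrank_le _))
    obtain ⟨e⟩ := Function.Embedding.nonempty_of_card_le hcard
    have hne : Nonempty ι := by
      by_contra h
      rw [not_nonempty_iff] at h
      simp at hw1
    obtain ⟨i₀⟩ := hne
    -- Affine independence may leave fewer than `N` points: the spare slots get weight 0 and an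
    -- arbitrary point of the set.
    refine ⟨(Function.extend e w 0, Function.extend e z (fun _ => z i₀)), ⟨⟨?_, ?_⟩, ?_⟩, ?_⟩
    · intro j
      by_cases h : ∃ i, e i = j
      · obtain ⟨i, rfl⟩ := h
        simp only [e.injective.extend_apply]; exact (hw i).le
      · simp [Function.extend_apply' _ _ _ h]
    · rw [← hw1]
      exact sum_eq_sum_of_embedding e w _ (fun i => e.injective.extend_apply _ _ _)
        (fun j h => by simp [Function.extend_apply' _ _ _ h])
    · intro j _
      by_cases h : ∃ i, e i = j
      · obtain ⟨i, rfl⟩ := h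
        simp only [e.injective.extend_apply]; exact hz ⟨i, rfl⟩
      · simp only [Function.extend_apply' _ _ _ h]; exact hz ⟨i₀, rfl⟩
    · refine sum_eq_sum_of_embedding e (fun i => w i • z i) _ (fun i => ?_) (fun j h => ?_)
      · simp [e.injective.extend_apply]
      · simp [Function.extend_apply' _ _ _ h]
  · rintro _ ⟨⟨w, z⟩, ⟨⟨hw0, hw1⟩, hz⟩, rfl⟩
    exact (convex_convexHull ℝ s).sum_mem (fun i _ => hw0 i) hw1
      (fun i _ => subset_convexHull ℝ s (hz i trivial))

/-- This is log x ≤ x - 1 at x = m/p. The last hypothesis is absolute continuity: when m = 0 < p the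
right side would be 0 by convention and the bound would fail. -/
theorem sub_le_mul_log_div {p m : ℝ} (hp : 0 ≤ p) (hm : 0 ≤ m) (h : 0 < p → 0 < m) :
    p - m ≤ p * log (p / m) := by
  rcases hp.eq_or_lt with rfl | hp'
  · simpa using hm
  · have hm' := h hp'
    have h1 := log_le_sub_one_of_pos (div_pos hm' hp')
    rw [log_div hm'.ne' hp'.ne'] at h1
    rw [log_div hp'.ne' hm'.ne']
    have h2 : p * (m / p - 1) = m - p := by field_simp
    nlinarith

/-- Gibbs' inequality for an unnormalized reference measure. -/
theorem neg_log_sum_le {A : Type*} [Fintype A] {p m : A → ℝ} (hp : p ∈ stdSimplex ℝ A)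
    (hm : ∀ a, 0 ≤ m a) (h : ∀ a, 0 < p a → 0 < m a) :
    -log (∑ a, m a) ≤ ∑ a, p a * log (p a / m a) := by
  have hM : 0 < ∑ a, m a := by
    obtain ⟨a, ha⟩ : ∃ a, 0 < p a := by
      by_contra hcon
      push Not at hcon
      have := hp.2
      rw [Finset.sum_eq_zero (fun a _ => le_antisymm (hcon a) (hp.1 a))] at this
      exact one_ne_zero this.symm
    exact Finset.sum_pos' (fun a _ => hm a) ⟨a, Finset.mem_univ _, h a ha⟩
  set M := ∑ a, m a
  have key : ∀ a, p a - m a / M ≤ p a * log (p a / m a) + p a * log M := by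
    intro a
    refine (sub_le_mul_log_div (hp.1 a) (div_nonneg (hm a) hM.le)
      (fun h' => div_pos (h a h') hM)).trans_eq ?_
    rcases (hp.1 a).eq_or_lt with h0 | h0
    · simp [← h0]
    · rw [div_div_eq_mul_div, mul_div_right_comm, log_mul (div_pos h0 (h a h0)).ne' hM.ne']
      ring
  have := Finset.sum_le_sum fun a (_ : a ∈ Finset.univ) => key a
  rw [Finset.sum_sub_distrib, Finset.sum_add_distrib, ← Finset.sum_mul, ← Finset.sum_div, hp.2,
    div_self hM.ne'] at this
  linarith

theorem sum_mul_log_div_nonneg {A : Type*} [Fintype A] {p m : A → ℝ} (hp : p ∈ stdSimplex ℝ A)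
    (hm : ∀ a, 0 ≤ m a) (h : ∀ a, 0 < p a → 0 < m a) (hm1 : ∑ a, m a ≤ 1) :
    0 ≤ ∑ a, p a * log (p a / m a) := by
  have h1 := neg_log_sum_le hp hm h
  have h2 : log (∑ a, m a) ≤ 0 := log_nonpos (Finset.sum_nonneg fun a _ => hm a) hm1
  linarith

end Preliminaries

/-! ### Mutual information in nats, as a functional of an input law and a channel. -/

section Information

theorem log_two_mul_condMutualInfo {A B C : Type*} [Fintype A] [Fintype B] [Fintype C]
    (p : A → C → ℝ) (κ : A → C → B → ℝ) (hκ : ∀ a c, κ a c ∈ stdSimplex ℝ B) :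
    log 2 * condMutualInfo (fun a b c => p a c * κ a c b) =
      ∑ a, ∑ c, p a c * ∑ b, κ a c b *
        log (κ a c b / ((∑ a', p a' c * κ a' c b) / ∑ a', p a' c)) := by
  have h2 : log 2 ≠ 0 := (log_pos one_lt_two).ne'
  unfold condMutualInfo
  rw [Finset.mul_sum]
  refine Finset.sum_congr rfl fun a _ => ?_
  rw [Finset.sum_comm, Finset.mul_sum]
  refine Finset.sum_congr rfl fun c _ => ?_
  rw [Finset.mul_sum, Finset.mul_sum]
  refine Finset.sum_congr rfl fun b _ => ?_
  simp only [← Finset.mul_sum, (hκ _ _).2, mul_one]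
  rcases eq_or_ne (p a c) 0 with h0 | h0
  · simp [h0]
  · rw [mul_assoc (p a c) (κ a c b) (∑ x, p x c), mul_div_mul_left _ _ h0, ← div_div_eq_mul_div, logb]
    field_simp

/-- The mutual information, in nats, of input law `m` and channel `κ`. -/
def channelInfo {A B : Type*} [Fintype A] [Fintype B] (m : A → ℝ) (κ : A → B → ℝ) : ℝ :=
  ∑ b, negMulLog (∑ a, m a * κ a b) - ∑ a, m a * ∑ b, negMulLog (κ a b)

/-- The entropy form contains no quotients, and `negMulLog` is continuous at 0, so continuity holds
at every point, including laws with vanishing masses. Compactness of the value set depends on this.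
-/
theorem continuous_channelInfo {A B : Type*} [Fintype A] [Fintype B] :
    Continuous fun r : (A → ℝ) × (A → B → ℝ) => channelInfo r.1 r.2 := by
  unfold channelInfo
  have := continuous_negMulLog
  fun_prop

theorem channelInfo_eq {A B : Type*} [Fintype A] [Fintype B] (m : A → ℝ) (κ : A → B → ℝ)
    (hm : ∀ a, 0 ≤ m a) (hκ : ∀ a, κ a ∈ stdSimplex ℝ B) :
    ∑ a, m a * ∑ b, κ a b * log (κ a b / ∑ a', m a' * κ a' b) = channelInfo m κ := by
  have h1 : ∀ a b, m a * (κ a b * log (κ a b / ∑ a', m a' * κ a' b)) =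
      m a * κ a b * -log (∑ a', m a' * κ a' b) - m a * negMulLog (κ a b) := by
    intro a b
    rcases (mul_nonneg (hm a) ((hκ a).1 b)).eq_or_lt with h | h
    · rcases mul_eq_zero.1 h.symm with h | h <;> simp [h]
    · have hk : κ a b ≠ 0 := right_ne_zero_of_mul h.ne'
      have hs : 0 < ∑ a', m a' * κ a' b :=
        Finset.sum_pos' (fun a _ => mul_nonneg (hm a) ((hκ a).1 b)) ⟨a, Finset.mem_univ _, h⟩
      rw [log_div hk hs.ne', negMulLog]
      ring
  simp only [Finset.mul_sum, h1, Finset.sum_sub_distrib, channelInfo]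
  congr 1
  rw [Finset.sum_comm]
  refine Finset.sum_congr rfl fun b _ => ?_
  rw [← Finset.sum_mul, negMulLog]
  ring

theorem log_two_mul_condMutualInfo_eq_sum {A B C : Type*} [Fintype A] [Fintype B] [Fintype C]
    (p : A → C → ℝ) (κ : A → C → B → ℝ) (hκ : ∀ a c, κ a c ∈ stdSimplex ℝ B)
    (q : C → ℝ) (m : C → A → ℝ) (hm : ∀ c, m c ∈ stdSimplex ℝ A)
    (hp : ∀ a c, p a c = q c * m c a) :
    log 2 * condMutualInfo (fun a b c => p a c * κ a c b) =
      ∑ c, q c * channelInfo (m c) (fun a => κ a c) := by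
  rw [log_two_mul_condMutualInfo _ _ hκ, Finset.sum_comm]
  refine Finset.sum_congr rfl fun c _ => ?_
  rw [← channelInfo_eq _ _ (hm c).1 (fun a => hκ a c), Finset.mul_sum]
  refine Finset.sum_congr rfl fun a _ => ?_
  simp only [hp]
  rcases eq_or_ne (q c) 0 with h0 | h0
  · simp [h0]
  · simp only [mul_assoc, ← Finset.mul_sum, (hm c).2, mul_one, mul_div_cancel_left₀ _ h0]

end Information

/-! ### Marginals, log-likelihood ratios and nonnegativity for a test channel. -/

namespace TestChannel

variable {X Y Xh Yh W : Type*} [Fintype X] [Fintype Y] [Fintype Xh] [Fintype Yh] [Fintype W]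
  (T : TestChannel X Y Xh Yh W) {P : X × Y → ℝ}

theorem pW_eq_sum (P : X × Y → ℝ) (w : W) : T.pW P w = ∑ z : X × Y, P z * T.chW z.1 z.2 w := by
  rw [Fintype.sum_prod_type]; rfl

theorem sum_pXW (P : X × Y → ℝ) (w : W) : ∑ x, T.pXW P x w = T.pW P w := rfl

theorem sum_pYW (P : X × Y → ℝ) (w : W) : ∑ y, T.pYW P y w = T.pW P w := by
  simp only [pYW, pW]; rw [Finset.sum_comm]

theorem pXW_nonneg (hP : ∀ z, 0 ≤ P z) (x : X) (w : W) : 0 ≤ T.pXW P x w :=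
  Finset.sum_nonneg fun y _ => mul_nonneg (hP _) ((T.chW_mem x y).1 w)

theorem pYW_nonneg (hP : ∀ z, 0 ≤ P z) (y : Y) (w : W) : 0 ≤ T.pYW P y w :=
  Finset.sum_nonneg fun x _ => mul_nonneg (hP _) ((T.chW_mem x y).1 w)

theorem pW_nonneg (hP : ∀ z, 0 ≤ P z) (w : W) : 0 ≤ T.pW P w :=
  Finset.sum_nonneg fun x _ => T.pXW_nonneg hP x w

theorem pW_mem (hP : P ∈ stdSimplex ℝ (X × Y)) : T.pW P ∈ stdSimplex ℝ W := by
  refine ⟨T.pW_nonneg hP.1, ?_⟩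
  simp only [pW_eq_sum]
  rw [Finset.sum_comm]
  simp only [← Finset.mul_sum, (T.chW_mem _ _).2, mul_one, hP.2]

theorem mul_chW_le_pW (hP : ∀ z, 0 ≤ P z) (z : X × Y) (w : W) :
    P z * T.chW z.1 z.2 w ≤ T.pW P w := by
  rw [pW_eq_sum]
  exact Finset.single_le_sum (f := fun z : X × Y => P z * T.chW z.1 z.2 w)
    (fun z _ => mul_nonneg (hP z) ((T.chW_mem _ _).1 w)) (Finset.mem_univ z)

theorem mul_chW_le_pXW (hP : ∀ z, 0 ≤ P z) (x : X) (y : Y) (w : W) :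
    P (x, y) * T.chW x y w ≤ T.pXW P x w :=
  Finset.single_le_sum (f := fun y => P (x, y) * T.chW x y w)
    (fun y _ => mul_nonneg (hP _) ((T.chW_mem _ _).1 w)) (Finset.mem_univ y)

theorem mul_chW_le_pYW (hP : ∀ z, 0 ≤ P z) (x : X) (y : Y) (w : W) :
    P (x, y) * T.chW x y w ≤ T.pYW P y w :=
  Finset.single_le_sum (f := fun x => P (x, y) * T.chW x y w)
    (fun x _ => mul_nonneg (hP _) ((T.chW_mem _ _).1 w)) (Finset.mem_univ x)

theorem pXhGivenW_mem (hP : ∀ z, 0 ≤ P z) {w : W} (hw : 0 < T.pW P w) :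
    T.pXhGivenW P w ∈ stdSimplex ℝ Xh := by
  refine ⟨fun xh => div_nonneg (Finset.sum_nonneg fun x _ =>
    mul_nonneg (T.pXW_nonneg hP x w) ((T.chX_mem x w).1 xh)) hw.le, ?_⟩
  simp only [pXhGivenW]
  rw [← Finset.sum_div, Finset.sum_comm]
  simp only [← Finset.mul_sum, (T.chX_mem _ _).2, mul_one, sum_pXW, div_self hw.ne']

theorem pYhGivenW_mem (hP : ∀ z, 0 ≤ P z) {w : W} (hw : 0 < T.pW P w) :
    T.pYhGivenW P w ∈ stdSimplex ℝ Yh := by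
  refine ⟨fun yh => div_nonneg (Finset.sum_nonneg fun y _ =>
    mul_nonneg (T.pYW_nonneg hP y w) ((T.chY_mem y w).1 yh)) hw.le, ?_⟩
  simp only [pYhGivenW]
  rw [← Finset.sum_div, Finset.sum_comm]
  simp only [← Finset.mul_sum, (T.chY_mem _ _).2, mul_one, sum_pYW, div_self hw.ne']

theorem pXhGivenW_nonneg (hP : ∀ z, 0 ≤ P z) (w : W) (xh : Xh) : 0 ≤ T.pXhGivenW P w xh :=
  div_nonneg (Finset.sum_nonneg fun x _ =>
    mul_nonneg (T.pXW_nonneg hP x w) ((T.chX_mem x w).1 xh)) (T.pW_nonneg hP w)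

theorem pYhGivenW_nonneg (hP : ∀ z, 0 ≤ P z) (w : W) (yh : Yh) : 0 ≤ T.pYhGivenW P w yh :=
  div_nonneg (Finset.sum_nonneg fun x _ =>
    mul_nonneg (T.pYW_nonneg hP x w) ((T.chY_mem x w).1 yh)) (T.pW_nonneg hP w)

theorem pXhGivenW_pos (hP : ∀ z, 0 ≤ P z) {x : X} {w : W} (hw : 0 < T.pXW P x w) {xh : Xh}
    (h : 0 < T.chX x w xh) : 0 < T.pXhGivenW P w xh := by
  refine div_pos (Finset.sum_pos' (fun x _ =>
    mul_nonneg (T.pXW_nonneg hP x w) ((T.chX_mem x w).1 xh)) ⟨x, Finset.mem_univ _, mul_pos hw h⟩) ?_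
  exact Finset.sum_pos' (fun x _ => T.pXW_nonneg hP x w) ⟨x, Finset.mem_univ _, hw⟩

theorem pYhGivenW_pos (hP : ∀ z, 0 ≤ P z) {y : Y} {w : W} (hw : 0 < T.pYW P y w) {yh : Yh}
    (h : 0 < T.chY y w yh) : 0 < T.pYhGivenW P w yh := by
  refine div_pos (Finset.sum_pos' (fun x _ =>
    mul_nonneg (T.pYW_nonneg hP x w) ((T.chY_mem x w).1 yh)) ⟨y, Finset.mem_univ _, mul_pos hw h⟩) ?_
  rw [← sum_pYW]
  exact Finset.sum_pos' (fun x _ => T.pYW_nonneg hP x w) ⟨y, Finset.mem_univ _, hw⟩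

/-- The expected log-likelihood ratio of the auxiliary letter, in nats, given the source letter. -/
def denW (P : X × Y → ℝ) (z : X × Y) : ℝ :=
  ∑ w, T.chW z.1 z.2 w * log (T.chW z.1 z.2 w / T.pW P w)

/-- The expected log-likelihood ratio of the first reproduction, in nats. -/
def denX (P : X × Y → ℝ) (x : X) (w : W) : ℝ :=
  ∑ xh, T.chX x w xh * log (T.chX x w xh / T.pXhGivenW P w xh)

/-- The expected log-likelihood ratio of the second reproduction, in nats. -/
def denY (P : X × Y → ℝ) (y : Y) (w : W) : ℝ :=
  ∑ yh, T.chY y w yh * log (T.chY y w yh / T.pYhGivenW P w yh)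

theorem log_two_mul_commonInfo (P : X × Y → ℝ) :
    log 2 * T.commonInfo P = ∑ z, P z * T.denW P z := by
  have h2 : log 2 ≠ 0 := (log_pos one_lt_two).ne'
  unfold commonInfo mutualInfo denW
  rw [Finset.mul_sum]
  refine Finset.sum_congr rfl fun z _ => ?_
  rw [Finset.mul_sum, Finset.mul_sum]
  refine Finset.sum_congr rfl fun w _ => ?_
  rw [← pW_eq_sum, ← Finset.mul_sum, (T.chW_mem _ _).2, mul_one]
  rcases eq_or_ne (P z) 0 with h0 | h0
  · simp [h0]
  · rw [mul_div_mul_left _ _ h0, logb]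
    field_simp

theorem log_two_mul_infoX (P : X × Y → ℝ) :
    log 2 * T.infoX P = ∑ x, ∑ w, T.pXW P x w * T.denX P x w :=
  log_two_mul_condMutualInfo (T.pXW P) T.chX T.chX_mem

theorem log_two_mul_infoY (P : X × Y → ℝ) :
    log 2 * T.infoY P = ∑ y, ∑ w, T.pYW P y w * T.denY P y w := by
  have := log_two_mul_condMutualInfo (T.pYW P) T.chY T.chY_mem
  simp only [sum_pYW] at this
  exact this

theorem commonInfo_nonneg (hP : P ∈ stdSimplex ℝ (X × Y)) : 0 ≤ T.commonInfo P := by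
  refine nonneg_of_mul_nonneg_right ?_ (log_pos one_lt_two)
  rw [log_two_mul_commonInfo]
  refine Finset.sum_nonneg fun z _ => ?_
  rcases (hP.1 z).eq_or_lt with h0 | h0
  · simp [← h0]
  · exact mul_nonneg h0.le (sum_mul_log_div_nonneg (T.chW_mem _ _) (T.pW_nonneg hP.1)
      (fun w hw => (mul_pos h0 hw).trans_le (T.mul_chW_le_pW hP.1 z w)) (T.pW_mem hP).2.le)

theorem infoX_nonneg (hP : ∀ z, 0 ≤ P z) : 0 ≤ T.infoX P := by
  refine nonneg_of_mul_nonneg_right ?_ (log_pos one_lt_two)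
  rw [log_two_mul_infoX]
  refine Finset.sum_nonneg fun x _ => Finset.sum_nonneg fun w _ => ?_
  rcases (T.pXW_nonneg hP x w).eq_or_lt with h0 | h0
  · simp [← h0]
  · have hw : 0 < T.pW P w := Finset.sum_pos' (fun x _ => T.pXW_nonneg hP x w)
      ⟨x, Finset.mem_univ _, h0⟩
    exact mul_nonneg h0.le (sum_mul_log_div_nonneg (T.chX_mem _ _) (T.pXhGivenW_nonneg hP w)
      (fun xh h => T.pXhGivenW_pos hP h0 h) (T.pXhGivenW_mem hP hw).2.le)

theorem infoY_nonneg (hP : ∀ z, 0 ≤ P z) : 0 ≤ T.infoY P := by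
  refine nonneg_of_mul_nonneg_right ?_ (log_pos one_lt_two)
  rw [log_two_mul_infoY]
  refine Finset.sum_nonneg fun y _ => Finset.sum_nonneg fun w _ => ?_
  rcases (T.pYW_nonneg hP y w).eq_or_lt with h0 | h0
  · simp [← h0]
  · have hw : 0 < T.pW P w := by
      rw [← sum_pYW]
      exact Finset.sum_pos' (fun x _ => T.pYW_nonneg hP x w) ⟨y, Finset.mem_univ _, h0⟩
    exact mul_nonneg h0.le (sum_mul_log_div_nonneg (T.chY_mem _ _) (T.pYhGivenW_nonneg hP w)
      (fun yh h => T.pYhGivenW_pos hP h0 h) (T.pYhGivenW_mem hP hw).2.le)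

theorem distX_nonneg (hP : ∀ z, 0 ≤ P z) {dX : X → Xh → ℝ} (hd : ∀ x xh, 0 ≤ dX x xh) :
    0 ≤ T.distX dX P :=
  Finset.sum_nonneg fun x _ => Finset.sum_nonneg fun w _ => Finset.sum_nonneg fun xh _ =>
    mul_nonneg (mul_nonneg (T.pXW_nonneg hP x w) ((T.chX_mem x w).1 xh)) (hd x xh)

theorem distY_nonneg (hP : ∀ z, 0 ≤ P z) {dY : Y → Yh → ℝ} (hd : ∀ y yh, 0 ≤ dY y yh) :
    0 ≤ T.distY dY P :=
  Finset.sum_nonneg fun x _ => Finset.sum_nonneg fun w _ => Finset.sum_nonneg fun xh _ =>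
    mul_nonneg (mul_nonneg (T.pYW_nonneg hP x w) ((T.chY_mem x w).1 xh)) (hd x xh)

end TestChannel

/-! ### The set of attainable information and distortion vectors is convex and compact. -/

section ValueSet

variable {X Y Xh Yh W : Type*} [Fintype X] [Fintype Y] [Fintype Xh] [Fintype Yh] [Fintype W]

/-- The information and distortion quantities of a test channel. -/
def TestChannel.vals (T : TestChannel X Y Xh Yh W) (dX : X → Xh → ℝ) (dY : Y → Yh → ℝ)
    (P : X × Y → ℝ) : Fin 5 → ℝ :=
  ![T.commonInfo P, T.infoX P, T.infoY P, T.distX dX P, T.distY dY P]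

/-- The contribution of one value of the auxiliary variable, with source posterior `ρ` and
reproduction channels `κ`, `κ'`, to the quantities of a test channel. -/
def atomVals (dX : X → Xh → ℝ) (dY : Y → Yh → ℝ) (ρ : X × Y → ℝ) (κ : X → Xh → ℝ)
    (κ' : Y → Yh → ℝ) : Fin 5 → ℝ :=
  ![-(∑ z, negMulLog (ρ z)) / log 2, channelInfo (fun x => ∑ y, ρ (x, y)) κ / log 2,
    channelInfo (fun y => ∑ x, ρ (x, y)) κ' / log 2,
    ∑ x, ∑ xh, (∑ y, ρ (x, y)) * κ x xh * dX x xh,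
    ∑ y, ∑ yh, (∑ x, ρ (x, y)) * κ' y yh * dY y yh]

theorem continuous_atomVals (dX : X → Xh → ℝ) (dY : Y → Yh → ℝ) :
    Continuous fun r : (X × Y → ℝ) × (X → Xh → ℝ) × (Y → Yh → ℝ) =>
      atomVals dX dY r.1 r.2.1 r.2.2 := by
  have h0 := continuous_negMulLog
  have h1 : Continuous fun r : (X × Y → ℝ) × (X → Xh → ℝ) × (Y → Yh → ℝ) =>
      channelInfo (fun x => ∑ y, r.1 (x, y)) r.2.1 :=
    continuous_channelInfo.comp
      (f := fun r : (X × Y → ℝ) × (X → Xh → ℝ) × (Y → Yh → ℝ) =>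
        ((fun x => ∑ y, r.1 (x, y)), r.2.1)) (by fun_prop)
  have h2 : Continuous fun r : (X × Y → ℝ) × (X → Xh → ℝ) × (Y → Yh → ℝ) =>
      channelInfo (fun y => ∑ x, r.1 (x, y)) r.2.2 :=
    continuous_channelInfo.comp
      (f := fun r : (X × Y → ℝ) × (X → Xh → ℝ) × (Y → Yh → ℝ) =>
        ((fun y => ∑ x, r.1 (x, y)), r.2.2)) (by fun_prop)
  refine continuous_pi fun i => ?_
  fin_cases i <;> simp only [atomVals, Fin.zero_eta, Fin.mk_one, Fin.reduceFinMk,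
    Matrix.cons_val] <;> fun_prop

/-- Since I(X,Y;W) = H(X,Y) - H(X,Y|W), and the other four quantities are averages over w, each
coordinate is a constant plus an average of functions of the posterior and of the reproduction
channels at w. The posterior is only pinned down where w has positive mass; any law may be used
elsewhere. -/
theorem TestChannel.vals_eq (T : TestChannel X Y Xh Yh W) (dX : X → Xh → ℝ) (dY : Y → Yh → ℝ)
    (P : X × Y → ℝ) (ρ : W → X × Y → ℝ) (hρ : ∀ w, ρ w ∈ stdSimplex ℝ (X × Y))
    (h : ∀ z w, P z * T.chW z.1 z.2 w = T.pW P w * ρ w z) :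
    T.vals dX dY P = ![(∑ z, negMulLog (P z)) / log 2, 0, 0, 0, 0] +
      ∑ w, T.pW P w • atomVals dX dY (ρ w) (fun x => T.chX x w) (fun y => T.chY y w) := by
  have h2 : log 2 ≠ 0 := (log_pos one_lt_two).ne'
  have hX : ∀ x w, T.pXW P x w = T.pW P w * ∑ y, ρ w (x, y) := by
    intro x w
    rw [Finset.mul_sum]
    exact Finset.sum_congr rfl fun y _ => h (x, y) w
  have hY : ∀ y w, T.pYW P y w = T.pW P w * ∑ x, ρ w (x, y) := by
    intro y w
    rw [Finset.mul_sum]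
    exact Finset.sum_congr rfl fun x _ => h (x, y) w
  have hρX : ∀ w, (fun x => ∑ y, ρ w (x, y)) ∈ stdSimplex ℝ X := fun w =>
    ⟨fun x => Finset.sum_nonneg fun y _ => (hρ w).1 _, by
      rw [← Fintype.sum_prod_type]; exact (hρ w).2⟩
  have hρY : ∀ w, (fun y => ∑ x, ρ w (x, y)) ∈ stdSimplex ℝ Y := fun w =>
    ⟨fun x => Finset.sum_nonneg fun y _ => (hρ w).1 _, by
      rw [← Fintype.sum_prod_type_right]; exact (hρ w).2⟩
  ext i
  rw [Pi.add_apply, Finset.sum_apply]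
  fin_cases i <;> simp only [TestChannel.vals, atomVals, Fin.zero_eta, Fin.mk_one, Fin.reduceFinMk,
    Matrix.cons_val, Pi.smul_apply, smul_eq_mul, zero_add]
  · apply mul_left_cancel₀ h2
    have e : ∀ z w, P z * (T.chW z.1 z.2 w * log (T.chW z.1 z.2 w / T.pW P w)) =
        -(T.pW P w * negMulLog (ρ w z)) - P z * T.chW z.1 z.2 w * log (P z) := by
      intro z w
      rcases eq_or_ne (P z * T.chW z.1 z.2 w) 0 with h0 | h0
      · have h1 := h0
        rw [h] at h1
        rw [← mul_assoc, h0]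
        rcases mul_eq_zero.1 h1 with h1 | h1 <;> simp [h1]
      · have h1 := h0
        rw [h] at h1
        have hq := left_ne_zero_of_mul h1
        have hp := right_ne_zero_of_mul h1
        have e1 : T.chW z.1 z.2 w / T.pW P w = ρ w z / P z := by
          rw [div_eq_div_iff hq (left_ne_zero_of_mul h0), mul_comm, h, mul_comm]
        rw [e1, log_div hp (left_ne_zero_of_mul h0), ← mul_assoc, mul_sub, negMulLog]
        congr 1
        rw [h]; ring
    rw [T.log_two_mul_commonInfo]
    simp only [TestChannel.denW, Finset.mul_sum, e, Finset.sum_sub_distrib]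
    simp only [← Finset.sum_mul, ← Finset.mul_sum, (T.chW_mem _ _).2, mul_one]
    rw [Finset.sum_comm, mul_add, mul_div_cancel₀ _ h2, Finset.mul_sum, add_comm]
    simp only [Finset.sum_neg_distrib, ← Finset.mul_sum, sub_eq_add_neg]
    congr 1
    · rw [← Finset.sum_neg_distrib, Finset.mul_sum]
      refine Finset.sum_congr rfl fun w _ => ?_
      field_simp
    · rw [← Finset.sum_neg_distrib]
      refine Finset.sum_congr rfl fun w _ => ?_
      rw [negMulLog]; ring
  · apply mul_left_cancel₀ h2
    have := log_two_mul_condMutualInfo_eq_sum (T.pXW P) T.chX T.chX_mem _ _ hρX hX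
    refine this.trans ?_
    rw [Finset.mul_sum]
    exact Finset.sum_congr rfl fun w _ => by field_simp
  · apply mul_left_cancel₀ h2
    have := log_two_mul_condMutualInfo_eq_sum (T.pYW P) T.chY T.chY_mem _ _ hρY hY
    refine this.trans ?_
    rw [Finset.mul_sum]
    exact Finset.sum_congr rfl fun w _ => by field_simp
  · unfold TestChannel.distX
    rw [Finset.sum_comm]
    simp only [hX, Finset.mul_sum (s := Finset.univ (α := X)),
      Finset.mul_sum (s := Finset.univ (α := Xh)), mul_assoc]
  · unfold TestChannel.distY
    rw [Finset.sum_comm]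
    simp only [hY, Finset.mul_sum (s := Finset.univ (α := Y)),
      Finset.mul_sum (s := Finset.univ (α := Yh)), mul_assoc]

/-- The set of information and distortion quantities of all finite test channels. -/
def valueSet (dX : X → Xh → ℝ) (dY : Y → Yh → ℝ) (P : X × Y → ℝ) : Set (Fin 5 → ℝ) :=
  {v | ∃ (k : ℕ) (T : TestChannel X Y Xh Yh (Fin k)), T.vals dX dY P = v}

/-- The same test channel with relabelled auxiliary alphabet. -/
def TestChannel.relabel {W' : Type*} [Fintype W'] (T : TestChannel X Y Xh Yh W) (e : W' ≃ W) :
    TestChannel X Y Xh Yh W' where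
  chW x y w := T.chW x y (e w)
  chX x w := T.chX x (e w)
  chY y w := T.chY y (e w)
  chW_mem x y := ⟨fun w => (T.chW_mem x y).1 _, by
    rw [e.sum_comp (fun w => T.chW x y w)]; exact (T.chW_mem x y).2⟩
  chX_mem x w := T.chX_mem x (e w)
  chY_mem y w := T.chY_mem y (e w)

/-- Bayes' rule. Letters w of mass zero are given the posterior P, so that every posterior is a pmf.
-/
theorem TestChannel.exists_posterior (T : TestChannel X Y Xh Yh W) {P : X × Y → ℝ}
    (hP : P ∈ stdSimplex ℝ (X × Y)) :
    ∃ ρ : W → X × Y → ℝ, (∀ w, ρ w ∈ stdSimplex ℝ (X × Y)) ∧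
      ∀ z w, P z * T.chW z.1 z.2 w = T.pW P w * ρ w z := by
  classical
  refine ⟨fun w => if T.pW P w = 0 then P else fun z => P z * T.chW z.1 z.2 w / T.pW P w,
    fun w => ?_, fun z w => ?_⟩
  · by_cases h : T.pW P w = 0
    · simpa [h] using hP
    · simp only [h, if_false]
      refine ⟨fun z => div_nonneg (mul_nonneg (hP.1 z) ((T.chW_mem _ _).1 w))
        (T.pW_nonneg hP.1 w), ?_⟩
      rw [← Finset.sum_div, ← T.pW_eq_sum, div_self h]
  · by_cases h : T.pW P w = 0
    · simp only [h, if_true, zero_mul]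
      exact le_antisymm (h ▸ T.mul_chW_le_pW hP.1 z w)
        (mul_nonneg (hP.1 z) ((T.chW_mem _ _).1 w))
    · simp only [h, if_false, mul_div_cancel₀ _ h]

theorem TestChannel.vals_relabel {W' : Type*} [Fintype W'] (T : TestChannel X Y Xh Yh W)
    (e : W' ≃ W) (dX : X → Xh → ℝ) (dY : Y → Yh → ℝ) {P : X × Y → ℝ}
    (hP : P ∈ stdSimplex ℝ (X × Y)) : (T.relabel e).vals dX dY P = T.vals dX dY P := by
  obtain ⟨ρ, hρ, h⟩ := T.exists_posterior hP
  have hp : ∀ w, (T.relabel e).pW P w = T.pW P (e w) := fun w => rfl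
  rw [T.vals_eq dX dY P ρ hρ h, (T.relabel e).vals_eq dX dY P (fun w => ρ (e w)) (fun w => hρ _)
    (fun z w => h z (e w))]
  congr 1
  exact e.sum_comp fun w =>
    T.pW P w • atomVals dX dY (ρ w) (fun x => T.chX x w) (fun y => T.chY y w)

theorem TestChannel.vals_mem_valueSet (T : TestChannel X Y Xh Yh W) (dX : X → Xh → ℝ)
    (dY : Y → Yh → ℝ) {P : X × Y → ℝ} (hP : P ∈ stdSimplex ℝ (X × Y)) :
    T.vals dX dY P ∈ valueSet dX dY P :=
  ⟨_, T.relabel (Fintype.equivFin W).symm, T.vals_relabel _ dX dY hP⟩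

/-- The convex hull of the graph of the one-letter contributions. -/
def atomHull (dX : X → Xh → ℝ) (dY : Y → Yh → ℝ) : Set ((X × Y → ℝ) × (Fin 5 → ℝ)) :=
  convexHull ℝ ((fun r : (X × Y → ℝ) × (X → Xh → ℝ) × (Y → Yh → ℝ) =>
    (r.1, atomVals dX dY r.1 r.2.1 r.2.2)) ''
      (stdSimplex ℝ (X × Y) ×ˢ (Set.univ.pi fun _ => stdSimplex ℝ Xh) ×ˢ
        (Set.univ.pi fun _ => stdSimplex ℝ Yh)))

theorem isCompact_atomHull (dX : X → Xh → ℝ) (dY : Y → Yh → ℝ) :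
    IsCompact (atomHull dX dY) := by
  refine isCompact_convexHull_of_isCompact (IsCompact.image ?_
    (continuous_fst.prodMk (continuous_atomVals dX dY)))
  exact (isCompact_stdSimplex ℝ _).prod ((isCompact_univ_pi fun _ => isCompact_stdSimplex ℝ _).prod
    (isCompact_univ_pi fun _ => isCompact_stdSimplex ℝ _))

/-- A test channel is the same as a finite mixture of triples (posterior, two reproduction channels)
whose posteriors average to P. Fixing the average selects a section of the compact convex
`atomHull`, and `Prod.snd` keeps the quantities; compactness and convexity follow at once. -/
theorem valueSet_eq (dX : X → Xh → ℝ) (dY : Y → Yh → ℝ) {P : X × Y → ℝ}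
    (hP : P ∈ stdSimplex ℝ (X × Y)) :
    valueSet dX dY P = (fun t => ![(∑ z, negMulLog (P z)) / log 2, 0, 0, 0, 0] + t) ''
      (Prod.snd '' (atomHull dX dY ∩ {p | p.1 = P})) := by
  classical
  apply Set.Subset.antisymm
  · rintro _ ⟨k, T, rfl⟩
    obtain ⟨ρ, hρ, h⟩ := T.exists_posterior hP
    refine ⟨_, ⟨(P, ∑ w, T.pW P w • atomVals dX dY (ρ w) (fun x => T.chX x w)
      (fun y => T.chY y w)), ⟨?_, rfl⟩, rfl⟩, (T.vals_eq dX dY P ρ hρ h).symm⟩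
    have : (P, ∑ w, T.pW P w • atomVals dX dY (ρ w) (fun x => T.chX x w) (fun y => T.chY y w)) =
        ∑ w, T.pW P w • (ρ w, atomVals dX dY (ρ w) (fun x => T.chX x w) (fun y => T.chY y w)) := by
      ext z
      · simp only [Prod.fst_sum, Prod.smul_fst, Finset.sum_apply, Pi.smul_apply, smul_eq_mul, ← h,
          ← Finset.mul_sum, (T.chW_mem _ _).2, mul_one]
      · simp only [Prod.snd_sum, Prod.smul_snd]
    rw [this]
    refine (convex_convexHull ℝ _).sum_mem (fun w _ => T.pW_nonneg hP.1 w) (T.pW_mem hP).2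
      fun w _ => subset_convexHull ℝ _ ⟨(ρ w, fun x => T.chX x w, fun y => T.chY y w),
        ⟨hρ w, fun x _ => T.chX_mem x w, fun y _ => T.chY_mem y w⟩, rfl⟩
  · rintro _ ⟨_, ⟨⟨P', t⟩, ⟨hmem, rfl⟩, rfl⟩, rfl⟩
    obtain ⟨ι, _, p, a, hp, hp1, ha, hsum⟩ := mem_convexHull_iff_exists_fintype.1 hmem
    choose r hr hra using ha
    have e1 : ∀ z, ∑ i, p i * (r i).1 z = P' z := by
      intro z
      have := congrFun (congrArg Prod.fst hsum) z
      simpa [← hra, Prod.fst_sum, Finset.sum_apply] using this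
    have e2 : ∑ i, p i • atomVals dX dY (r i).1 (r i).2.1 (r i).2.2 = t := by
      have := congrArg Prod.snd hsum
      simpa [← hra, Prod.snd_sum] using this
    have e0 : ∀ i z, 0 ≤ p i * (r i).1 z := fun i z => mul_nonneg (hp i) ((hr i).1.1 z)
    have ez : ∀ z, P' z = 0 → ∀ i, p i * (r i).1 z = 0 := fun z hz i =>
      (Finset.sum_eq_zero_iff_of_nonneg (fun i _ => e0 i z)).1 ((e1 z).trans hz) i
        (Finset.mem_univ i)
    let T : TestChannel X Y Xh Yh ι :=
      -- Bayes' rule backwards; at a source letter of probability zero the channel is irrelevant and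
      -- the mixture weights serve as a default.
      { chW := fun x y i => if P' (x, y) = 0 then p i else p i * (r i).1 (x, y) / P' (x, y)
        chX := fun x i => (r i).2.1 x
        chY := fun y i => (r i).2.2 y
        chW_mem := fun x y => by
          by_cases h : P' (x, y) = 0
          · simpa only [h, if_true] using ⟨hp, hp1⟩
          · simp only [h, if_false]
            refine ⟨fun i => div_nonneg (e0 _ _) (hP.1 _), ?_⟩
            rw [← Finset.sum_div, e1, div_self h]
        chX_mem := fun x i => (hr i).2.1 x trivial
        chY_mem := fun y i => (hr i).2.2 y trivial }
    have hT : ∀ z i, P' z * T.chW z.1 z.2 i = p i * (r i).1 z := by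
      intro z i
      by_cases h : P' z = 0
      · rw [ez z h, h, zero_mul]
      · simp only [T, h, if_false]
        rw [mul_div_cancel₀ _ h]
    have hpW : ∀ i, T.pW P' i = p i := by
      intro i
      rw [T.pW_eq_sum]
      simp only [hT, ← Finset.mul_sum, (hr i).1.2, mul_one]
    have := T.vals_eq dX dY P' (fun i => (r i).1) (fun i => (hr i).1) (fun z i => by
      rw [hT, hpW])
    simp only [hpW] at this
    show _ + t ∈ _
    rw [← e2]
    rw [show (∑ i, p i • atomVals dX dY (r i).1 (r i).2.1 (r i).2.2) =
      ∑ i, p i • atomVals dX dY (r i).1 (fun x => T.chX x i) (fun y => T.chY y i) from rfl, ← this]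
    exact T.vals_mem_valueSet dX dY hP

theorem isCompact_valueSet (dX : X → Xh → ℝ) (dY : Y → Yh → ℝ) {P : X × Y → ℝ}
    (hP : P ∈ stdSimplex ℝ (X × Y)) : IsCompact (valueSet dX dY P) := by
  rw [valueSet_eq dX dY hP]
  refine (((isCompact_atomHull dX dY).inter_right ?_).image continuous_snd).image
    (continuous_const.add continuous_id)
  exact isClosed_eq continuous_fst continuous_const

theorem convex_valueSet (dX : X → Xh → ℝ) (dY : Y → Yh → ℝ) {P : X × Y → ℝ}
    (hP : P ∈ stdSimplex ℝ (X × Y)) : Convex ℝ (valueSet dX dY P) := by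
  rw [valueSet_eq dX dY hP]
  refine Convex.translate (Convex.is_linear_image ?_ (LinearMap.snd ℝ (X × Y → ℝ) (Fin 5 → ℝ)).isLinear) _
  refine (convex_convexHull ℝ _).inter ?_
  exact (convex_singleton P).is_linear_preimage (LinearMap.fst ℝ (X × Y → ℝ) (Fin 5 → ℝ)).isLinear

theorem valueSet_nonneg {dX : X → Xh → ℝ} {dY : Y → Yh → ℝ} {P : X × Y → ℝ}
    (hP : P ∈ stdSimplex ℝ (X × Y)) (hdX : ∀ x xh, 0 ≤ dX x xh) (hdY : ∀ y yh, 0 ≤ dY y yh)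
    {v : Fin 5 → ℝ} (hv : v ∈ valueSet dX dY P) (i : Fin 5) : 0 ≤ v i := by
  obtain ⟨k, T, rfl⟩ := hv
  fin_cases i
  exacts [T.commonInfo_nonneg hP, T.infoX_nonneg hP.1, T.infoY_nonneg hP.1,
    T.distX_nonneg hP.1 hdX, T.distY_nonneg hP.1 hdY]

end ValueSet

/-! ### Log-optimality over a convex set. -/

section LogOptimal

/-- First-order optimality condition for maximizing an expected logarithm over a convex set. -/
theorem sum_mul_div_le_one_of_isMaxOn {Z : Type*} [Fintype Z] {P : Z → ℝ}
    (hP : P ∈ stdSimplex ℝ Z) {K : Set (Z → ℝ)} (hK : Convex ℝ K) (hpos : ∀ f ∈ K, ∀ z, 0 < f z)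
    {g : Z → ℝ} (hg : g ∈ K) (hmax : ∀ f ∈ K, ∑ z, P z * log (f z) ≤ ∑ z, P z * log (g z))
    {f : Z → ℝ} (hf : f ∈ K) : ∑ z, P z * (f z / g z) ≤ 1 := by
  have hmem : ∀ t ∈ Set.Ioc (0 : ℝ) 1, (fun z => g z + t * (f z - g z)) ∈ K := by
    intro t ht
    have := hK.add_smul_sub_mem hg hf ⟨ht.1.le, ht.2⟩
    exact this
  have key : ∀ t ∈ Set.Ioc (0 : ℝ) 1,
      ∑ z, P z * ((f z - g z) / (g z + t * (f z - g z))) ≤ 0 := by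
    intro t ht
    have h1 := hmax _ (hmem t ht)
    have h2 : ∀ z, t * (P z * ((f z - g z) / (g z + t * (f z - g z)))) ≤
        P z * log (g z + t * (f z - g z)) - P z * log (g z) := by
      intro z
      have hz := hpos _ (hmem t ht) z
      have hgz := hpos _ hg z
      -- The tangent bound 1 - 1/x ≤ log x compares the objective at g with the point at distance t
      -- along the segment, and leaves an expression that is continuous at t = 0.
      have h3 := one_sub_inv_le_log_of_pos (div_pos hz hgz)
      rw [log_div hz.ne' hgz.ne'] at h3
      rw [← mul_sub]
      refine le_trans (le_of_eq ?_) (mul_le_mul_of_nonneg_left h3 (hP.1 z))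
      field_simp
      ring
    have h4 := Finset.sum_le_sum fun z (_ : z ∈ Finset.univ) => h2 z
    rw [← Finset.mul_sum, Finset.sum_sub_distrib] at h4
    by_contra hcon
    push Not at hcon
    have := mul_pos ht.1 hcon
    linarith
  -- Letting t decrease to 0 turns the difference quotients into the directional derivative at g.
  have hcont : ContinuousAt (fun t : ℝ => ∑ z, P z * ((f z - g z) / (g z + t * (f z - g z)))) 0 := by
    refine tendsto_finsetSum _ fun z _ => ?_
    refine ContinuousAt.mul continuousAt_const (ContinuousAt.div continuousAt_const
      (by fun_prop) ?_)
    simpa using (hpos g hg z).ne'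
  have hlim := hcont.tendsto.mono_left (nhdsWithin_le_nhds (s := Set.Ioi 0))
  have hle := le_of_tendsto hlim (by
    filter_upwards [Ioc_mem_nhdsGT (zero_lt_one' ℝ)] with t ht using key t ht)
  have h5 : ∀ z, P z * ((f z - g z) / (g z + 0 * (f z - g z))) = P z * (f z / g z) - P z := by
    intro z
    have hgz := (hpos _ hg z).ne'
    rw [zero_mul, add_zero, sub_div, div_self hgz]
    ring
  simp only [h5, Finset.sum_sub_distrib, hP.2] at hle
  linarith

/-- The output law of a channel is the best reference law. -/
theorem sum_mul_sum_log_div_le {A B : Type*} [Fintype A] [Fintype B] {m : A → ℝ} {κ : A → B → ℝ}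
    {r : B → ℝ} (hm : ∀ a, 0 ≤ m a) (hκ : ∀ a, κ a ∈ stdSimplex ℝ B) (hr : r ∈ stdSimplex ℝ B)
    (h : ∀ a b, 0 < m a * κ a b → 0 < r b) :
    ∑ a, m a * ∑ b, κ a b * log (κ a b / ((∑ a', m a' * κ a' b) / ∑ a', m a')) ≤
      ∑ a, m a * ∑ b, κ a b * log (κ a b / r b) := by
  set M := ∑ a', m a' with hM
  set μ : B → ℝ := fun b => (∑ a', m a' * κ a' b) / M with hμ
  rcases (Finset.sum_nonneg fun a _ => hm a : 0 ≤ M).eq_or_lt with h0 | h0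
  · have : ∀ a, m a = 0 := fun a =>
      (Finset.sum_eq_zero_iff_of_nonneg (fun a _ => hm a)).1 h0.symm a (Finset.mem_univ a)
    simp [this]
  replace h0 : 0 < M := h0
  have hnn : ∀ a b, 0 ≤ m a * κ a b := fun a b => mul_nonneg (hm a) ((hκ a).1 b)
  have hμmem : μ ∈ stdSimplex ℝ B := by
    refine ⟨fun b => div_nonneg (Finset.sum_nonneg fun a _ => hnn a b) h0.le, ?_⟩
    simp only [hμ]
    rw [← Finset.sum_div, Finset.sum_comm]
    simp only [← Finset.mul_sum, (hκ _).2, mul_one, ← hM, div_self h0.ne']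
  have hterm : ∀ a b, m a * (κ a b * log (κ a b / r b)) - m a * (κ a b * log (κ a b / μ b)) =
      m a * κ a b * log (μ b / r b) := by
    intro a b
    rcases (hnn a b).eq_or_lt with h1 | h1
    · rw [← mul_assoc, ← mul_assoc, ← h1]; simp
    · have hk : κ a b ≠ 0 := right_ne_zero_of_mul h1.ne'
      have hmu : 0 < μ b := div_pos (Finset.sum_pos' (fun a _ => hnn a b)
        ⟨a, Finset.mem_univ _, h1⟩) h0
      rw [log_div hk (h a b h1).ne', log_div hk hmu.ne', log_div hmu.ne' (h a b h1).ne']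
      ring
  have hpos := sum_mul_log_div_nonneg hμmem hr.1 (fun b hb => by
    by_contra hcon
    have : ∀ a, m a * κ a b = 0 := fun a => by
      by_contra h2
      exact hcon (h a b ((hnn a b).lt_of_ne' h2))
    simp [hμ, this] at hb) hr.2.le
  -- Compensation identity: replacing the true output law by r costs exactly M times the divergence
  -- of the output law from r.
  have heq : ∑ a, m a * ∑ b, κ a b * log (κ a b / r b) -
      ∑ a, m a * ∑ b, κ a b * log (κ a b / μ b) = M * ∑ b, μ b * log (μ b / r b) := by
    simp only [Finset.mul_sum]
    rw [← Finset.sum_sub_distrib]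
    simp only [← Finset.sum_sub_distrib, hterm]
    rw [Finset.sum_comm]
    refine Finset.sum_congr rfl fun b _ => ?_
    rw [← Finset.sum_mul, ← mul_assoc]
    congr 1
    simp only [hμ]
    field_simp
  have := mul_nonneg h0.le hpos
  change ∑ a, m a * ∑ b, κ a b * log (κ a b / μ b) ≤ _
  linarith

end LogOptimal

/-! ### Duality between the Lagrangian of a test channel and log-optimal feature mixtures. -/

section Lagrangian

variable {X Y Xh Yh W : Type*} [Fintype X] [Fintype Y] [Fintype Xh] [Fintype Yh] [Fintype W]

/-- The moment generating average of a distortion under a reproduction law. -/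
def expAvg {A B : Type*} [Fintype B] (d : A → B → ℝ) (s : ℝ) (u : B → ℝ) (a : A) : ℝ :=
  ∑ b, u b * exp (-(s * d a b))

theorem expAvg_pos {A B : Type*} [Fintype B] (d : A → B → ℝ) (s : ℝ) {u : B → ℝ}
    (hu : u ∈ stdSimplex ℝ B) (a : A) : 0 < expAvg d s u a := by
  obtain ⟨b, hb⟩ : ∃ b, 0 < u b := by
    by_contra hcon
    push Not at hcon
    have := hu.2
    rw [Finset.sum_eq_zero (fun b _ => le_antisymm (hcon b) (hu.1 b))] at this
    exact one_ne_zero this.symm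
  exact Finset.sum_pos' (fun b _ => mul_nonneg (hu.1 b) (exp_pos _).le)
    ⟨b, Finset.mem_univ _, mul_pos hb (exp_pos _)⟩

/-- The pair of reproduction laws seen as a function of the source letters. -/
def feature (dX : X → Xh → ℝ) (dY : Y → Yh → ℝ) (l₁ l₂ s₁ s₂ : ℝ) (u : Xh → ℝ) (v : Yh → ℝ) :
    X × Y → ℝ :=
  fun z => expAvg dX s₁ u z.1 ^ l₁ * expAvg dY s₂ v z.2 ^ l₂

/-- The convex hull of all features. -/
def featureHull (dX : X → Xh → ℝ) (dY : Y → Yh → ℝ) (l₁ l₂ s₁ s₂ : ℝ) : Set (X × Y → ℝ) :=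
  convexHull ℝ ((fun r : (Xh → ℝ) × (Yh → ℝ) => feature dX dY l₁ l₂ s₁ s₂ r.1 r.2) ''
    (stdSimplex ℝ Xh ×ˢ stdSimplex ℝ Yh))

theorem feature_mem_featureHull (dX : X → Xh → ℝ) (dY : Y → Yh → ℝ) (l₁ l₂ s₁ s₂ : ℝ)
    {u : Xh → ℝ} {v : Yh → ℝ} (hu : u ∈ stdSimplex ℝ Xh) (hv : v ∈ stdSimplex ℝ Yh) :
    feature dX dY l₁ l₂ s₁ s₂ u v ∈ featureHull dX dY l₁ l₂ s₁ s₂ :=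
  subset_convexHull ℝ _ ⟨(u, v), ⟨hu, hv⟩, rfl⟩

theorem featureHull_pos {dX : X → Xh → ℝ} {dY : Y → Yh → ℝ} {l₁ l₂ s₁ s₂ : ℝ} {f : X × Y → ℝ}
    (hf : f ∈ featureHull dX dY l₁ l₂ s₁ s₂) (z : X × Y) : 0 < f z := by
  have hconv : Convex ℝ {f : X × Y → ℝ | 0 < f z} :=
    (convex_Ioi (0 : ℝ)).is_linear_preimage (LinearMap.proj (R := ℝ) (φ := fun _ => ℝ) z).isLinear
  refine convexHull_min ?_ hconv hf
  rintro _ ⟨⟨u, v⟩, ⟨hu, hv⟩, rfl⟩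
  exact mul_pos (rpow_pos_of_pos (expAvg_pos _ _ hu _) _) (rpow_pos_of_pos (expAvg_pos _ _ hv _) _)

theorem isCompact_featureHull (dX : X → Xh → ℝ) (dY : Y → Yh → ℝ) (l₁ l₂ s₁ s₂ : ℝ) :
    IsCompact (featureHull dX dY l₁ l₂ s₁ s₂) := by
  refine isCompact_convexHull_of_isCompact (IsCompact.image_of_continuousOn
    ((isCompact_stdSimplex ℝ _).prod (isCompact_stdSimplex ℝ _)) ?_)
  refine continuousOn_pi.2 fun z => ?_
  unfold feature
  refine ContinuousOn.mul (ContinuousOn.rpow_const ?_ ?_) (ContinuousOn.rpow_const ?_ ?_)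
  · unfold expAvg; fun_prop
  · exact fun r hr => Or.inl (expAvg_pos _ _ hr.1 _).ne'
  · unfold expAvg; fun_prop
  · exact fun r hr => Or.inl (expAvg_pos _ _ hr.2 _).ne'

/-- The hull is compact and all its members are strictly positive, so the expected logarithm is
continuous on it, also where P vanishes. -/
theorem exists_isMaxOn_featureHull [Nonempty Xh] [Nonempty Yh] (dX : X → Xh → ℝ)
    (dY : Y → Yh → ℝ) (l₁ l₂ s₁ s₂ : ℝ) (P : X × Y → ℝ) :
    ∃ g ∈ featureHull dX dY l₁ l₂ s₁ s₂, ∀ f ∈ featureHull dX dY l₁ l₂ s₁ s₂,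
      ∑ z, P z * log (f z) ≤ ∑ z, P z * log (g z) := by
  classical
  refine IsCompact.exists_isMaxOn (f := fun f : X × Y → ℝ => ∑ z, P z * log (f z))
    (isCompact_featureHull dX dY l₁ l₂ s₁ s₂) ?_ ?_
  · exact ⟨_, feature_mem_featureHull dX dY l₁ l₂ s₁ s₂
      (single_mem_stdSimplex ℝ (Classical.arbitrary Xh))
      (single_mem_stdSimplex ℝ (Classical.arbitrary Yh))⟩
  · refine continuousOn_finsetSum _ fun z _ => ContinuousOn.mul continuousOn_const ?_
    exact ContinuousOn.log (by fun_prop) fun f hf => (featureHull_pos hf z).ne'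

namespace TestChannel

variable (T : TestChannel X Y Xh Yh W) {P : X × Y → ℝ}

/-- The expected distortion of the first reproduction given its inputs. -/
def avgDX (dX : X → Xh → ℝ) (x : X) (w : W) : ℝ := ∑ xh, T.chX x w xh * dX x xh

/-- The expected distortion of the second reproduction given its inputs. -/
def avgDY (dY : Y → Yh → ℝ) (y : Y) (w : W) : ℝ := ∑ yh, T.chY y w yh * dY y yh

theorem sum_pXW_mul (P : X × Y → ℝ) (f : X → W → ℝ) :
    ∑ x, ∑ w, T.pXW P x w * f x w = ∑ z, P z * ∑ w, T.chW z.1 z.2 w * f z.1 w := by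
  rw [Fintype.sum_prod_type]
  refine Finset.sum_congr rfl fun x _ => ?_
  simp only [pXW, Finset.sum_mul, Finset.mul_sum]
  rw [Finset.sum_comm]
  simp only [mul_assoc]

theorem sum_pYW_mul (P : X × Y → ℝ) (f : Y → W → ℝ) :
    ∑ y, ∑ w, T.pYW P y w * f y w = ∑ z, P z * ∑ w, T.chW z.1 z.2 w * f z.2 w := by
  rw [Fintype.sum_prod_type_right]
  refine Finset.sum_congr rfl fun x _ => ?_
  simp only [pYW, Finset.sum_mul, Finset.mul_sum]
  rw [Finset.sum_comm]
  simp only [mul_assoc]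

theorem log_two_mul_infoX' (P : X × Y → ℝ) :
    log 2 * T.infoX P = ∑ z, P z * ∑ w, T.chW z.1 z.2 w * T.denX P z.1 w := by
  rw [log_two_mul_infoX, sum_pXW_mul]

theorem log_two_mul_infoY' (P : X × Y → ℝ) :
    log 2 * T.infoY P = ∑ z, P z * ∑ w, T.chW z.1 z.2 w * T.denY P z.2 w := by
  rw [log_two_mul_infoY, sum_pYW_mul]

theorem distX_eq (dX : X → Xh → ℝ) (P : X × Y → ℝ) :
    T.distX dX P = ∑ z, P z * ∑ w, T.chW z.1 z.2 w * T.avgDX dX z.1 w := by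
  rw [← sum_pXW_mul]
  simp only [distX, avgDX, Finset.mul_sum, mul_assoc]

theorem distY_eq (dY : Y → Yh → ℝ) (P : X × Y → ℝ) :
    T.distY dY P = ∑ z, P z * ∑ w, T.chW z.1 z.2 w * T.avgDY dY z.2 w := by
  rw [← sum_pYW_mul]
  simp only [distY, avgDY, Finset.mul_sum, mul_assoc]

/-- The one-letter Lagrangian density, in nats. -/
def lagrDen (dX : X → Xh → ℝ) (dY : Y → Yh → ℝ) (l₁ l₂ s₁ s₂ : ℝ) (P : X × Y → ℝ) (z : X × Y) :
    ℝ :=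
  T.denW P z + l₁ * (∑ w, T.chW z.1 z.2 w * T.denX P z.1 w) +
    l₂ * (∑ w, T.chW z.1 z.2 w * T.denY P z.2 w) +
    l₁ * s₁ * (∑ w, T.chW z.1 z.2 w * T.avgDX dX z.1 w) +
    l₂ * s₂ * (∑ w, T.chW z.1 z.2 w * T.avgDY dY z.2 w)

theorem sum_lagrDen (dX : X → Xh → ℝ) (dY : Y → Yh → ℝ) (l₁ l₂ s₁ s₂ : ℝ) (P : X × Y → ℝ) :
    ∑ z, P z * T.lagrDen dX dY l₁ l₂ s₁ s₂ P z =
      log 2 * (T.commonInfo P + l₁ * T.infoX P + l₂ * T.infoY P) +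
        l₁ * s₁ * T.distX dX P + l₂ * s₂ * T.distY dY P := by
  have : log 2 * (T.commonInfo P + l₁ * T.infoX P + l₂ * T.infoY P) =
      log 2 * T.commonInfo P + l₁ * (log 2 * T.infoX P) + l₂ * (log 2 * T.infoY P) := by ring
  rw [this, log_two_mul_commonInfo, log_two_mul_infoX', log_two_mul_infoY', distX_eq, distY_eq]
  simp only [lagrDen, mul_add, Finset.sum_add_distrib, Finset.mul_sum]
  congr 1; congr 1; congr 1; congr 1
  all_goals refine Finset.sum_congr rfl fun z _ => Finset.sum_congr rfl fun w _ => by ring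

/-- The mixture of features induced by the output laws of a test channel. -/
def mixFeature (dX : X → Xh → ℝ) (dY : Y → Yh → ℝ) (l₁ l₂ s₁ s₂ : ℝ) (P : X × Y → ℝ) :
    X × Y → ℝ :=
  fun z => ∑ w, T.pW P w *
    feature dX dY l₁ l₂ s₁ s₂ (T.pXhGivenW P w) (T.pYhGivenW P w) z

theorem mixFeature_mem (dX : X → Xh → ℝ) (dY : Y → Yh → ℝ) (l₁ l₂ s₁ s₂ : ℝ)
    (hP : P ∈ stdSimplex ℝ (X × Y)) :
    T.mixFeature dX dY l₁ l₂ s₁ s₂ P ∈ featureHull dX dY l₁ l₂ s₁ s₂ := by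
  classical
  have hW := T.pW_mem hP
  obtain ⟨w₀, hw₀⟩ : ∃ w, 0 < T.pW P w := by
    by_contra hcon
    push Not at hcon
    have := hW.2
    rw [Finset.sum_eq_zero (fun b _ => le_antisymm (hcon b) (hW.1 b))] at this
    exact one_ne_zero this.symm
  have hmem : ∀ w, 0 < T.pW P w → feature dX dY l₁ l₂ s₁ s₂ (T.pXhGivenW P w)
      (T.pYhGivenW P w) ∈ featureHull dX dY l₁ l₂ s₁ s₂ := fun w hw =>
    feature_mem_featureHull _ _ _ _ _ _ (T.pXhGivenW_mem hP.1 hw) (T.pYhGivenW_mem hP.1 hw)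
  -- At a letter w of mass zero the conditional reproduction laws are the zero function and not
  -- pmfs; such letters are redirected to `w₀`, which changes nothing because their weight is 0.
  have : T.mixFeature dX dY l₁ l₂ s₁ s₂ P = ∑ w, T.pW P w •
      (feature dX dY l₁ l₂ s₁ s₂ (T.pXhGivenW P (if 0 < T.pW P w then w else w₀))
        (T.pYhGivenW P (if 0 < T.pW P w then w else w₀))) := by
    ext z
    rw [Finset.sum_apply]
    refine Finset.sum_congr rfl fun w _ => ?_
    by_cases h : 0 < T.pW P w
    · simp only [h, if_true, Pi.smul_apply, smul_eq_mul]
    · rw [Pi.smul_apply, le_antisymm (not_lt.1 h) (hW.1 w)]; simp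
  rw [this]
  refine (convex_convexHull ℝ _).sum_mem (fun w _ => hW.1 w) hW.2 fun w _ => ?_
  by_cases h : 0 < T.pW P w
  · simp only [h, if_true]; exact hmem w h
  · simp only [h, if_false]; exact hmem w₀ hw₀

/-- Gibbs' variational bound: `neg_log_sum_le` for the reference measure u weighted by exp(-s d). -/
theorem neg_log_expAvg_le {A B : Type*} [Fintype B] (d : A → B → ℝ) (s : ℝ) {κ u : B → ℝ}
    (hκ : κ ∈ stdSimplex ℝ B) (hu : ∀ b, 0 ≤ u b) (h : ∀ b, 0 < κ b → 0 < u b) (a : A) :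
    -log (expAvg d s u a) ≤ ∑ b, κ b * log (κ b / u b) + s * ∑ b, κ b * d a b := by
  refine (neg_log_sum_le hκ (m := fun b => u b * exp (-(s * d a b)))
    (fun b => mul_nonneg (hu b) (exp_pos _).le)
    (fun b hb => mul_pos (h b hb) (exp_pos _))).trans_eq ?_
  rw [Finset.mul_sum, ← Finset.sum_add_distrib]
  refine Finset.sum_congr rfl fun b _ => ?_
  rcases (hκ.1 b).eq_or_lt with h0 | h0
  · simp [← h0]
  · rw [log_div h0.ne' (mul_pos (h b h0) (exp_pos _)).ne', log_mul (h b h0).ne' (exp_pos _).ne',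
      log_exp, log_div h0.ne' (h b h0).ne']
    ring

/-- Gibbs' inequality is used on two levels: over w with the features as weights, then inside each
feature over the reproduction letters. The bound holds letter by letter, so equality of the averages
will force equality at every source letter of positive probability. -/
theorem neg_log_mixFeature_le (dX : X → Xh → ℝ) (dY : Y → Yh → ℝ) {l₁ l₂ : ℝ} (s₁ s₂ : ℝ)
    (hl₁ : 0 ≤ l₁) (hl₂ : 0 ≤ l₂) (hP : P ∈ stdSimplex ℝ (X × Y)) {z : X × Y} (hz : 0 < P z) :
    -log (T.mixFeature dX dY l₁ l₂ s₁ s₂ P z) ≤ T.lagrDen dX dY l₁ l₂ s₁ s₂ P z := by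
  have hposW : ∀ w, 0 < T.chW z.1 z.2 w → 0 < T.pXW P z.1 w ∧ 0 < T.pYW P z.2 w ∧ 0 < T.pW P w :=
    fun w hw => ⟨(mul_pos hz hw).trans_le (T.mul_chW_le_pXW hP.1 z.1 z.2 w),
      (mul_pos hz hw).trans_le (T.mul_chW_le_pYW hP.1 z.1 z.2 w),
      (mul_pos hz hw).trans_le (T.mul_chW_le_pW hP.1 z w)⟩
  have hf : ∀ w, 0 ≤ T.pW P w * feature dX dY l₁ l₂ s₁ s₂ (T.pXhGivenW P w)
      (T.pYhGivenW P w) z := by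
    intro w
    rcases (T.pW_nonneg hP.1 w).eq_or_lt with h | h
    · simp [← h]
    · exact mul_nonneg h.le (featureHull_pos (feature_mem_featureHull _ _ _ _ _ _
        (T.pXhGivenW_mem hP.1 h) (T.pYhGivenW_mem hP.1 h)) z).le
  refine (neg_log_sum_le (T.chW_mem z.1 z.2) hf fun w hw => ?_).trans ?_
  · have h := (hposW w hw).2.2
    exact mul_pos h (featureHull_pos (feature_mem_featureHull _ _ _ _ _ _
        (T.pXhGivenW_mem hP.1 h) (T.pYhGivenW_mem hP.1 h)) z)
  · have hterm : ∀ w, T.chW z.1 z.2 w * log (T.chW z.1 z.2 w / (T.pW P w *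
        feature dX dY l₁ l₂ s₁ s₂ (T.pXhGivenW P w) (T.pYhGivenW P w) z)) ≤
        T.chW z.1 z.2 w * log (T.chW z.1 z.2 w / T.pW P w) +
        l₁ * (T.chW z.1 z.2 w * T.denX P z.1 w) + l₂ * (T.chW z.1 z.2 w * T.denY P z.2 w) +
        l₁ * s₁ * (T.chW z.1 z.2 w * T.avgDX dX z.1 w) +
        l₂ * s₂ * (T.chW z.1 z.2 w * T.avgDY dY z.2 w) := by
      intro w
      rcases ((T.chW_mem z.1 z.2).1 w).eq_or_lt with h0 | h0
      · simp [← h0]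
      · obtain ⟨hx, hy, hw⟩ := hposW w h0
        have hA := expAvg_pos dX s₁ (T.pXhGivenW_mem hP.1 hw) z.1
        have hB := expAvg_pos dY s₂ (T.pYhGivenW_mem hP.1 hw) z.2
        have h1 := neg_log_expAvg_le dX s₁ (T.chX_mem z.1 w) (T.pXhGivenW_nonneg hP.1 w)
          (fun b hb => T.pXhGivenW_pos hP.1 hx hb) z.1
        have h2 := neg_log_expAvg_le dY s₂ (T.chY_mem z.2 w) (T.pYhGivenW_nonneg hP.1 w)
          (fun b hb => T.pYhGivenW_pos hP.1 hy hb) z.2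
        have hFA := rpow_pos_of_pos hA l₁
        have hFB := rpow_pos_of_pos hB l₂
        rw [feature, log_div h0.ne' (mul_pos hw (mul_pos hFA hFB)).ne',
          log_mul hw.ne' (mul_pos hFA hFB).ne', log_mul hFA.ne' hFB.ne', log_rpow hA, log_rpow hB,
          log_div h0.ne' hw.ne']
        have h1' := mul_le_mul_of_nonneg_left h1 (mul_nonneg h0.le hl₁)
        have h2' := mul_le_mul_of_nonneg_left h2 (mul_nonneg h0.le hl₂)
        unfold denX denY avgDX avgDY
        linarith
    refine (Finset.sum_le_sum fun w _ => hterm w).trans_eq ?_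
    simp only [Finset.sum_add_distrib, ← Finset.mul_sum]
    rfl

end TestChannel

/-- Every element of the feature hull gives a test channel by exponential tilting. -/
theorem exists_valueSet_le_of_mem_featureHull (dX : X → Xh → ℝ) (dY : Y → Yh → ℝ) {l₁ l₂ : ℝ}
    (s₁ s₂ : ℝ) (hl₁ : 0 ≤ l₁) (hl₂ : 0 ≤ l₂) {P : X × Y → ℝ} (hP : P ∈ stdSimplex ℝ (X × Y))
    {g : X × Y → ℝ} (hg : g ∈ featureHull dX dY l₁ l₂ s₁ s₂) :
    ∃ v ∈ valueSet dX dY P, log 2 * (v 0 + l₁ * v 1 + l₂ * v 2) + l₁ * s₁ * v 3 +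
      l₂ * s₂ * v 4 ≤ -∑ z, P z * log (g z) := by
  classical
  obtain ⟨ι, _, q, f, hq, hq1, hf, hsum⟩ := mem_convexHull_iff_exists_fintype.1 hg
  choose r hr hrf using hf
  have hgz : ∀ z, ∑ i, q i * feature dX dY l₁ l₂ s₁ s₂ (r i).1 (r i).2 z = g z := by
    intro z
    rw [← hsum, Finset.sum_apply]
    simp [← hrf]
  have hgpos := featureHull_pos hg
  have hA : ∀ x i, 0 < expAvg dX s₁ (r i).1 x := fun x i => expAvg_pos _ _ (hr i).1 x
  have hB : ∀ y i, 0 < expAvg dY s₂ (r i).2 y := fun x i => expAvg_pos _ _ (hr i).2 x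
  have hfpos : ∀ i z, 0 < feature dX dY l₁ l₂ s₁ s₂ (r i).1 (r i).2 z := fun i z =>
    mul_pos (rpow_pos_of_pos (hA _ _) _) (rpow_pos_of_pos (hB _ _) _)
  -- These tilted channels attain equality in both levels of Gibbs' inequality, when measured
  -- against the reference laws `q` and `r i` instead of the true output laws.
  let T : TestChannel X Y Xh Yh ι :=
    { chW := fun x y i => q i * feature dX dY l₁ l₂ s₁ s₂ (r i).1 (r i).2 (x, y) / g (x, y)
      chX := fun x i xh => (r i).1 xh * exp (-(s₁ * dX x xh)) / expAvg dX s₁ (r i).1 x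
      chY := fun y i yh => (r i).2 yh * exp (-(s₂ * dY y yh)) / expAvg dY s₂ (r i).2 y
      chW_mem := fun x y => ⟨fun i => div_nonneg (mul_nonneg (hq i) (hfpos _ _).le) (hgpos _).le,
        by rw [← Finset.sum_div, hgz, div_self (hgpos _).ne']⟩
      chX_mem := fun x i => ⟨fun xh => div_nonneg (mul_nonneg ((hr i).1.1 _) (exp_pos _).le)
        (hA _ _).le, by rw [← Finset.sum_div]; exact div_self (hA x i).ne'⟩
      chY_mem := fun y i => ⟨fun yh => div_nonneg (mul_nonneg ((hr i).2.1 _) (exp_pos _).le)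
        (hB _ _).le, by rw [← Finset.sum_div]; exact div_self (hB y i).ne'⟩ }
  have hX : ∀ x i, ∑ xh, T.chX x i xh * log (T.chX x i xh / (r i).1 xh) =
      -log (expAvg dX s₁ (r i).1 x) - s₁ * T.avgDX dX x i := by
    intro x i
    have : ∀ xh, T.chX x i xh * log (T.chX x i xh / (r i).1 xh) =
        T.chX x i xh * -log (expAvg dX s₁ (r i).1 x) - s₁ * (T.chX x i xh * dX x xh) := by
      intro xh
      rcases ((hr i).1.1 xh).eq_or_lt with h | h
      · have : T.chX x i xh = 0 := by simp [T, ← h]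
        simp [this]
      · have e : T.chX x i xh / (r i).1 xh = exp (-(s₁ * dX x xh)) / expAvg dX s₁ (r i).1 x := by
          simp only [T]; field_simp
        rw [e, log_div (exp_pos _).ne' (hA x i).ne', log_exp]
        ring
    simp only [this, Finset.sum_sub_distrib, ← Finset.sum_mul, ← Finset.mul_sum, (T.chX_mem _ _).2,
      one_mul]
    rfl
  have hY : ∀ x i, ∑ xh, T.chY x i xh * log (T.chY x i xh / (r i).2 xh) =
      -log (expAvg dY s₂ (r i).2 x) - s₂ * T.avgDY dY x i := by
    intro x i
    have : ∀ xh, T.chY x i xh * log (T.chY x i xh / (r i).2 xh) =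
        T.chY x i xh * -log (expAvg dY s₂ (r i).2 x) - s₂ * (T.chY x i xh * dY x xh) := by
      intro xh
      rcases ((hr i).2.1 xh).eq_or_lt with h | h
      · have : T.chY x i xh = 0 := by simp [T, ← h]
        simp [this]
      · have e : T.chY x i xh / (r i).2 xh = exp (-(s₂ * dY x xh)) / expAvg dY s₂ (r i).2 x := by
          simp only [T]; field_simp
        rw [e, log_div (exp_pos _).ne' (hB x i).ne', log_exp]
        ring
    simp only [this, Finset.sum_sub_distrib, ← Finset.sum_mul, ← Finset.mul_sum, (T.chY_mem _ _).2,
      one_mul]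
    rfl
  have hW : ∀ (z : X × Y) i, T.chW z.1 z.2 i * log (T.chW z.1 z.2 i / q i) =
      T.chW z.1 z.2 i * (l₁ * log (expAvg dX s₁ (r i).1 z.1) +
        l₂ * log (expAvg dY s₂ (r i).2 z.2) - log (g z)) := by
    intro z i
    rcases (hq i).eq_or_lt with h | h
    · have : T.chW z.1 z.2 i = 0 := by simp [T, ← h]
      simp [this]
    · have e : T.chW z.1 z.2 i / q i = feature dX dY l₁ l₂ s₁ s₂ (r i).1 (r i).2 z / g z := by
        simp only [T]; field_simp
      rw [e, log_div (hfpos i z).ne' (hgpos z).ne', feature,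
        log_mul (rpow_pos_of_pos (hA _ _) _).ne' (rpow_pos_of_pos (hB _ _) _).ne',
        log_rpow (hA _ _), log_rpow (hB _ _)]
  -- Passing from the reference laws to the true output laws can only lower the three information
  -- terms; this is where an inequality enters.
  have b0 : ∑ z, P z * T.denW P z ≤ ∑ z, P z * ∑ i, T.chW z.1 z.2 i *
      log (T.chW z.1 z.2 i / q i) := by
    have := sum_mul_sum_log_div_le (m := P) (κ := fun z i => T.chW z.1 z.2 i) (r := q) hP.1
      (fun z => T.chW_mem _ _) ⟨hq, hq1⟩ (fun z i h => by
        refine (hq i).lt_of_ne' fun h0 => ?_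
        simp [T, h0] at h)
    simp only [hP.2, div_one, ← T.pW_eq_sum] at this
    exact this
  have b1 : ∑ x, ∑ w, T.pXW P x w * T.denX P x w ≤ ∑ x, ∑ w, T.pXW P x w *
      ∑ xh, T.chX x w xh * log (T.chX x w xh / (r w).1 xh) := by
    rw [Finset.sum_comm, Finset.sum_comm (f := fun x w => T.pXW P x w *
      ∑ xh, T.chX x w xh * log (T.chX x w xh / (r w).1 xh))]
    refine Finset.sum_le_sum fun w _ => ?_
    exact sum_mul_sum_log_div_le (m := fun x => T.pXW P x w) (κ := fun x => T.chX x w)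
      (r := (r w).1) (fun x => T.pXW_nonneg hP.1 x w) (fun x => T.chX_mem x w) (hr w).1
      (fun x xh h => by
        refine ((hr w).1.1 xh).lt_of_ne' fun h0 => ?_
        simp [T, h0] at h)
  have b2 : ∑ x, ∑ w, T.pYW P x w * T.denY P x w ≤ ∑ x, ∑ w, T.pYW P x w *
      ∑ xh, T.chY x w xh * log (T.chY x w xh / (r w).2 xh) := by
    rw [Finset.sum_comm, Finset.sum_comm (f := fun x w => T.pYW P x w *
      ∑ xh, T.chY x w xh * log (T.chY x w xh / (r w).2 xh))]
    refine Finset.sum_le_sum fun w _ => ?_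
    have := sum_mul_sum_log_div_le (m := fun x => T.pYW P x w) (κ := fun x => T.chY x w)
      (r := (r w).2) (fun x => T.pYW_nonneg hP.1 x w) (fun x => T.chY_mem x w) (hr w).2
      (fun x xh h => by
        refine ((hr w).2.1 xh).lt_of_ne' fun h0 => ?_
        simp [T, h0] at h)
    rw [T.sum_pYW] at this
    exact this
  refine ⟨_, T.vals_mem_valueSet dX dY hP, ?_⟩
  show log 2 * (T.commonInfo P + l₁ * T.infoX P + l₂ * T.infoY P) + l₁ * s₁ * T.distX dX P +
    l₂ * s₂ * T.distY dY P ≤ _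
  have h1 : log 2 * (T.commonInfo P + l₁ * T.infoX P + l₂ * T.infoY P) =
      log 2 * T.commonInfo P + l₁ * (log 2 * T.infoX P) + l₂ * (log 2 * T.infoY P) := by ring
  rw [h1, T.log_two_mul_commonInfo, T.log_two_mul_infoX, T.log_two_mul_infoY, T.distX_eq,
    T.distY_eq]
  rw [T.sum_pXW_mul _ (fun x w => ∑ xh, T.chX x w xh * log (T.chX x w xh / (r w).1 xh))] at b1
  rw [T.sum_pYW_mul _ (fun x w => ∑ xh, T.chY x w xh * log (T.chY x w xh / (r w).2 xh))] at b2
  simp only [hX] at b1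
  simp only [hY] at b2
  simp only [hW] at b0
  refine (add_le_add (add_le_add (add_le_add (add_le_add b0 (mul_le_mul_of_nonneg_left b1 hl₁))
    (mul_le_mul_of_nonneg_left b2 hl₂)) le_rfl) le_rfl).trans_eq ?_
  simp only [Finset.mul_sum, ← Finset.sum_add_distrib]
  rw [← Finset.sum_neg_distrib]
  refine Finset.sum_congr rfl fun z _ => ?_
  have : -(P z * log (g z)) = ∑ i, T.chW z.1 z.2 i * -(P z * log (g z)) := by
    rw [← Finset.sum_mul, (T.chW_mem _ _).2, one_mul]
  rw [this]
  exact Finset.sum_congr rfl fun i _ => by ring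

end Lagrangian

/-! ### Sums over strings and tensorization. -/

section BlockSums

variable {Z : Type*} [Fintype Z]

theorem sum_cons {E : Type*} [AddCommMonoid E] {n : ℕ} (F : (Fin (n + 1) → Z) → E) :
    ∑ z, F z = ∑ a, ∑ z : Fin n → Z, F (Fin.cons a z) := by
  rw [← Fintype.sum_prod_type', ← (Fin.consEquiv fun _ : Fin (n + 1) => Z).sum_comp]
  rfl

theorem sum_fun_prod {X Y E : Type*} [Fintype X] [Fintype Y] [AddCommMonoid E] {n : ℕ}
    (F : (Fin n → X) → (Fin n → Y) → E) :
    ∑ x, ∑ y, F x y = ∑ z : Fin n → X × Y, F (fun i => (z i).1) (fun i => (z i).2) := by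
  rw [← Fintype.sum_prod_type', ← (Equiv.arrowProdEquivProdArrow (Fin n) (fun _ => X)
    (fun _ => Y)).sum_comp]
  rfl

theorem sum_prod_eq_one {P : Z → ℝ} (hP : P ∈ stdSimplex ℝ Z) (n : ℕ) :
    ∑ z : Fin n → Z, ∏ i, P (z i) = 1 := by
  induction n with
  | zero => simp
  | succ n ih =>
    rw [sum_cons]
    simp only [Fin.prod_univ_succ, Fin.cons_zero, Fin.cons_succ, ← Finset.mul_sum, ih, mul_one,
      hP.2]

theorem sum_prod_mul_sum {P : Z → ℝ} (hP : P ∈ stdSimplex ℝ Z) (f : Z → ℝ) (n : ℕ) :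
    ∑ z : Fin n → Z, (∏ i, P (z i)) * ∑ i, f (z i) = n * ∑ z, P z * f z := by
  induction n with
  | zero => simp
  | succ n ih =>
    rw [sum_cons]
    simp only [Fin.prod_univ_succ, Fin.sum_univ_succ, Fin.cons_zero, Fin.cons_succ, mul_add,
      Finset.sum_add_distrib]
    have h1 : ∀ a, ∑ z : Fin n → Z, P a * (∏ i, P (z i)) * f a = P a * f a := by
      intro a
      rw [← Finset.sum_mul, ← Finset.mul_sum, sum_prod_eq_one hP, mul_one]
    have h2 : ∀ a, ∑ z : Fin n → Z, P a * (∏ i, P (z i)) * ∑ i, f (z i) =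
        P a * (n * ∑ z, P z * f z) := by
      intro a
      simp only [mul_assoc]
      rw [← Finset.mul_sum, ih]
    simp only [h1, h2]
    rw [← Finset.sum_mul, hP.2]
    push_cast
    ring

theorem prod_nonneg_of_mem {P : Z → ℝ} (hP : ∀ z, 0 ≤ P z) {n : ℕ} (z : Fin n → Z) :
    0 ≤ ∏ i, P (z i) := Finset.prod_nonneg fun i _ => hP _

/-- A mixed-norm bound for a pair of nonnegative kernels is inherited by their tensor powers. -/
theorem tensor_power_bound {X Y A B : Type*} [Fintype X] [Fintype Y] [Fintype A] [Fintype B]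
    {m : X × Y → ℝ} {k₁ : X → A → ℝ} {k₂ : Y → B → ℝ} {l₁ l₂ : ℝ}
    (hm : ∀ z, 0 ≤ m z) (hk₁ : ∀ x a, 0 ≤ k₁ x a) (hk₂ : ∀ y b, 0 ≤ k₂ y b)
    (H : ∀ (u : A → ℝ) (v : B → ℝ), (∀ a, 0 ≤ u a) → (∀ b, 0 ≤ v b) →
      ∑ z, m z * ((∑ a, u a * k₁ z.1 a) ^ l₁ * (∑ b, v b * k₂ z.2 b) ^ l₂) ≤
        (∑ a, u a) ^ l₁ * (∑ b, v b) ^ l₂)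
    (n : ℕ) (u : (Fin n → A) → ℝ) (v : (Fin n → B) → ℝ) (hu : ∀ a, 0 ≤ u a) (hv : ∀ b, 0 ≤ v b) :
    ∑ z : Fin n → X × Y, (∏ i, m (z i)) * ((∑ a, u a * ∏ i, k₁ (z i).1 (a i)) ^ l₁ *
        (∑ b, v b * ∏ i, k₂ (z i).2 (b i)) ^ l₂) ≤
      (∑ a, u a) ^ l₁ * (∑ b, v b) ^ l₂ := by
  induction n with
  | zero => simp
  | succ n ih =>
    rw [sum_cons]
    -- The first source letter is frozen and its kernel absorbed into the weights on the remaining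
    -- letters. The induction hypothesis leaves the total masses of `u'` and `v'`, which are again
    -- of the form covered by `H` for the first letter.
    set u' : X → (Fin n → A) → ℝ := fun x a' => ∑ a, u (Fin.cons a a') * k₁ x a with hu'
    set v' : Y → (Fin n → B) → ℝ := fun y b' => ∑ b, v (Fin.cons b b') * k₂ y b with hv'
    have step : ∀ z₀ : X × Y, ∑ z : Fin n → X × Y,
        (∏ i, m ((Fin.cons z₀ z : Fin (n + 1) → X × Y) i)) *
        ((∑ a, u a * ∏ i, k₁ ((Fin.cons z₀ z : Fin (n + 1) → X × Y) i).1 (a i)) ^ l₁ *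
        (∑ b, v b * ∏ i, k₂ ((Fin.cons z₀ z : Fin (n + 1) → X × Y) i).2 (b i)) ^ l₂) ≤
        m z₀ * ((∑ a', u' z₀.1 a') ^ l₁ * (∑ b', v' z₀.2 b') ^ l₂) := by
      intro z₀
      have e1 : ∀ z : Fin n → X × Y,
          ∑ a, u a * ∏ i, k₁ ((Fin.cons z₀ z : Fin (n + 1) → X × Y) i).1 (a i) =
          ∑ a', u' z₀.1 a' * ∏ i, k₁ (z i).1 (a' i) := by
        intro z
        rw [sum_cons, Finset.sum_comm]
        refine Finset.sum_congr rfl fun a' _ => ?_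
        simp only [hu', Finset.sum_mul, Fin.prod_univ_succ, Fin.cons_zero, Fin.cons_succ, mul_assoc]
      have e2 : ∀ z : Fin n → X × Y,
          ∑ b, v b * ∏ i, k₂ ((Fin.cons z₀ z : Fin (n + 1) → X × Y) i).2 (b i) =
          ∑ b', v' z₀.2 b' * ∏ i, k₂ (z i).2 (b' i) := by
        intro z
        rw [sum_cons, Finset.sum_comm]
        refine Finset.sum_congr rfl fun a' _ => ?_
        simp only [hv', Finset.sum_mul, Fin.prod_univ_succ, Fin.cons_zero, Fin.cons_succ, mul_assoc]
      simp only [e1, e2]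
      simp only [Fin.prod_univ_succ, Fin.cons_zero, Fin.cons_succ, mul_assoc, ← Finset.mul_sum]
      exact mul_le_mul_of_nonneg_left (ih _ _
        (fun a' => Finset.sum_nonneg fun a _ => mul_nonneg (hu _) (hk₁ _ _))
        (fun b' => Finset.sum_nonneg fun b _ => mul_nonneg (hv _) (hk₂ _ _))) (hm _)
    refine (Finset.sum_le_sum fun z₀ _ => step z₀).trans ?_
    have e3 : ∀ x, ∑ a', u' x a' = ∑ a, (∑ a', u (Fin.cons a a')) * k₁ x a := by
      intro x
      simp only [hu', Finset.sum_mul]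
      rw [Finset.sum_comm]
    have e4 : ∀ y, ∑ b', v' y b' = ∑ b, (∑ b', v (Fin.cons b b')) * k₂ y b := by
      intro x
      simp only [hv', Finset.sum_mul]
      rw [Finset.sum_comm]
    simp only [e3, e4]
    rw [sum_cons u, sum_cons v]
    exact H _ _ (fun a => Finset.sum_nonneg fun _ _ => hu _)
      (fun b => Finset.sum_nonneg fun _ _ => hv _)

end BlockSums

/-! ### One-shot bounds valid for every code. -/

section CodeBound

variable {X Y Xh Yh : Type*} [Fintype X] [Fintype Y] [Fintype Xh] [Fintype Yh]

theorem mul_avgDist {A B : Type*} (d : A → B → ℝ) {n : ℕ} (a : Fin n → A) (b : Fin n → B) :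
    n * avgDist d a b = ∑ i, d (a i) (b i) := by
  unfold avgDist
  rcases Nat.eq_zero_or_pos n with rfl | h
  · simp
  · field_simp

/-- Optimality conditions for the log-optimal feature mixture, in homogeneous form. -/
theorem feature_bound {dX : X → Xh → ℝ} {dY : Y → Yh → ℝ} {l₁ l₂ s₁ s₂ : ℝ} (hl₁ : 0 < l₁)
    (hl₂ : 0 < l₂) {P : X × Y → ℝ} (hP : P ∈ stdSimplex ℝ (X × Y)) {g : X × Y → ℝ}
    (hg : g ∈ featureHull dX dY l₁ l₂ s₁ s₂)
    (hmax : ∀ f ∈ featureHull dX dY l₁ l₂ s₁ s₂,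
      ∑ z, P z * log (f z) ≤ ∑ z, P z * log (g z))
    (u : Xh → ℝ) (v : Yh → ℝ) (hu : ∀ a, 0 ≤ u a) (hv : ∀ b, 0 ≤ v b) :
    ∑ z, P z / g z * ((∑ a, u a * exp (-(s₁ * dX z.1 a))) ^ l₁ *
        (∑ b, v b * exp (-(s₂ * dY z.2 b))) ^ l₂) ≤ (∑ a, u a) ^ l₁ * (∑ b, v b) ^ l₂ := by
  -- Normalizing to pmfs requires positive mass. For zero mass both sides vanish because the
  -- exponents are positive.
  rcases (Finset.sum_nonneg fun a _ => hu a : 0 ≤ ∑ a, u a).eq_or_lt with h0 | hU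
  · have : ∀ a, u a = 0 := fun a =>
      (Finset.sum_eq_zero_iff_of_nonneg (fun a _ => hu a)).1 h0.symm a (Finset.mem_univ a)
    simp [this, zero_rpow hl₁.ne']
  rcases (Finset.sum_nonneg fun a _ => hv a : 0 ≤ ∑ a, v a).eq_or_lt with h0 | hV
  · have : ∀ a, v a = 0 := fun a =>
      (Finset.sum_eq_zero_iff_of_nonneg (fun a _ => hv a)).1 h0.symm a (Finset.mem_univ a)
    simp [this, zero_rpow hl₂.ne']
  set U := ∑ a, u a with hUdef
  set V := ∑ b, v b with hVdef
  have hu' : (fun a => u a / U) ∈ stdSimplex ℝ Xh :=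
    ⟨fun a => div_nonneg (hu a) hU.le, by rw [← Finset.sum_div, div_self hU.ne']⟩
  have hv' : (fun a => v a / V) ∈ stdSimplex ℝ Yh :=
    ⟨fun a => div_nonneg (hv a) hV.le, by rw [← Finset.sum_div, div_self hV.ne']⟩
  have key := sum_mul_div_le_one_of_isMaxOn hP (convex_convexHull ℝ _)
    (fun f hf z => featureHull_pos hf z) hg hmax
    (feature_mem_featureHull dX dY l₁ l₂ s₁ s₂ hu' hv')
  have e : ∀ z : X × Y, P z / g z * ((∑ a, u a * exp (-(s₁ * dX z.1 a))) ^ l₁ *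
        (∑ b, v b * exp (-(s₂ * dY z.2 b))) ^ l₂) = U ^ l₁ * V ^ l₂ *
        (P z * (feature dX dY l₁ l₂ s₁ s₂ (fun a => u a / U) (fun a => v a / V) z / g z)) := by
    intro z
    have e1 : ∑ a, u a * exp (-(s₁ * dX z.1 a)) = U * expAvg dX s₁ (fun a => u a / U) z.1 := by
      rw [expAvg, Finset.mul_sum]
      exact Finset.sum_congr rfl fun a _ => by field_simp
    have e2 : ∑ a, v a * exp (-(s₂ * dY z.2 a)) = V * expAvg dY s₂ (fun a => v a / V) z.2 := by
      rw [expAvg, Finset.mul_sum]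
      exact Finset.sum_congr rfl fun a _ => by field_simp
    rw [e1, e2, mul_rpow hU.le (expAvg_pos _ _ hu' _).le, mul_rpow hV.le (expAvg_pos _ _ hv' _).le,
      feature]
    ring
  simp only [e]
  rw [← Finset.mul_sum]
  exact mul_le_of_le_one_right (mul_nonneg (rpow_nonneg hU.le _) (rpow_nonneg hV.le _)) key

/-- The one-shot bound on the performance of a code. -/
theorem Code.sum_exp_le {dX : X → Xh → ℝ} {dY : Y → Yh → ℝ} {l₁ l₂ s₁ s₂ : ℝ} (hl₁ : 0 < l₁)
    (hl₂ : 0 < l₂) {P : X × Y → ℝ} (hP : P ∈ stdSimplex ℝ (X × Y)) {g : X × Y → ℝ}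
    (hg : g ∈ featureHull dX dY l₁ l₂ s₁ s₂)
    (hmax : ∀ f ∈ featureHull dX dY l₁ l₂ s₁ s₂,
      ∑ z, P z * log (f z) ≤ ∑ z, P z * log (g z))
    {n M₀ M₁ M₂ : ℕ} (c : Code X Y Xh Yh n M₀ M₁ M₂) :
    ∑ z : Fin n → X × Y, (∏ i, P (z i) / g (z i)) *
      exp (-(l₁ * s₁ * (n * avgDist dX (fun i => (z i).1)
        (c.outX (fun i => (z i).1) (fun i => (z i).2))) +
        l₂ * s₂ * (n * avgDist dY (fun i => (z i).2)
        (c.outY (fun i => (z i).1) (fun i => (z i).2))))) ≤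
      M₀ * ((M₁ : ℝ) ^ l₁ * (M₂ : ℝ) ^ l₂) := by
  classical
  have hm : ∀ z, 0 ≤ P z / g z := fun z => div_nonneg (hP.1 z) (featureHull_pos hg z).le
  -- Counting measures of the private codebooks selected by the common message; their total masses
  -- are M₁ and M₂.
  set u : Fin M₀ → (Fin n → Xh) → ℝ := fun m a => ∑ j, if c.dec₁ m j = a then 1 else 0 with hu
  set v : Fin M₀ → (Fin n → Yh) → ℝ := fun m a => ∑ j, if c.dec₂ m j = a then 1 else 0 with hv
  have hu0 : ∀ m a, 0 ≤ u m a := fun m a => Finset.sum_nonneg fun j _ => by split_ifs <;> norm_num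
  have hv0 : ∀ m a, 0 ≤ v m a := fun m a => Finset.sum_nonneg fun j _ => by split_ifs <;> norm_num
  have husum : ∀ m (f : (Fin n → Xh) → ℝ), ∑ a, u m a * f a = ∑ j, f (c.dec₁ m j) := by
    intro m f
    simp only [hu, Finset.sum_mul]
    rw [Finset.sum_comm]
    simp
  have hvsum : ∀ m (f : (Fin n → Yh) → ℝ), ∑ a, v m a * f a = ∑ j, f (c.dec₂ m j) := by
    intro m f
    simp only [hv, Finset.sum_mul]
    rw [Finset.sum_comm]
    simp
  have hu1 : ∀ m, ∑ a, u m a = M₁ := fun m => by simpa using husum m fun _ => 1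
  have hv1 : ∀ m, ∑ a, v m a = M₂ := fun m => by simpa using hvsum m fun _ => 1
  have key : ∀ m : Fin M₀, _ := fun m => tensor_power_bound hm
    (k₁ := fun x a => exp (-(s₁ * dX x a))) (k₂ := fun y b => exp (-(s₂ * dY y b)))
    (fun _ _ => (exp_pos _).le) (fun _ _ => (exp_pos _).le)
    (feature_bound hl₁ hl₂ hP hg hmax) n (u m) (v m) (hu0 m) (hv0 m)
  have htot := Finset.sum_le_sum fun m (_ : m ∈ Finset.univ) => key m
  simp only [hu1, hv1, Finset.sum_const, Finset.card_univ, Fintype.card_fin, nsmul_eq_mul,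
    husum, hvsum] at htot
  rw [Finset.sum_comm] at htot
  refine le_trans (Finset.sum_le_sum fun z _ => ?_) htot
  rw [← Finset.mul_sum]
  refine mul_le_mul_of_nonneg_left ?_ (Finset.prod_nonneg fun i _ => hm _)
  set x : Fin n → X := fun i => (z i).1
  set y : Fin n → Y := fun i => (z i).2
  have hnn1 : ∀ m j, 0 ≤ ∏ i, exp (-(s₁ * dX (z i).1 (c.dec₁ m j i))) := fun m j =>
    Finset.prod_nonneg fun i _ => (exp_pos _).le
  have hnn2 : ∀ m j, 0 ≤ ∏ i, exp (-(s₂ * dY (z i).2 (c.dec₂ m j i))) := fun m j =>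
    Finset.prod_nonneg fun i _ => (exp_pos _).le
  have h1 : exp (-(s₁ * (n * avgDist dX x (c.outX x y)))) ≤
      ∑ j, ∏ i, exp (-(s₁ * dX (z i).1 (c.dec₁ (c.enc₀ x y) j i))) := by
    refine le_trans (le_of_eq ?_) (Finset.single_le_sum
      (f := fun j => ∏ i, exp (-(s₁ * dX (z i).1 (c.dec₁ (c.enc₀ x y) j i))))
      (fun j _ => hnn1 _ j) (Finset.mem_univ (c.enc₁ x y)))
    rw [mul_avgDist, Finset.mul_sum, ← Finset.sum_neg_distrib, exp_sum]
    rfl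
  have h2 : exp (-(s₂ * (n * avgDist dY y (c.outY x y)))) ≤
      ∑ j, ∏ i, exp (-(s₂ * dY (z i).2 (c.dec₂ (c.enc₀ x y) j i))) := by
    refine le_trans (le_of_eq ?_) (Finset.single_le_sum
      (f := fun j => ∏ i, exp (-(s₂ * dY (z i).2 (c.dec₂ (c.enc₀ x y) j i))))
      (fun j _ => hnn2 _ j) (Finset.mem_univ (c.enc₂ x y)))
    rw [mul_avgDist, Finset.mul_sum, ← Finset.sum_neg_distrib, exp_sum]
    rfl
  refine le_trans ?_ (Finset.single_le_sum (f := fun m =>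
    (∑ j, ∏ i, exp (-(s₁ * dX (z i).1 (c.dec₁ m j i)))) ^ l₁ *
    (∑ j, ∏ i, exp (-(s₂ * dY (z i).2 (c.dec₂ m j i)))) ^ l₂) (fun m _ => mul_nonneg
      (rpow_nonneg (Finset.sum_nonneg fun j _ => hnn1 m j) _)
      (rpow_nonneg (Finset.sum_nonneg fun j _ => hnn2 m j) _)) (Finset.mem_univ (c.enc₀ x y)))
  refine le_trans (le_of_eq ?_) (mul_le_mul (rpow_le_rpow (exp_pos _).le h1 hl₁.le)
    (rpow_le_rpow (exp_pos _).le h2 hl₂.le) (rpow_nonneg (exp_pos _).le _)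
    (rpow_nonneg (Finset.sum_nonneg fun j _ => hnn1 _ j) _))
  rw [← exp_mul, ← exp_mul, ← exp_add]
  congr 1
  ring

theorem Code.one_le {n M₀ M₁ M₂ : ℕ} (c : Code X Y Xh Yh n M₀ M₁ M₂) [Nonempty X] [Nonempty Y] :
    (1 : ℝ) ≤ M₀ ∧ (1 : ℝ) ≤ M₁ ∧ (1 : ℝ) ≤ M₂ := by
  have x : Fin n → X := fun _ => Classical.arbitrary X
  have y : Fin n → Y := fun _ => Classical.arbitrary Y
  refine ⟨?_, ?_, ?_⟩
  · exact_mod_cast (c.enc₀ x y).pos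
  · exact_mod_cast (c.enc₁ x y).pos
  · exact_mod_cast (c.enc₂ x y).pos

/-- The one-shot bound, normalized. -/
theorem Code.sum_prod_mul_exp_le_one {dX : X → Xh → ℝ} {dY : Y → Yh → ℝ} {l₁ l₂ s₁ s₂ : ℝ}
    (hl₁ : 0 < l₁) (hl₂ : 0 < l₂) {P : X × Y → ℝ} (hP : P ∈ stdSimplex ℝ (X × Y)) {g : X × Y → ℝ}
    (hg : g ∈ featureHull dX dY l₁ l₂ s₁ s₂)
    (hmax : ∀ f ∈ featureHull dX dY l₁ l₂ s₁ s₂,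
      ∑ z, P z * log (f z) ≤ ∑ z, P z * log (g z)) [Nonempty X] [Nonempty Y]
    {n M₀ M₁ M₂ : ℕ} (c : Code X Y Xh Yh n M₀ M₁ M₂) :
    ∑ z : Fin n → X × Y, (∏ i, P (z i)) * exp (∑ i, -log (g (z i)) +
      -(l₁ * s₁ * (n * avgDist dX (fun i => (z i).1)
        (c.outX (fun i => (z i).1) (fun i => (z i).2))) +
        l₂ * s₂ * (n * avgDist dY (fun i => (z i).2)
        (c.outY (fun i => (z i).1) (fun i => (z i).2)))) -
      (log M₀ + l₁ * log M₁ + l₂ * log M₂)) ≤ 1 := by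
  obtain ⟨h0, h1, h2⟩ := c.one_le
  have hM0 : (0 : ℝ) < M₀ := by linarith
  have hM1 : (0 : ℝ) < M₁ := by linarith
  have hM2 : (0 : ℝ) < M₂ := by linarith
  have key := c.sum_exp_le hl₁ hl₂ hP hg hmax
  set B := log M₀ + l₁ * log M₁ + l₂ * log M₂ with hB
  have hexpB : exp B = M₀ * ((M₁ : ℝ) ^ l₁ * (M₂ : ℝ) ^ l₂) := by
    rw [hB, exp_add, exp_add, exp_log hM0, mul_comm l₁, mul_comm l₂, exp_mul, exp_mul,
      exp_log hM1, exp_log hM2, mul_assoc]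
  rw [← hexpB] at key
  set D : (Fin n → X × Y) → ℝ := fun z => -(l₁ * s₁ * (n * avgDist dX (fun i => (z i).1)
        (c.outX (fun i => (z i).1) (fun i => (z i).2))) +
        l₂ * s₂ * (n * avgDist dY (fun i => (z i).2)
        (c.outY (fun i => (z i).1) (fun i => (z i).2)))) with hD
  have : ∀ z : Fin n → X × Y, (∏ i, P (z i)) * exp (∑ i, -log (g (z i)) + D z - B) =
      (∏ i, P (z i) / g (z i)) * exp (D z) * exp (-B) := by
    intro z
    rw [sub_eq_add_neg, exp_add, exp_add, exp_sum, Finset.prod_div_distrib, div_eq_mul_inv,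
      ← Finset.prod_inv_distrib]
    simp only [exp_neg (log _), exp_log (featureHull_pos hg _)]
    ring
  change ∑ z : Fin n → X × Y, (∏ i, P (z i)) * exp (∑ i, -log (g (z i)) + D z - B) ≤ 1
  simp only [this]
  rw [← Finset.sum_mul, exp_neg, ← div_eq_mul_inv]
  exact div_le_one_of_le₀ key (exp_pos _).le

/-- The bound t + 1 ≤ exp t, averaged over the source, replaces the exponential moment by
expectations. This is the finite-blocklength form of the expected-distortion converse. -/
theorem Code.sum_neg_log_le {dX : X → Xh → ℝ} {dY : Y → Yh → ℝ} {l₁ l₂ s₁ s₂ : ℝ} (hl₁ : 0 < l₁)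
    (hl₂ : 0 < l₂) {P : X × Y → ℝ} (hP : P ∈ stdSimplex ℝ (X × Y)) {g : X × Y → ℝ}
    (hg : g ∈ featureHull dX dY l₁ l₂ s₁ s₂)
    (hmax : ∀ f ∈ featureHull dX dY l₁ l₂ s₁ s₂,
      ∑ z, P z * log (f z) ≤ ∑ z, P z * log (g z)) [Nonempty X] [Nonempty Y]
    {n M₀ M₁ M₂ : ℕ} (c : Code X Y Xh Yh n M₀ M₁ M₂) :
    n * -∑ z, P z * log (g z) ≤ log M₀ + l₁ * log M₁ + l₂ * log M₂ +
      n * (l₁ * s₁ * c.expDistX dX P + l₂ * s₂ * c.expDistY dY P) := by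
  have h3 := c.sum_prod_mul_exp_le_one hl₁ hl₂ hP hg hmax
  unfold Code.expDistX Code.expDistY
  rw [sum_fun_prod, sum_fun_prod]
  set dx : (Fin n → X × Y) → ℝ := fun z => avgDist dX (fun i => (z i).1)
        (c.outX (fun i => (z i).1) (fun i => (z i).2)) with hdx
  set dy : (Fin n → X × Y) → ℝ := fun z => avgDist dY (fun i => (z i).2)
        (c.outY (fun i => (z i).1) (fun i => (z i).2)) with hdy
  set B := log M₀ + l₁ * log M₁ + l₂ * log M₂ with hB
  set t : (Fin n → X × Y) → ℝ := fun z => ∑ i, -log (g (z i)) +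
    -(l₁ * s₁ * (n * dx z) + l₂ * s₂ * (n * dy z)) - B with ht
  have h4 : ∑ z : Fin n → X × Y, (∏ i, P (z i)) * (t z + 1) ≤ 1 :=
    (Finset.sum_le_sum fun z _ => mul_le_mul_of_nonneg_left (add_one_le_exp _)
      (prod_nonneg_of_mem hP.1 z)).trans h3
  have e1 : ∑ z : Fin n → X × Y, (∏ i, P (z i)) * (t z + 1) =
      n * ∑ z, P z * -log (g z) - (n * (l₁ * s₁ * ∑ z : Fin n → X × Y, (∏ i, P (z i)) * dx z +
        l₂ * s₂ * ∑ z : Fin n → X × Y, (∏ i, P (z i)) * dy z)) - B + 1 := by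
    have : ∀ z : Fin n → X × Y, (∏ i, P (z i)) * (t z + 1) = (∏ i, P (z i)) * ∑ i, -log (g (z i)) -
      (n * (l₁ * s₁ * ((∏ i, P (z i)) * dx z) + l₂ * s₂ * ((∏ i, P (z i)) * dy z))) +
      (∏ i, P (z i)) * (1 - B) := by
      intro z; simp only [ht]; ring
    simp only [this, Finset.sum_add_distrib, Finset.sum_sub_distrib]
    rw [sum_prod_mul_sum hP (fun z => -log (g z)), ← Finset.sum_mul, sum_prod_eq_one hP]
    simp only [← Finset.mul_sum, Finset.sum_add_distrib]
    ring
  have e2 : ∑ z, P z * -log (g z) = -∑ z, P z * log (g z) := by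
    rw [← Finset.sum_neg_distrib]
    exact Finset.sum_congr rfl fun z _ => by ring
  rw [e1, e2] at h4
  linarith

end CodeBound

/-! ### The rate region is dominated by the value set. -/

section FirstOrderConverse

variable {X Y Xh Yh : Type*} [Fintype X] [Fintype Y] [Fintype Xh] [Fintype Yh]

theorem nonempty_of_mem_stdSimplex {Z : Type*} [Fintype Z] {P : Z → ℝ} (hP : P ∈ stdSimplex ℝ Z) :
    Nonempty Z := by
  by_contra h
  rw [not_nonempty_iff] at h
  have := hP.2
  simp at this

/-- Dividing `Code.sum_neg_log_le` by n gives the inequality for achievable triples. It defines a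
closed half-space of triples, so it passes to the closure. -/
theorem lagrangian_le_of_mem_rateRegion {dX : X → Xh → ℝ} {dY : Y → Yh → ℝ} {D₁ D₂ : ℝ}
    {P : X × Y → ℝ} (hP : P ∈ stdSimplex ℝ (X × Y)) [Nonempty Xh] [Nonempty Yh]
    {l₁ l₂ g₁ g₂ c : ℝ} (hl₁ : 0 < l₁) (hl₂ : 0 < l₂) (hg₁ : 0 ≤ g₁) (hg₂ : 0 ≤ g₂)
    (hc : ∀ v ∈ valueSet dX dY P, c ≤ v 0 + l₁ * v 1 + l₂ * v 2 + g₁ * v 3 + g₂ * v 4)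
    {R : ℝ × ℝ × ℝ} (hR : R ∈ rateRegion dX dY D₁ D₂ P) :
    c ≤ R.1 + l₁ * R.2.1 + l₂ * R.2.2 + g₁ * D₁ + g₂ * D₂ := by
  obtain ⟨⟨x₀, y₀⟩⟩ := nonempty_of_mem_stdSimplex hP
  have : Nonempty X := ⟨x₀⟩
  have : Nonempty Y := ⟨y₀⟩
  have hlog2 := log_pos one_lt_two
  set S := {R : ℝ × ℝ × ℝ | c ≤ R.1 + l₁ * R.2.1 + l₂ * R.2.2 + g₁ * D₁ + g₂ * D₂} with hS
  have hclosed : IsClosed S := isClosed_le continuous_const (by fun_prop)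
  suffices h : {R | Achievable dX dY D₁ D₂ P R} ⊆ S from closure_minimal h hclosed hR
  rintro ⟨R₀, R₁, R₂⟩ ⟨M₀, M₁, M₂, C, h0, h1, h2, h3, h4⟩
  simp only [hS, Set.mem_ofPred_eq]
  -- Chosen so that l₁ s₁ is the distortion multiplier g₁ converted from bits to nats.
  set s₁ := g₁ * log 2 / l₁ with hs₁
  set s₂ := g₂ * log 2 / l₂ with hs₂
  have e1 : l₁ * s₁ = g₁ * log 2 := by rw [hs₁]; field_simp
  have e2 : l₂ * s₂ = g₂ * log 2 := by rw [hs₂]; field_simp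
  obtain ⟨g, hg, hmax⟩ := exists_isMaxOn_featureHull dX dY l₁ l₂ s₁ s₂ P
  obtain ⟨v, hv, hle⟩ := exists_valueSet_le_of_mem_featureHull dX dY s₁ s₂ hl₁.le hl₂.le hP hg
  have hcv := hc v hv
  refine le_of_forall_pos_le_add fun δ hδ => ?_
  set η := δ / (1 + l₁ + l₂ + g₁ + g₂) with hη
  have hden : 0 < 1 + l₁ + l₂ + g₁ + g₂ := by positivity
  have hηpos : 0 < η := div_pos hδ hden
  have lt_add : ∀ a : ℝ, (a : EReal) < ((a + η : ℝ) : EReal) := fun a => by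
    exact_mod_cast lt_add_of_pos_right a hηpos
  have ev0 := Filter.eventually_lt_of_limsup_lt (h0.trans_lt (lt_add _))
  have ev1 := Filter.eventually_lt_of_limsup_lt (h1.trans_lt (lt_add _))
  have ev2 := Filter.eventually_lt_of_limsup_lt (h2.trans_lt (lt_add _))
  have ev3 := Filter.eventually_lt_of_limsup_lt (h3.trans_lt (lt_add _))
  have ev4 := Filter.eventually_lt_of_limsup_lt (h4.trans_lt (lt_add _))
  obtain ⟨n, b0, b1, b2, b3, b4, hn⟩ := (ev0.and (ev1.and (ev2.and (ev3.and
    (ev4.and (Filter.eventually_gt_atTop 0)))))).exists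
  simp only [EReal.coe_lt_coe_iff] at b0 b1 b2 b3 b4
  have hn' : (0 : ℝ) < n := by exact_mod_cast hn
  have key := (C n).sum_neg_log_le hl₁ hl₂ hP hg hmax
  rw [e1, e2] at key hle
  have conv : ∀ M : ℕ, log M = n * (log 2 * (logb 2 M / n)) := by
    intro M
    rw [logb]; field_simp
  rw [conv (M₀ n), conv (M₁ n), conv (M₂ n)] at key
  have key2 : -∑ z, P z * log (g z) ≤ log 2 * (logb 2 (M₀ n) / n + l₁ * (logb 2 (M₁ n) / n) +
      l₂ * (logb 2 (M₂ n) / n) + g₁ * (C n).expDistX dX P + g₂ * (C n).expDistY dY P) := by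
    refine le_of_mul_le_mul_left (key.trans_eq ?_) hn'
    ring
  have key3 : v 0 + l₁ * v 1 + l₂ * v 2 + g₁ * v 3 + g₂ * v 4 ≤
      logb 2 (M₀ n) / n + l₁ * (logb 2 (M₁ n) / n) +
      l₂ * (logb 2 (M₂ n) / n) + g₁ * (C n).expDistX dX P + g₂ * (C n).expDistY dY P := by
    refine le_of_mul_le_mul_left (le_trans (le_of_eq ?_) (hle.trans key2)) hlog2
    ring
  have f1 := mul_le_mul_of_nonneg_left b1.le hl₁.le
  have f2 := mul_le_mul_of_nonneg_left b2.le hl₂.le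
  have f3 := mul_le_mul_of_nonneg_left b3.le hg₁
  have f4 := mul_le_mul_of_nonneg_left b4.le hg₂
  have f5 : (1 + l₁ + l₂ + g₁ + g₂) * η = δ := by rw [hη]; field_simp
  nlinarith

/-- If no value vector lay below the constraint vector, the compact convex value set could be
strictly separated from the orthant below that vector. The separating functional has nonnegative
weights, and after a small perturbation it contradicts the Lagrangian converse. -/
theorem exists_valueSet_le_of_mem_rateRegion {dX : X → Xh → ℝ} {dY : Y → Yh → ℝ} {D₁ D₂ : ℝ}
    (hdX : ∀ x xh, 0 ≤ dX x xh) (hdY : ∀ y yh, 0 ≤ dY y yh)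
    {P : X × Y → ℝ} (hP : P ∈ stdSimplex ℝ (X × Y)) [Nonempty Xh] [Nonempty Yh]
    {R : ℝ × ℝ × ℝ} (hR : R ∈ rateRegion dX dY D₁ D₂ P) :
    ∃ v ∈ valueSet dX dY P, v ≤ ![R.1, R.2.1, R.2.2, D₁, D₂] := by
  by_contra hcon
  push Not at hcon
  set r : Fin 5 → ℝ := ![R.1, R.2.1, R.2.2, D₁, D₂] with hr
  have hdisj : Disjoint (valueSet dX dY P) (Set.Iic r) :=
    Set.disjoint_left.2 fun v hv hv' => hcon v hv hv'
  obtain ⟨f, a, b, hfa, hab, hfb⟩ := geometric_hahn_banach_compact_closed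
    (convex_valueSet dX dY hP) (isCompact_valueSet dX dY hP) (convex_Iic r) isClosed_Iic hdisj
  have hf : ∀ v : Fin 5 → ℝ, f v = ∑ i, v i * f (Pi.single i 1) := by
    intro v
    have := LinearMap.pi_apply_eq_sum_univ (f : (Fin 5 → ℝ) →ₗ[ℝ] ℝ) v
    simp only [ContinuousLinearMap.coe_coe, smul_eq_mul] at this
    rw [this]
    refine Finset.sum_congr rfl fun i _ => ?_
    congr 2
    ext j
    simp [Pi.single_apply, eq_comm]
  -- The orthant is unbounded downwards, so a functional bounded below on it cannot have a positive
  -- coefficient.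
  have hneg : ∀ i, 0 ≤ -f (Pi.single i 1) := by
    intro i
    by_contra h
    push Not at h
    have hpos : 0 < f (Pi.single i 1) := by linarith
    set t := (|f r - b| + 1) / f (Pi.single i 1) with ht
    have htpos : 0 ≤ t := by positivity
    have := hfb (r - t • Pi.single i 1) (by
      rw [Set.mem_Iic, sub_le_self_iff]
      exact smul_nonneg htpos (Pi.single_nonneg.2 zero_le_one))
    rw [map_sub, map_smul, smul_eq_mul, ht, div_mul_cancel₀ _ hpos.ne'] at this
    linarith [le_abs_self (f r - b)]
  set c : Fin 5 → ℝ := fun i => -f (Pi.single i 1) with hc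
  have hfc : ∀ v, f v = -∑ i, c i * v i := by
    intro v
    rw [hf, ← Finset.sum_neg_distrib]
    exact Finset.sum_congr rfl fun i _ => by simp only [hc]; ring
  have hsep : ∀ v ∈ valueSet dX dY P, ∑ i, c i * r i + (b - a) ≤ ∑ i, c i * v i := by
    intro v hv
    have h1 := hfa v hv
    have h2 := hfb r (Set.mem_Iic.2 le_rfl)
    rw [hfc] at h1 h2
    linarith
  -- Adding `e` makes all weights strictly positive, as needed for l₁, l₂ and for dividing by the
  -- weight of the common rate, while `e` times the size of r stays below the separation gap.
  -- Nonnegativity of the value vectors keeps their side of the inequality.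
  set e := (b - a) / (2 * (1 + ∑ i, |r i|)) with he
  have hS : 0 ≤ ∑ i, |r i| := Finset.sum_nonneg fun i _ => abs_nonneg _
  have hepos : 0 < e := div_pos (by linarith) (by linarith)
  have heS : e * ∑ i, |r i| < b - a := by
    have : e * (2 * (1 + ∑ i, |r i|)) = b - a := by
      rw [he]; field_simp
    have := mul_nonneg hepos.le hS
    linarith
  have hsep2 : ∀ v ∈ valueSet dX dY P, ∑ i, (c i + e) * r i + ((b - a) - e * ∑ i, |r i|) ≤
      ∑ i, (c i + e) * v i := by
    intro v hv
    have h1 := hsep v hv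
    simp only [add_mul, Finset.sum_add_distrib, ← Finset.mul_sum]
    have h2 : 0 ≤ e * ∑ i, v i := mul_nonneg hepos.le
      (Finset.sum_nonneg fun i _ => valueSet_nonneg hP hdX hdY hv i)
    have h3 : e * ∑ i, r i ≤ e * ∑ i, |r i| := mul_le_mul_of_nonneg_left
      (Finset.sum_le_sum fun i _ => le_abs_self _) hepos.le
    linarith
  have hcp : ∀ i, 0 < c i + e := fun i => add_pos_of_nonneg_of_pos (hneg i) hepos
  have hq : ∀ i, 0 < (c i + e) / (c 0 + e) := fun i => div_pos (hcp i) (hcp 0)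
  have := lagrangian_le_of_mem_rateRegion (dX := dX) (dY := dY) (D₁ := D₁) (D₂ := D₂) hP
    (hq 1) (hq 2) (hq 3).le (hq 4).le
    (c := (∑ i, (c i + e) * r i + ((b - a) - e * ∑ i, |r i|)) / (c 0 + e)) (fun v hv => by
      rw [div_le_iff₀ (hcp 0)]
      refine (hsep2 v hv).trans_eq ?_
      rw [Fin.sum_univ_five]
      field_simp [(hcp 0).ne']) hR
  rw [div_le_iff₀ (hcp 0), Fin.sum_univ_five] at this
  have e3 : (R.1 + (c 1 + e) / (c 0 + e) * R.2.1 + (c 2 + e) / (c 0 + e) * R.2.2 +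
      (c 3 + e) / (c 0 + e) * D₁ + (c 4 + e) / (c 0 + e) * D₂) * (c 0 + e) =
      (c 0 + e) * R.1 + (c 1 + e) * R.2.1 + (c 2 + e) * R.2.2 + (c 3 + e) * D₁ +
      (c 4 + e) * D₂ := by
    field_simp [(hcp 0).ne']
  rw [e3] at this
  simp only [hr, Matrix.cons_val] at this heS
  linarith

end FirstOrderConverse

/-! ### A conditional type class of polynomially large probability. -/

section TypicalClass

variable {S A : Type*} [Fintype S] [Fintype A]

open Classical in
/-- The joint letter counts of two strings. -/
def jointCount {n : ℕ} (s : Fin n → S) (a : Fin n → A) (σ : S) (α : A) : ℕ :=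
  ∑ i, if s i = σ ∧ a i = α then 1 else 0

theorem jointCount_le {n : ℕ} (s : Fin n → S) (a : Fin n → A) (σ : S) (α : A) :
    jointCount s a σ α ≤ n := by
  classical
  refine (Finset.sum_le_sum (g := fun _ => 1) fun i _ => ?_).trans (by simp)
  split_ifs <;> simp

theorem sum_eq_sum_jointCount {n : ℕ} (s : Fin n → S) (a : Fin n → A) (f : S → A → ℝ) :
    ∑ i, f (s i) (a i) = ∑ σ, ∑ α, (jointCount s a σ α : ℝ) * f σ α := by
  classical
  simp only [jointCount, Nat.cast_sum, Finset.sum_mul]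
  have : ∀ i, f (s i) (a i) =
      ∑ σ, ∑ α, ((if s i = σ ∧ a i = α then 1 else 0 : ℕ) : ℝ) * f σ α := by
    intro i
    rw [Finset.sum_eq_single (s i), Finset.sum_eq_single (a i)]
    · simp
    · intro α _ h; simp [h.symm]
    · simp
    · intro σ _ h; simp [h.symm]
    · simp
  simp only [this]
  rw [Finset.sum_comm]
  refine Finset.sum_congr rfl fun σ _ => ?_
  rw [Finset.sum_comm]

theorem jointCount_pos {n : ℕ} (s : Fin n → S) (a : Fin n → A) (i : Fin n) :
    0 < jointCount s a (s i) (a i) := by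
  classical
  exact Finset.sum_pos' (fun _ _ => Nat.zero_le _) ⟨i, Finset.mem_univ _, by simp⟩

open Classical in
theorem jointCount_update {n : ℕ} (s : Fin n → S) (a : Fin n → A) (i : Fin n)
    (β : A) (σ : S) (α : A) :
    jointCount s (Function.update a i β) σ α + (if s i = σ ∧ a i = α then 1 else 0) =
      jointCount s a σ α + (if s i = σ ∧ β = α then 1 else 0) := by
  unfold jointCount
  rw [← Finset.add_sum_erase _ _ (Finset.mem_univ i),
    ← Finset.add_sum_erase (a := i) _ (fun j => if s j = σ ∧ a j = α then 1 else 0)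
      (Finset.mem_univ i)]
  have : ∑ j ∈ Finset.univ.erase i, (if s j = σ ∧ Function.update a i β j = α then 1 else 0) =
      ∑ j ∈ Finset.univ.erase i, (if s j = σ ∧ a j = α then 1 else 0) := by
    refine Finset.sum_congr rfl fun j hj => ?_
    rw [Function.update_of_ne (Finset.ne_of_mem_erase hj)]
  simp only [this, Function.update_self]
  ring

open Classical in
/-- Exchanging one letter shows that the most likely joint counts are close to their means. -/
theorem exchange_count {n : ℕ} (κ : S → A → ℝ) (hκ : ∀ σ α, 0 ≤ κ σ α)
    (s : Fin n → S) (c : S → A → ℕ)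
    (hpos : 0 < ∑ a : Fin n → A with jointCount s a = c, ∏ i, κ (s i) (a i))
    (hmax : ∀ c' : S → A → ℕ, ∑ a : Fin n → A with jointCount s a = c', ∏ i, κ (s i) (a i) ≤
      ∑ a : Fin n → A with jointCount s a = c, ∏ i, κ (s i) (a i)) (σ : S) (α β : A) :
    κ σ β * c σ α ≤ κ σ α * (c σ β + 1) := by
  by_cases hαβ : α = β
  · subst hαβ
    exact mul_le_mul_of_nonneg_left (by linarith) (hκ _ _)
  set pr : (S → A → ℕ) → ℝ := fun c' =>
    ∑ a : Fin n → A with jointCount s a = c', ∏ i, κ (s i) (a i) with hpr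
  -- The counts after one occurrence of (σ, α) is turned into (σ, β); the natural subtraction is
  -- only relevant when c σ α > 0.
  set c' : S → A → ℕ := fun τ δ => if τ = σ ∧ δ = β then c τ δ + 1 else
    if τ = σ ∧ δ = α then c τ δ - 1 else c τ δ with hc'
  have hc'β : c' σ β = c σ β + 1 := by simp [hc']
  set S₁ : Finset ((Fin n → A) × Fin n) :=
    Finset.univ.filter fun p => jointCount s p.1 = c ∧ s p.2 = σ ∧ p.1 p.2 = α with hS₁
  set S₂ : Finset ((Fin n → A) × Fin n) :=
    Finset.univ.filter fun p => jointCount s p.1 = c' ∧ s p.2 = σ ∧ p.1 p.2 = β with hS₂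
  -- Double counting: weighting each string of a class by its number of marked positions multiplies
  -- the class probability by the count. Changing the marked letter then injects the marked strings
  -- of c into those of `c'`.
  have count : ∀ (d : S → A → ℕ) (δ : A), ∑ p ∈ (Finset.univ.filter fun p :
      (Fin n → A) × Fin n => jointCount s p.1 = d ∧ s p.2 = σ ∧ p.1 p.2 = δ),
      ∏ i, κ (s i) (p.1 i) = d σ δ * pr d := by
    intro d δ
    rw [Finset.sum_filter, Fintype.sum_prod_type]
    simp only [hpr, Finset.mul_sum]
    rw [Finset.sum_filter]
    refine Finset.sum_congr rfl fun a _ => ?_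
    by_cases h : jointCount s a = d
    · simp only [h, true_and, if_true]
      rw [← h, jointCount, Nat.cast_sum, Finset.sum_mul]
      refine Finset.sum_congr rfl fun i _ => ?_
      split_ifs <;> simp
    · simp [h]
  have hmap : ∀ p ∈ S₁, (Function.update p.1 p.2 β, p.2) ∈ S₂ := by
    rintro ⟨a, i⟩ hp
    simp only [hS₁, hS₂, Finset.mem_filter, Finset.mem_univ, true_and] at hp ⊢
    obtain ⟨h1, h2, h3⟩ := hp
    refine ⟨?_, h2, Function.update_self _ _ _⟩
    ext τ δ
    have h := jointCount_update s a i β τ δ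
    rw [h1, h2, h3] at h
    simp only [hc']
    have hpos1 : 0 < c σ α := by
      rw [← h1, ← h2, ← h3]; exact jointCount_pos s a i
    by_cases e1 : τ = σ ∧ δ = β
    · obtain ⟨rfl, rfl⟩ := e1
      simp only [and_self, if_true, true_and, hαβ, if_false] at h ⊢
      omega
    · by_cases e2 : τ = σ ∧ δ = α
      · obtain ⟨rfl, rfl⟩ := e2
        have : ¬ (β = δ) := fun h => hαβ h.symm
        have h' : ¬ (δ = β) := hαβ
        simp only [true_and, if_true, this, h', if_false] at h ⊢
        omega
      · have e1' : ¬ (σ = τ ∧ β = δ) := fun ⟨a, b⟩ => e1 ⟨a.symm, b.symm⟩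
        have e2' : ¬ (σ = τ ∧ α = δ) := fun ⟨a, b⟩ => e2 ⟨a.symm, b.symm⟩
        simp only [e1, e2, e1', e2', if_false] at h ⊢
        omega
  have hinj : Set.InjOn (fun p : (Fin n → A) × Fin n => (Function.update p.1 p.2 β, p.2)) S₁ := by
    rintro ⟨a, i⟩ ha ⟨b, j⟩ hb hab
    simp only [Prod.mk.injEq] at hab
    obtain ⟨h1, rfl⟩ := hab
    simp only [hS₁, Finset.coe_filter, Finset.mem_univ, true_and, Set.mem_ofPred_eq] at ha hb
    congr 1
    ext k
    by_cases hk : k = i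
    · rw [hk, ha.2.2, hb.2.2]
    · have := congrFun h1 k
      rwa [Function.update_of_ne hk, Function.update_of_ne hk] at this
  have hterm : ∀ p ∈ S₁, (∏ i, κ (s i) (p.1 i)) * κ σ β =
      (∏ i, κ (s i) (Function.update p.1 p.2 β i)) * κ σ α := by
    rintro ⟨a, i⟩ hp
    simp only [hS₁, Finset.mem_filter, Finset.mem_univ, true_and] at hp
    obtain ⟨_, h2, h3⟩ := hp
    simp only
    rw [← Finset.mul_prod_erase _ _ (Finset.mem_univ i),
      ← Finset.mul_prod_erase _ (fun j => κ (s j) (Function.update a i β j)) (Finset.mem_univ i)]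
    have : ∏ j ∈ Finset.univ.erase i, κ (s j) (Function.update a i β j) =
        ∏ j ∈ Finset.univ.erase i, κ (s j) (a j) :=
      Finset.prod_congr rfl fun j hj => by
        rw [Function.update_of_ne (Finset.ne_of_mem_erase hj)]
    rw [this, Function.update_self, h2, h3]
    ring
  have hle : (c σ α * pr c) * κ σ β ≤ ((c σ β + 1) * pr c') * κ σ α := by
    have e1 := count c α
    have e2 := count c' β
    rw [hc'β] at e2
    push_cast at e2
    rw [← e1, ← e2, Finset.sum_mul, Finset.sum_mul, Finset.sum_congr rfl hterm]
    rw [← Finset.sum_image (s := S₁)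
      (g := fun p : (Fin n → A) × Fin n => (Function.update p.1 p.2 β, p.2))
      (f := fun q => (∏ i, κ (s i) (q.1 i)) * κ σ α) hinj]
    refine Finset.sum_le_sum_of_subset_of_nonneg ?_ fun q _ _ => mul_nonneg
      (Finset.prod_nonneg fun i _ => hκ _ _) (hκ _ _)
    intro q hq
    obtain ⟨p, hp, rfl⟩ := Finset.mem_image.1 hq
    exact hmap p hp
  have h2 : ((c σ β + 1) * pr c') * κ σ α ≤ ((c σ β + 1) * pr c) * κ σ α :=
    mul_le_mul_of_nonneg_right (mul_le_mul_of_nonneg_left (hmax c') (by positivity)) (hκ _ _)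
  refine le_of_mul_le_mul_right ?_ hpos
  change κ σ β * c σ α * pr c ≤ κ σ α * (c σ β + 1) * pr c
  linarith

/-- For every context string there is a set of strings, of polynomially large probability, on which
all additive statistics are within a constant of their conditional means. -/
theorem exists_typical_class {n : ℕ} (κ : S → A → ℝ) (hκ : ∀ σ, κ σ ∈ stdSimplex ℝ A)
    (s : Fin n → S) :
    ∃ C : Finset (Fin n → A),
      ((n + 1 : ℝ) ^ (Fintype.card S * Fintype.card A))⁻¹ ≤ ∑ a ∈ C, ∏ i, κ (s i) (a i) ∧
      (∀ a ∈ C, ∀ i, 0 < κ (s i) (a i)) ∧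
      ∀ (f : S → A → ℝ) (B : ℝ), 0 ≤ B → (∀ i α, 0 < κ (s i) α → |f (s i) α| ≤ B) → ∀ a ∈ C,
        |∑ i, f (s i) (a i) - ∑ i, ∑ α, κ (s i) α * f (s i) α| ≤
          (Fintype.card S * (Fintype.card A * Fintype.card A) : ℕ) * B := by
  classical
  set pr : (S → A → ℕ) → ℝ := fun c' =>
    ∑ a : Fin n → A with jointCount s a = c', ∏ i, κ (s i) (a i) with hpr
  set I : Finset (S → A → ℕ) := Finset.univ.image (fun a : Fin n → A => jointCount s a) with hI
  have hnn : ∀ a : Fin n → A, 0 ≤ ∏ i, κ (s i) (a i) := fun a =>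
    Finset.prod_nonneg fun i _ => (hκ _).1 _
  have htot : ∑ a : Fin n → A, ∏ i, κ (s i) (a i) = 1 := by
    have := Finset.prod_univ_sum (fun _ : Fin n => (Finset.univ : Finset A))
      (fun i α => κ (s i) α)
    rw [Fintype.piFinset_univ] at this
    rw [← this]
    exact Finset.prod_eq_one fun i _ => (hκ _).2
  have hsum : ∑ c ∈ I, pr c = 1 := by
    rw [← htot]
    exact Finset.sum_fiberwise_of_maps_to (fun a _ => Finset.mem_image_of_mem _ (Finset.mem_univ a))
      _
  have hIne : I.Nonempty := by
    by_contra h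
    rw [Finset.not_nonempty_iff_eq_empty] at h
    rw [h] at hsum
    simp at hsum
  -- The most probable joint count is chosen; since there are at most (n+1)^(|S||A|) of them, its
  -- probability is at least the reciprocal.
  obtain ⟨c, hcI, hcmax⟩ := I.exists_max_image pr hIne
  have hcard : (I.card : ℝ) ≤ (n + 1 : ℝ) ^ (Fintype.card S * Fintype.card A) := by
    have h1 : I ⊆ Fintype.piFinset fun _ : S => Fintype.piFinset fun _ : A =>
        Finset.range (n + 1) := by
      intro d hd
      obtain ⟨a, _, rfl⟩ := Finset.mem_image.1 hd
      simp only [Fintype.mem_piFinset, Finset.mem_range]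
      exact fun σ α => Nat.lt_succ_of_le (jointCount_le s a σ α)
    have h2 := Finset.card_le_card h1
    simp only [Fintype.card_piFinset, Finset.card_range, Finset.prod_const, Finset.card_univ,
      ← pow_mul] at h2
    rw [mul_comm]
    exact_mod_cast h2
  have hIpos : (0 : ℝ) < I.card := by exact_mod_cast hIne.card_pos
  have hprc : ((n + 1 : ℝ) ^ (Fintype.card S * Fintype.card A))⁻¹ ≤ pr c := by
    have h1 := Finset.sum_le_card_nsmul I pr (pr c) hcmax
    rw [hsum, nsmul_eq_mul] at h1
    refine (inv_anti₀ hIpos hcard).trans ?_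
    rw [inv_eq_one_div, div_le_iff₀ hIpos]
    linarith
  have hpos : 0 < pr c := lt_of_lt_of_le (by positivity) hprc
  have hmax : ∀ c', pr c' ≤ pr c := by
    intro c'
    by_cases h : c' ∈ I
    · exact hcmax c' h
    · have : pr c' = 0 := by
        simp only [hpr]
        rw [Finset.filter_eq_empty_iff.2, Finset.sum_empty]
        intro a _ ha
        exact h (ha ▸ Finset.mem_image_of_mem _ (Finset.mem_univ a))
      rw [this]; exact hpos.le
  have hex := exchange_count κ (fun σ α => (hκ σ).1 α) s c hpos hmax
  set N : S → ℝ := fun σ => ∑ α, (c σ α : ℝ) with hN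
  -- Summing the exchange inequality over β removes κ σ β and gives an upper bound on each count;
  -- the lower bound follows since the counts for a fixed σ add up to `N σ`.
  have hup : ∀ σ α, (c σ α : ℝ) ≤ κ σ α * (N σ + Fintype.card A) := by
    intro σ α
    have := Finset.sum_le_sum fun β (_ : β ∈ Finset.univ) => hex σ α β
    rw [← Finset.sum_mul, (hκ σ).2, one_mul, ← Finset.mul_sum, Finset.sum_add_distrib] at this
    simpa using this
  have hκ1 : ∀ σ α, κ σ α ≤ 1 := fun σ α => by
    rw [← (hκ σ).2]
    exact Finset.single_le_sum (fun β _ => (hκ σ).1 β) (Finset.mem_univ α)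
  have hdev : ∀ σ α, |(c σ α : ℝ) - N σ * κ σ α| ≤ Fintype.card A := by
    intro σ α
    have hA : (0 : ℝ) ≤ Fintype.card A := Nat.cast_nonneg _
    rw [abs_le]
    constructor
    · have h1 : (c σ α : ℝ) = N σ - ∑ β ∈ Finset.univ.erase α, (c σ β : ℝ) := by
        simp only [hN]
        rw [← Finset.add_sum_erase _ (fun β => (c σ β : ℝ)) (Finset.mem_univ α)]; ring
      have h2 : ∑ β ∈ Finset.univ.erase α, (c σ β : ℝ) ≤
          ∑ β ∈ Finset.univ.erase α, κ σ β * (N σ + Fintype.card A) :=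
        Finset.sum_le_sum fun β _ => hup σ β
      have h3 : ∑ β ∈ Finset.univ.erase α, κ σ β = 1 - κ σ α := by
        rw [← (hκ σ).2, ← Finset.add_sum_erase _ (fun β => κ σ β) (Finset.mem_univ α)]; ring
      rw [← Finset.sum_mul, h3] at h2
      have h4 : 0 ≤ κ σ α * Fintype.card A := mul_nonneg ((hκ σ).1 α) hA
      rw [h1]
      nlinarith
    · have := hup σ α
      have h4 : κ σ α * Fintype.card A ≤ Fintype.card A := mul_le_of_le_one_left hA (hκ1 _ _)
      linarith
  refine ⟨Finset.univ.filter fun a => jointCount s a = c, hprc, ?_, ?_⟩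
  · intro a ha i
    rw [Finset.mem_filter] at ha
    have h1 := jointCount_pos s a i
    rw [ha.2] at h1
    refine ((hκ _).1 _).lt_of_ne' fun h0 => ?_
    have h2 := hup (s i) (a i)
    rw [h0, zero_mul] at h2
    have : (0 : ℝ) < c (s i) (a i) := by exact_mod_cast h1
    linarith
  · intro f B hB hf a ha
    rw [Finset.mem_filter] at ha
    rw [sum_eq_sum_jointCount s a f, ha.2, sum_eq_sum_jointCount s a
      (fun σ _ => ∑ α, κ σ α * f σ α), ha.2, ← Finset.sum_sub_distrib]
    have hterm : ∀ σ, ∑ α, (c σ α : ℝ) * f σ α - ∑ α, (c σ α : ℝ) * ∑ α, κ σ α * f σ α =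
        ∑ α, ((c σ α : ℝ) - N σ * κ σ α) * f σ α := by
      intro σ
      rw [← Finset.sum_mul, Finset.mul_sum, ← Finset.sum_sub_distrib]
      exact Finset.sum_congr rfl fun α _ => by simp only [hN]; ring
    simp only [hterm]
    refine (Finset.abs_sum_le_sum_abs _ _).trans ((Finset.sum_le_sum (g := fun _ =>
      (Fintype.card A * Fintype.card A : ℝ) * B) fun σ _ => ?_).trans (by simp [mul_assoc]))
    refine (Finset.abs_sum_le_sum_abs _ _).trans ((Finset.sum_le_sum (g := fun _ =>
      (Fintype.card A : ℝ) * B) fun α _ => ?_).trans (by simp [mul_assoc]))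
    rw [abs_mul]
    -- The bound on f is only available for contexts that occur and letters of positive probability;
    -- in every other case the deviation is exactly zero.
    by_cases h0 : 0 < κ σ α ∧ ∃ i, s i = σ
    · obtain ⟨h0, i, rfl⟩ := h0
      exact mul_le_mul (hdev _ _) (hf i α h0) (abs_nonneg _) (Nat.cast_nonneg _)
    · have hzero : (c σ α : ℝ) - N σ * κ σ α = 0 := by
        rw [not_and_or] at h0
        rcases h0 with h0 | h0
        · have hk : κ σ α = 0 := le_antisymm (not_lt.1 h0) ((hκ σ).1 α)
          have h2 := hup σ α
          rw [hk, zero_mul] at h2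
          have := le_antisymm h2 (Nat.cast_nonneg _)
          rw [this, hk]; ring
        · push Not at h0
          have hc0 : ∀ β, c σ β = 0 := by
            intro β
            rw [← ha.2, jointCount]
            exact Finset.sum_eq_zero fun i _ => by simp [h0 i]
          simp [hN, hc0]
      rw [hzero, abs_zero, zero_mul]
      positivity

/-- Lower bound on the probability of a typical class under a different product law. -/
theorem exists_typical_class_reference {n : ℕ} (κ r : S → A → ℝ) (hκ : ∀ σ, κ σ ∈ stdSimplex ℝ A)
    (s : Fin n → S) {B : ℝ} (hB : 0 ≤ B) (hr : ∀ i α, 0 < κ (s i) α → 0 < r (s i) α)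
    (hlog : ∀ i α, 0 < κ (s i) α → |log (κ (s i) α / r (s i) α)| ≤ B) :
    ∃ C : Finset (Fin n → A),
      exp (-(∑ i, ∑ α, κ (s i) α * log (κ (s i) α / r (s i) α)) -
        (Fintype.card S * (Fintype.card A * Fintype.card A) : ℕ) * (B + log (n + 1))) ≤
          ∑ a ∈ C, ∏ i, r (s i) (a i) ∧
      (∀ a ∈ C, ∀ i, 0 < κ (s i) (a i)) ∧
      ∀ (f : S → A → ℝ) (B : ℝ), 0 ≤ B → (∀ i α, 0 < κ (s i) α → |f (s i) α| ≤ B) → ∀ a ∈ C,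
        |∑ i, f (s i) (a i) - ∑ i, ∑ α, κ (s i) α * f (s i) α| ≤
          (Fintype.card S * (Fintype.card A * Fintype.card A) : ℕ) * B := by
  obtain ⟨C, h1, h2, h3⟩ := exists_typical_class κ hκ s
  refine ⟨C, ?_, h2, h3⟩
  set K : ℕ := Fintype.card S * (Fintype.card A * Fintype.card A) with hK
  set L := ∑ i, ∑ α, κ (s i) α * log (κ (s i) α / r (s i) α) with hL
  have hn : (0 : ℝ) < n + 1 := by positivity
  -- Change of measure: on the class, the log-likelihood ratio is within a constant of its
  -- conditional mean, so the densities compare string by string.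
  have hstep : ∀ a ∈ C, (∏ i, κ (s i) (a i)) * exp (-L - K * B) ≤ ∏ i, r (s i) (a i) := by
    intro a ha
    have e1 : ∏ i, r (s i) (a i) = (∏ i, κ (s i) (a i)) *
        exp (-∑ i, log (κ (s i) (a i) / r (s i) (a i))) := by
      rw [← Finset.sum_neg_distrib, exp_sum, ← Finset.prod_mul_distrib]
      refine Finset.prod_congr rfl fun i _ => ?_
      have hk := h2 a ha i
      rw [exp_neg, exp_log (div_pos hk (hr i _ hk))]
      field_simp
    rw [e1]
    refine mul_le_mul_of_nonneg_left (exp_le_exp.2 ?_)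
      (Finset.prod_nonneg fun i _ => (hκ _).1 _)
    have := (abs_le.1 (h3 (fun σ α => log (κ σ α / r σ α)) B hB hlog a ha)).2
    linarith
  have hpow : exp (-(K * log (n + 1))) ≤
      ((n + 1 : ℝ) ^ (Fintype.card S * Fintype.card A))⁻¹ := by
    have e2 : exp (K * log ((n : ℝ) + 1)) = ((n : ℝ) + 1) ^ K := by
      rw [mul_comm, exp_mul, exp_log hn, rpow_natCast]
    rw [exp_neg, e2]
    refine inv_anti₀ (by positivity) (pow_le_pow_right₀ (by linarith [(Nat.cast_nonneg n : (0:ℝ) ≤ n)]) ?_)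
    rw [hK]
    refine Nat.mul_le_mul le_rfl ?_
    rcases Nat.eq_zero_or_pos (Fintype.card A) with h | h
    · simp [h]
    · exact Nat.le_mul_of_pos_left _ h
  calc exp (-L - K * (B + log (n + 1))) = exp (-(K * log (n + 1))) * exp (-L - K * B) := by
        rw [← exp_add]; congr 1; ring
    _ ≤ (∑ a ∈ C, ∏ i, κ (s i) (a i)) * exp (-L - K * B) :=
        mul_le_mul_of_nonneg_right (hpow.trans h1) (exp_pos _).le
    _ ≤ _ := by
        rw [Finset.sum_mul]
        exact Finset.sum_le_sum hstep

end TypicalClass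

/-! ### Greedy covering. -/

section Cover

open Classical in
/-- Greedy covering: if each point is covered by a random set with probability at least `p`, few
sets cover all points. -/
theorem exists_cover {Ω ι : Type*} [Fintype Ω] (μ : Ω → ℝ) (hμ : ∀ ω, 0 ≤ μ ω)
    (hμ1 : ∑ ω, μ ω ≤ 1) (rel : Ω → ι → Prop) (Z : Finset ι) {p : ℝ} (hp : 0 < p)
    (h : ∀ z ∈ Z, p ≤ ∑ ω with rel ω z, μ ω) [Nonempty Ω] (m : ℕ)
    (hm : Z.card * exp (-(p * m)) < 1) :
    ∃ c : Fin m → Ω, ∀ z ∈ Z, ∃ j, rel (c j) z := by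
  have key : ∀ k : ℕ, ∃ c : Fin k → Ω,
      ((Z.filter fun z => ∀ j, ¬ rel (c j) z).card : ℝ) ≤ Z.card * exp (-(p * k)) := by
    intro k
    induction k with
    | zero => exact ⟨Fin.elim0, by simp⟩
    | succ k ih =>
      obtain ⟨c, hc⟩ := ih
      set U := Z.filter fun z => ∀ j, ¬ rel (c j) z with hU
      -- On average over μ a random set covers a fraction p of the uncovered points, so some set
      -- does at least as well. Each step thus shrinks the uncovered part by a factor 1 - p ≤
      -- exp(-p).
      obtain ⟨ω, hω⟩ : ∃ ω, p * U.card ≤ ((U.filter fun z => rel ω z).card : ℝ) := by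
        rcases U.eq_empty_or_nonempty with hUe | hUne
        · exact ⟨Classical.arbitrary Ω, by simp [hUe]⟩
        by_contra hcon
        push Not at hcon
        have h1 : p * U.card ≤ ∑ ω, μ ω * ((U.filter fun z => rel ω z).card : ℝ) := by
          have : ∀ ω, μ ω * ((U.filter fun z => rel ω z).card : ℝ) =
              ∑ z ∈ U, if rel ω z then μ ω else 0 := by
            intro ω
            rw [← Finset.sum_filter, Finset.sum_const, nsmul_eq_mul, mul_comm]
          simp only [this]
          rw [Finset.sum_comm, mul_comm, ← nsmul_eq_mul]
          refine Finset.card_nsmul_le_sum _ _ _ fun z hz => ?_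
          rw [← Finset.sum_filter]
          exact h z (Finset.mem_filter.1 hz).1
        have hUpos : (0 : ℝ) < p * U.card := mul_pos hp (by exact_mod_cast hUne.card_pos)
        obtain ⟨ω₀, hω₀⟩ : ∃ ω, 0 < μ ω := by
          by_contra hall
          push Not at hall
          have : ∀ ω, μ ω = 0 := fun ω => le_antisymm (hall ω) (hμ ω)
          simp [this] at h1
          have : (0 : ℝ) < U.card := by exact_mod_cast hUne.card_pos
          nlinarith
        have h2 : ∑ ω, μ ω * ((U.filter fun z => rel ω z).card : ℝ) < ∑ ω, μ ω * (p * U.card) :=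
          Finset.sum_lt_sum (fun ω _ => mul_le_mul_of_nonneg_left (hcon ω).le (hμ ω))
            ⟨ω₀, Finset.mem_univ _, mul_lt_mul_of_pos_left (hcon ω₀) hω₀⟩
        rw [← Finset.sum_mul] at h2
        have h3 : (∑ ω, μ ω) * (p * U.card) ≤ p * U.card := mul_le_of_le_one_left hUpos.le hμ1
        linarith
      refine ⟨Fin.cons ω c, ?_⟩
      have hsplit : (Z.filter fun z => ∀ j, ¬ rel ((Fin.cons ω c : Fin (k + 1) → Ω) j) z) =
          U.filter fun z => ¬ rel ω z := by
        ext z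
        simp only [hU, Finset.mem_filter, Fin.forall_fin_succ, Fin.cons_zero, Fin.cons_succ]
        tauto
      rw [hsplit]
      have hadd := Finset.card_filter_add_card_filter_not (s := U) (fun z => rel ω z)
      have hadd' : ((U.filter fun z => rel ω z).card : ℝ) + (U.filter fun z => ¬ rel ω z).card =
          U.card := by exact_mod_cast hadd
      have h1p : 1 - p ≤ exp (-p) := by linarith [add_one_le_exp (-p)]
      calc ((U.filter fun z => ¬ rel ω z).card : ℝ) ≤ (1 - p) * U.card := by linarith
        _ ≤ exp (-p) * U.card := mul_le_mul_of_nonneg_right h1p (Nat.cast_nonneg _)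
        _ ≤ exp (-p) * (Z.card * exp (-(p * k))) := mul_le_mul_of_nonneg_left hc (exp_pos _).le
        _ = Z.card * exp (-(p * (k + 1 : ℕ))) := by
          rw [mul_left_comm, ← exp_add]; congr 2; push_cast; ring
  obtain ⟨c, hc⟩ := key m
  refine ⟨c, fun z hz => ?_⟩
  by_contra hcon
  push Not at hcon
  have h1 : 1 ≤ (Z.filter fun z => ∀ j, ¬ rel (c j) z).card :=
    Finset.card_pos.2 ⟨z, Finset.mem_filter.2 ⟨hz, hcon⟩⟩
  have h2 : (1 : ℝ) ≤ (Z.filter fun z => ∀ j, ¬ rel (c j) z).card := by exact_mod_cast h1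
  linarith

open Classical in
/-- Greedy covering with an explicit bound on the number of sets. -/
theorem exists_cover_log {Ω ι : Type*} [Fintype Ω] (μ : Ω → ℝ) (hμ : ∀ ω, 0 ≤ μ ω)
    (hμ1 : ∑ ω, μ ω ≤ 1) (rel : Ω → ι → Prop) (Z : Finset ι) {L E : ℝ} (hE : 0 ≤ E) (hL : 0 ≤ L)
    (hZ : (Z.card : ℝ) ≤ exp L) (h : ∀ z ∈ Z, exp (-E) ≤ ∑ ω with rel ω z, μ ω) [Nonempty Ω] :
    ∃ c : Fin ⌈(L + 1) * exp E⌉₊ → Ω, ∀ z ∈ Z, ∃ j, rel (c j) z := by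
  refine exists_cover μ hμ hμ1 rel Z (exp_pos (-E)) h _ ?_
  -- The extra 1 leaves at most exp(-1) < 1 uncovered points, hence none.
  have h1 : L + 1 ≤ exp (-E) * ⌈(L + 1) * exp E⌉₊ := by
    calc L + 1 = exp (-E) * ((L + 1) * exp E) := by
          rw [mul_left_comm, ← exp_add]; simp
      _ ≤ _ := mul_le_mul_of_nonneg_left (Nat.le_ceil _) (exp_pos _).le
  calc (Z.card : ℝ) * exp (-(exp (-E) * ⌈(L + 1) * exp E⌉₊)) ≤ exp L * exp (-(L + 1)) :=
        mul_le_mul hZ (exp_le_exp.2 (neg_le_neg h1)) (exp_pos _).le (exp_pos _).le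
    _ = exp (-1) := by rw [← exp_add]; congr 1; ring
    _ < 1 := by rw [exp_lt_one_iff]; norm_num

theorem log_ceil_le {L E : ℝ} (hE : 0 ≤ E) (hL : 0 ≤ L) :
    0 < ⌈(L + 1) * exp E⌉₊ ∧ log (⌈(L + 1) * exp E⌉₊ : ℝ) ≤ E + log (L + 2) := by
  have hpos : 0 < (L + 1) * exp E := mul_pos (by linarith) (exp_pos _)
  have hc : 0 < ⌈(L + 1) * exp E⌉₊ := Nat.ceil_pos.2 hpos
  refine ⟨hc, ?_⟩
  have h1 : (⌈(L + 1) * exp E⌉₊ : ℝ) ≤ (L + 2) * exp E := by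
    have := (Nat.ceil_lt_add_one hpos.le).le
    have h2 := one_le_exp hE
    nlinarith
  refine (log_le_log (by exact_mod_cast hc) h1).trans_eq ?_
  rw [log_mul (by linarith) (exp_pos _).ne', log_exp, add_comm]

end Cover

/-! ### From typical classes to random codebooks for one test channel. -/

section CoverPoint

variable {X Y Xh Yh W : Type*} [Fintype X] [Fintype Y] [Fintype Xh] [Fintype Yh] [Fintype W]

theorem abs_sum_mul_le {A : Type*} [Fintype A] {p f : A → ℝ} (hp : p ∈ stdSimplex ℝ A) {B : ℝ}
    (hf : ∀ a, 0 < p a → |f a| ≤ B) : |∑ a, p a * f a| ≤ B := by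
  refine (Finset.abs_sum_le_sum_abs _ _).trans ((Finset.sum_le_sum (g := fun a => p a * B)
    fun a _ => ?_).trans_eq ?_)
  · rw [abs_mul, abs_of_nonneg (hp.1 a)]
    rcases (hp.1 a).eq_or_lt with h | h
    · simp [← h]
    · exact mul_le_mul_of_nonneg_left (hf a h) h.le
  · rw [← Finset.sum_mul, hp.2, one_mul]

/-- The probability that a random reproduction string, drawn from the letter laws `u (w i)`, is
within total distortion `τ` of `x`. -/
def ballProb {A B W : Type*} [Fintype B] {n : ℕ} (d : A → B → ℝ) (u : W → B → ℝ) (x : Fin n → A)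
    (w : Fin n → W) (τ : ℝ) : ℝ :=
  by classical exact ∑ b : Fin n → B with ∑ i, d (x i) (b i) ≤ τ, ∏ i, u (w i) (b i)

/-- The typical class is taken with context (x, w), while the reference law u depends on w alone.
Every member of the class respects the distortion bound, so the ball contains a class of known
probability. -/
theorem ballProb_ge {A B : Type*} [Fintype A] [Fintype B] {n : ℕ} (d : A → B → ℝ)
    (κ : A → W → B → ℝ) (hκ : ∀ a w, κ a w ∈ stdSimplex ℝ B) (u : W → B → ℝ)
    (hu0 : ∀ w b, 0 ≤ u w b) {β : ℝ} (hβ : 0 ≤ β) (hd : ∀ a b, |d a b| ≤ β)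
    (x : Fin n → A) (w : Fin n → W)
    (hu : ∀ i b, 0 < κ (x i) (w i) b → 0 < u (w i) b ∧ |log (κ (x i) (w i) b / u (w i) b)| ≤ β)
    {L τ : ℝ} {K : ℕ} (hK : K = Fintype.card A * Fintype.card W * (Fintype.card B * Fintype.card B))
    (hL : ∑ i, ∑ b, κ (x i) (w i) b * log (κ (x i) (w i) b / u (w i) b) ≤ L)
    (hτ : ∑ i, ∑ b, κ (x i) (w i) b * d (x i) b + K * β ≤ τ) :
    exp (-L - K * (β + log (n + 1))) ≤ ballProb d u x w τ := by
  classical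
  obtain ⟨C, h1, _, h3⟩ := exists_typical_class_reference
    (fun (σ : A × W) b => κ σ.1 σ.2 b) (fun (σ : A × W) b => u σ.2 b) (fun σ => hκ _ _)
    (fun i => (x i, w i)) hβ (fun i b hb => (hu i b hb).1) (fun i b hb => (hu i b hb).2)
  rw [Fintype.card_prod, ← hK] at h1 h3
  refine le_trans (exp_le_exp.2 (by linarith)) (h1.trans ?_)
  unfold ballProb
  refine Finset.sum_le_sum_of_subset_of_nonneg (fun b hb => ?_)
    (fun b _ _ => Finset.prod_nonneg fun i _ => hu0 _ _)
  rw [Finset.mem_filter]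
  refine ⟨Finset.mem_univ _, ?_⟩
  have := (abs_le.1 (h3 (fun σ b => d σ.1 b) β hβ (fun i b _ => hd _ _) b hb)).2
  simp only at this
  linarith

/-- The auxiliary strings are drawn from a typical class given z. On it the sums of the conditional
divergences and distortions are additive statistics, hence within a constant of their means, and
`ballProb_ge` makes both reproduction balls large for every auxiliary string of the class. -/
theorem exists_cover_point {n : ℕ} {dX : X → Xh → ℝ} {dY : Y → Yh → ℝ} {β : ℝ} (hβ : 0 ≤ β)
    (hdX : ∀ x xh, |dX x xh| ≤ β) (hdY : ∀ y yh, |dY y yh| ≤ β)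
    (V : X × Y → W → ℝ) (hV : ∀ z, V z ∈ stdSimplex ℝ W) (q : W → ℝ) (hq0 : ∀ w, 0 ≤ q w)
    (κX : X → W → Xh → ℝ) (hκX : ∀ x w, κX x w ∈ stdSimplex ℝ Xh) (uX : W → Xh → ℝ)
    (huX : ∀ w b, 0 ≤ uX w b)
    (κY : Y → W → Yh → ℝ) (hκY : ∀ y w, κY y w ∈ stdSimplex ℝ Yh) (uY : W → Yh → ℝ)
    (huY : ∀ w b, 0 ≤ uY w b)
    (z : Fin n → X × Y)
    (hq : ∀ i w, 0 < V (z i) w → 0 < q w ∧ |log (V (z i) w / q w)| ≤ β)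
    (hX : ∀ i w, 0 < V (z i) w → ∀ b, 0 < κX (z i).1 w b → 0 < uX w b ∧
      |log (κX (z i).1 w b / uX w b)| ≤ β)
    (hY : ∀ i w, 0 < V (z i) w → ∀ b, 0 < κY (z i).2 w b → 0 < uY w b ∧
      |log (κY (z i).2 w b / uY w b)| ≤ β)
    {K : ℕ} (hK : K = Fintype.card (X × Y) * (Fintype.card W * Fintype.card W) +
      Fintype.card X * Fintype.card W * (Fintype.card Xh * Fintype.card Xh) +
      Fintype.card Y * Fintype.card W * (Fintype.card Yh * Fintype.card Yh))
    {E₀ E₁ E₂ τ₁ τ₂ : ℝ}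
    (hE₀ : ∑ i, ∑ w, V (z i) w * log (V (z i) w / q w) + K * (β + log (n + 1)) ≤ E₀)
    (hE₁ : ∑ i, ∑ w, V (z i) w * ∑ b, κX (z i).1 w b * log (κX (z i).1 w b / uX w b) +
      K * (β + log (n + 1)) ≤ E₁)
    (hE₂ : ∑ i, ∑ w, V (z i) w * ∑ b, κY (z i).2 w b * log (κY (z i).2 w b / uY w b) +
      K * (β + log (n + 1)) ≤ E₂)
    (hτ₁ : ∑ i, ∑ w, V (z i) w * ∑ b, κX (z i).1 w b * dX (z i).1 b + K * β ≤ τ₁)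
    (hτ₂ : ∑ i, ∑ w, V (z i) w * ∑ b, κY (z i).2 w b * dY (z i).2 b + K * β ≤ τ₂) :
    ∃ C : Finset (Fin n → W), exp (-E₀) ≤ ∑ w ∈ C, ∏ i, q (w i) ∧ ∀ w ∈ C,
      exp (-E₁) ≤ ballProb dX uX (fun i => (z i).1) w τ₁ ∧
      exp (-E₂) ≤ ballProb dY uY (fun i => (z i).2) w τ₂ := by
  obtain ⟨C, h1, h2, h3⟩ := exists_typical_class_reference V (fun _ => q) hV z hβ
    (fun i w hw => (hq i w hw).1) (fun i w hw => (hq i w hw).2)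
  set K₀ : ℕ := Fintype.card (X × Y) * (Fintype.card W * Fintype.card W) with hK₀
  set K₁ : ℕ := Fintype.card X * Fintype.card W * (Fintype.card Xh * Fintype.card Xh) with hK₁
  set K₂ : ℕ := Fintype.card Y * Fintype.card W * (Fintype.card Yh * Fintype.card Yh) with hK₂
  have hKr : (K : ℝ) = K₀ + K₁ + K₂ := by rw [hK]; push_cast; ring
  have hlog : 0 ≤ log ((n : ℝ) + 1) := log_nonneg (by linarith [(Nat.cast_nonneg n : (0:ℝ) ≤ n)])
  have p0 : (0 : ℝ) ≤ K₀ := Nat.cast_nonneg _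
  have p1 : (0 : ℝ) ≤ K₁ := Nat.cast_nonneg _
  have p2 : (0 : ℝ) ≤ K₂ := Nat.cast_nonneg _
  have q0 := mul_nonneg p0 hlog
  have q1 := mul_nonneg p1 hlog
  have q2 := mul_nonneg p2 hlog
  have r0 := mul_nonneg p0 hβ
  have r1 := mul_nonneg p1 hβ
  have r2 := mul_nonneg p2 hβ
  rw [hKr] at hE₀ hE₁ hE₂ hτ₁ hτ₂
  refine ⟨C, le_trans (exp_le_exp.2 (by linarith)) h1, fun w hw => ⟨?_, ?_⟩⟩
  · have s1 := (abs_le.1 (h3 (fun z w => ∑ b, κX z.1 w b * log (κX z.1 w b / uX w b)) β hβ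
      (fun i w' hw' => abs_sum_mul_le (hκX _ _) fun b hb => (hX i w' hw' b hb).2) w hw)).2
    have s2 := (abs_le.1 (h3 (fun z w => ∑ b, κX z.1 w b * dX z.1 b) β hβ
      (fun i w' hw' => abs_sum_mul_le (hκX _ _) fun b hb => hdX _ _) w hw)).2
    refine le_trans (exp_le_exp.2 ?_) (ballProb_ge dX κX hκX uX huX hβ hdX _ w
      (fun i b hb => hX i (w i) (h2 w hw i) b hb) hK₁ (sub_le_iff_le_add'.1 s1) ?_)
    · linarith
    · linarith
  · have s1 := (abs_le.1 (h3 (fun z w => ∑ b, κY z.2 w b * log (κY z.2 w b / uY w b)) β hβ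
      (fun i w' hw' => abs_sum_mul_le (hκY _ _) fun b hb => (hY i w' hw' b hb).2) w hw)).2
    have s2 := (abs_le.1 (h3 (fun z w => ∑ b, κY z.2 w b * dY z.2 b) β hβ
      (fun i w' hw' => abs_sum_mul_le (hκY _ _) fun b hb => hdY _ _) w hw)).2
    refine le_trans (exp_le_exp.2 ?_) (ballProb_ge dY κY hκY uY huY hβ hdY _ w
      (fun i b hb => hY i (w i) (h2 w hw i) b hb) hK₂ (sub_le_iff_le_add'.1 s1) ?_)
    · linarith
    · linarith

theorem sum_prod_le_one {A : Type*} [Fintype A] {n : ℕ} (p : Fin n → A → ℝ)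
    (hp : ∀ i a, 0 ≤ p i a) (hp1 : ∀ i, ∑ a, p i a ≤ 1) :
    ∑ a : Fin n → A, ∏ i, p i (a i) ≤ 1 := by
  classical
  have := Finset.prod_univ_sum (fun _ : Fin n => (Finset.univ : Finset A)) p
  rw [Fintype.piFinset_univ] at this
  rw [← this]
  exact Finset.prod_le_one (fun i _ => Finset.sum_nonneg fun a _ => hp i a) fun i _ => hp1 i

/-- A private codebook for every auxiliary string. -/
theorem exists_private_codebook {A B : Type*} [Fintype A] [Fintype B] [Nonempty A] [Nonempty B]
    {n : ℕ} (d : A → B → ℝ) (u : W → B → ℝ) (hu0 : ∀ w b, 0 ≤ u w b) (hu1 : ∀ w, ∑ b, u w b ≤ 1)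
    {E τ : ℝ} (hE : 0 ≤ E) :
    ∃ c : (Fin n → W) → Fin ⌈(n * log (Fintype.card A) + 1) * exp E⌉₊ → (Fin n → B),
      ∀ w x, exp (-E) ≤ ballProb d u x w τ → ∃ j, ∑ i, d (x i) (c w j i) ≤ τ := by
  classical
  have hcard : (1 : ℝ) ≤ Fintype.card A := by exact_mod_cast Fintype.card_pos
  have : ∀ w : Fin n → W, ∃ c : Fin ⌈(n * log (Fintype.card A) + 1) * exp E⌉₊ → (Fin n → B),
      ∀ x, exp (-E) ≤ ballProb d u x w τ → ∃ j, ∑ i, d (x i) (c j i) ≤ τ := by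
    intro w
    obtain ⟨c, hc⟩ := exists_cover_log (fun b : Fin n → B => ∏ i, u (w i) (b i))
      (fun b => Finset.prod_nonneg fun i _ => hu0 _ _)
      (sum_prod_le_one (fun i => u (w i)) (fun i => hu0 _) (fun i => hu1 _))
      (fun b (x : Fin n → A) => ∑ i, d (x i) (b i) ≤ τ)
      (Finset.univ.filter fun x : Fin n → A => exp (-E) ≤ ballProb d u x w τ) hE
      (L := n * log (Fintype.card A)) (mul_nonneg (Nat.cast_nonneg _) (log_nonneg hcard)) (by
        have h1 : (Finset.univ.filter fun x : Fin n → A => exp (-E) ≤ ballProb d u x w τ).card ≤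
            Fintype.card A ^ n := by
          refine (Finset.card_filter_le _ _).trans_eq ?_
          simp
        rw [mul_comm, exp_mul, exp_log (by linarith), rpow_natCast]
        exact_mod_cast h1) (fun x hx => by
        have := (Finset.mem_filter.1 hx).2
        refine this.trans (le_of_eq ?_)
        unfold ballProb
        congr)
    exact ⟨c, fun x hx => hc x (Finset.mem_filter.2 ⟨Finset.mem_univ _, hx⟩)⟩
  choose c hc using this
  exact ⟨c, hc⟩

/-- Codes from a pointwise covering estimate. -/
theorem exists_code_of_cover [Nonempty X] [Nonempty Y] [Nonempty Xh] [Nonempty Yh] [Nonempty W]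
    {n : ℕ} {dX : X → Xh → ℝ} {dY : Y → Yh → ℝ} {ι : Type*} [Fintype ι] [Nonempty ι]
    (q : ι → W → ℝ) (hq : ∀ t, q t ∈ stdSimplex ℝ W) (uX : W → Xh → ℝ)
    (huX0 : ∀ w b, 0 ≤ uX w b) (huX1 : ∀ w, ∑ b, uX w b ≤ 1) (uY : W → Yh → ℝ)
    (huY0 : ∀ w b, 0 ≤ uY w b) (huY1 : ∀ w, ∑ b, uY w b ≤ 1) {E₀ E₁ E₂ τ₁ τ₂ : ℝ} (hE₀ : 0 ≤ E₀)
    (hE₁ : 0 ≤ E₁) (hE₂ : 0 ≤ E₂) (G : Finset (Fin n → X × Y))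
    (hG : ∀ z ∈ G, ∃ t, ∃ C : Finset (Fin n → W), exp (-E₀) ≤ ∑ w ∈ C, ∏ i, q t (w i) ∧ ∀ w ∈ C,
      exp (-E₁) ≤ ballProb dX uX (fun i => (z i).1) w τ₁ ∧
      exp (-E₂) ≤ ballProb dY uY (fun i => (z i).2) w τ₂) :
    ∃ (M₀ M₁ M₂ : ℕ) (c : Code X Y Xh Yh n M₀ M₁ M₂),
      log M₀ ≤ E₀ + log (Fintype.card ι) + log (n * log (Fintype.card (X × Y)) + 2) ∧
      log M₁ ≤ E₁ + log (n * log (Fintype.card X) + 2) ∧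
      log M₂ ≤ E₂ + log (n * log (Fintype.card Y) + 2) ∧
      ∀ z ∈ G, ∑ i, dX (z i).1 (c.outX (fun i => (z i).1) (fun i => (z i).2) i) ≤ τ₁ ∧
        ∑ i, dY (z i).2 (c.outY (fun i => (z i).1) (fun i => (z i).2) i) ≤ τ₂ := by
  classical
  have lX : 0 ≤ (n : ℝ) * log (Fintype.card X) := mul_nonneg (Nat.cast_nonneg _)
      (log_nonneg (by exact_mod_cast Fintype.card_pos))
  have lY : 0 ≤ (n : ℝ) * log (Fintype.card Y) := mul_nonneg (Nat.cast_nonneg _)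
      (log_nonneg (by exact_mod_cast Fintype.card_pos))
  have lZ : 0 ≤ (n : ℝ) * log (Fintype.card (X × Y)) := mul_nonneg (Nat.cast_nonneg _)
      (log_nonneg (by exact_mod_cast Fintype.card_pos))
  have hcZ : (1 : ℝ) ≤ Fintype.card (X × Y) := by exact_mod_cast Fintype.card_pos
  have hcι : (1 : ℝ) ≤ Fintype.card ι := by exact_mod_cast Fintype.card_pos
  have hcι0 : (0 : ℝ) < Fintype.card ι := by linarith
  obtain ⟨cX, hcX⟩ := exists_private_codebook (n := n) dX uX huX0 huX1 (τ := τ₁) hE₁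
  obtain ⟨cY, hcY⟩ := exists_private_codebook (n := n) dY uY huY0 huY1 (τ := τ₂) hE₂
  have hE₀' : 0 ≤ E₀ + log (Fintype.card ι) := add_nonneg hE₀ (log_nonneg hcι)
  have hprod : ∀ t (w : Fin n → W), 0 ≤ ∏ i, q t (w i) := fun t w =>
    Finset.prod_nonneg fun i _ => (hq t).1 _
  -- Drawing the label uniformly lets one common codebook serve all labels, at a cost of log |ι|.
  set μ : (Fin n → W) → ℝ := fun w => (∑ t, ∏ i, q t (w i)) / Fintype.card ι with hμ
  have hμ0 : ∀ w, 0 ≤ μ w := fun w => div_nonneg (Finset.sum_nonneg fun t _ => hprod t w) hcι0.le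
  have hμ1 : ∑ w, μ w ≤ 1 := by
    simp only [hμ]
    rw [← Finset.sum_div, Finset.sum_comm, div_le_one hcι0]
    refine (Finset.sum_le_sum (g := fun _ => 1) fun t _ =>
      sum_prod_le_one (fun _ => q t) (fun _ => (hq t).1) (fun _ => (hq t).2.le)).trans ?_
    simp
  obtain ⟨c₀, hc₀⟩ := exists_cover_log μ hμ0 hμ1
    (fun w (z : Fin n → X × Y) => exp (-E₁) ≤ ballProb dX uX (fun i => (z i).1) w τ₁ ∧
      exp (-E₂) ≤ ballProb dY uY (fun i => (z i).2) w τ₂) G hE₀' lZ (by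
        have h1 : G.card ≤ Fintype.card (X × Y) ^ n := by
          refine (Finset.card_le_univ _).trans_eq ?_
          simp
        rw [mul_comm, exp_mul, exp_log (by linarith), rpow_natCast]
        exact_mod_cast h1) (fun z hz => by
        obtain ⟨t, C, h1, h2⟩ := hG z hz
        rw [neg_add, exp_add, exp_neg (log _), exp_log hcι0, ← div_eq_mul_inv]
        refine (div_le_div_of_nonneg_right h1 hcι0.le).trans ?_
        rw [Finset.sum_div]
        refine (Finset.sum_le_sum (g := μ) fun w _ => div_le_div_of_nonneg_right
          (Finset.single_le_sum (f := fun t => ∏ i, q t (w i)) (fun t _ => hprod t w)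
            (Finset.mem_univ t)) hcι0.le).trans ?_
        have h3 : C ⊆ Finset.univ.filter fun w => exp (-E₁) ≤ ballProb dX uX (fun i => (z i).1) w τ₁ ∧
            exp (-E₂) ≤ ballProb dY uY (fun i => (z i).2) w τ₂ := fun w hw =>
          Finset.mem_filter.2 ⟨Finset.mem_univ _, h2 w hw⟩
        refine (Finset.sum_le_sum_of_subset_of_nonneg h3 fun w _ _ => hμ0 w).trans (le_of_eq ?_)
        congr)
  obtain ⟨p₀, b₀⟩ := log_ceil_le hE₀' lZ
  obtain ⟨p₁, b₁⟩ := log_ceil_le hE₁ lX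
  obtain ⟨p₂, b₂⟩ := log_ceil_le hE₂ lY
  have henc : ∀ z : Fin n → X × Y, ∃ (j₀ : Fin _) (j₁ : Fin _) (j₂ : Fin _), z ∈ G →
      ∑ i, dX (z i).1 (cX (c₀ j₀) j₁ i) ≤ τ₁ ∧ ∑ i, dY (z i).2 (cY (c₀ j₀) j₂ i) ≤ τ₂ := by
    intro z
    by_cases hz : z ∈ G
    · obtain ⟨j₀, h1, h2⟩ := hc₀ z hz
      obtain ⟨j₁, h3⟩ := hcX _ _ h1
      obtain ⟨j₂, h4⟩ := hcY _ _ h2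
      exact ⟨j₀, j₁, j₂, fun _ => ⟨h3, h4⟩⟩
    · exact ⟨⟨0, p₀⟩, ⟨0, p₁⟩, ⟨0, p₂⟩, fun h => absurd h hz⟩
  choose e₀ e₁ e₂ he using henc
  refine ⟨_, _, _, ⟨fun x y => e₀ fun i => (x i, y i), fun x y => e₁ fun i => (x i, y i),
    fun x y => e₂ fun i => (x i, y i), fun m j => cX (c₀ m) j, fun m j => cY (c₀ m) j⟩,
    b₀, b₁, b₂, fun z hz => he z hz⟩

end CoverPoint

/-! ### Codes from type-dependent mixtures of test channels. -/

section FamilyCode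

variable {X Y Xh Yh : Type*} [Fintype X] [Fintype Y] [Fintype Xh] [Fintype Yh]

namespace TestChannel

variable {W : Type*} [Fintype W] (T : TestChannel X Y Xh Yh W)

/-- The first private rate of a test channel, in nats, given the source letters. -/
def rateX (P : X × Y → ℝ) (z : X × Y) : ℝ := ∑ w, T.chW z.1 z.2 w * T.denX P z.1 w

/-- The second private rate of a test channel, in nats, given the source letters. -/
def rateY (P : X × Y → ℝ) (z : X × Y) : ℝ := ∑ w, T.chW z.1 z.2 w * T.denY P z.2 w

/-- The first distortion of a test channel given the source letters. -/
def lossX (dX : X → Xh → ℝ) (z : X × Y) : ℝ := ∑ w, T.chW z.1 z.2 w * T.avgDX dX z.1 w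

/-- The second distortion of a test channel given the source letters. -/
def lossY (dY : Y → Yh → ℝ) (z : X × Y) : ℝ := ∑ w, T.chW z.1 z.2 w * T.avgDY dY z.2 w

theorem sum_pXhGivenW_le_one {P : X × Y → ℝ} (hP : ∀ z, 0 ≤ P z) (w : W) :
    ∑ b, T.pXhGivenW P w b ≤ 1 := by
  rcases (T.pW_nonneg hP w).eq_or_lt with h | h
  · simp [pXhGivenW, ← h]
  · exact (T.pXhGivenW_mem hP h).2.le

theorem sum_pYhGivenW_le_one {P : X × Y → ℝ} (hP : ∀ z, 0 ≤ P z) (w : W) :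
    ∑ b, T.pYhGivenW P w b ≤ 1 := by
  rcases (T.pW_nonneg hP w).eq_or_lt with h | h
  · simp [pYhGivenW, ← h]
  · exact (T.pYhGivenW_mem hP h).2.le

/-- Bound on all log-likelihood ratios and distortions. -/
def logBound (dX : X → Xh → ℝ) (dY : Y → Yh → ℝ) (P : X × Y → ℝ) : ℝ :=
  ∑ z : X × Y, ∑ w, |log (T.chW z.1 z.2 w / T.pW P w)| +
    ∑ x, ∑ w, ∑ b, |log (T.chX x w b / T.pXhGivenW P w b)| +
    ∑ y, ∑ w, ∑ b, |log (T.chY y w b / T.pYhGivenW P w b)| +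
    ∑ x, ∑ b, |dX x b| + ∑ y, ∑ b, |dY y b|

theorem logBound_ge (dX : X → Xh → ℝ) (dY : Y → Yh → ℝ) (P : X × Y → ℝ) :
    (∀ (z : X × Y) w, |log (T.chW z.1 z.2 w / T.pW P w)| ≤ T.logBound dX dY P) ∧
    (∀ x w b, |log (T.chX x w b / T.pXhGivenW P w b)| ≤ T.logBound dX dY P) ∧
    (∀ y w b, |log (T.chY y w b / T.pYhGivenW P w b)| ≤ T.logBound dX dY P) ∧
    (∀ x b, |dX x b| ≤ T.logBound dX dY P) ∧ (∀ y b, |dY y b| ≤ T.logBound dX dY P) := by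
  have n1 : 0 ≤ ∑ z : X × Y, ∑ w, |log (T.chW z.1 z.2 w / T.pW P w)| := by positivity
  have n2 : 0 ≤ ∑ x, ∑ w, ∑ b, |log (T.chX x w b / T.pXhGivenW P w b)| := by positivity
  have n3 : 0 ≤ ∑ y, ∑ w, ∑ b, |log (T.chY y w b / T.pYhGivenW P w b)| := by positivity
  have n4 : 0 ≤ ∑ x, ∑ b, |dX x b| := by positivity
  have n5 : 0 ≤ ∑ y, ∑ b, |dY y b| := by positivity
  unfold logBound
  refine ⟨fun z w => ?_, fun x w b => ?_, fun y w b => ?_, fun x b => ?_, fun y b => ?_⟩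
  · have := (Finset.single_le_sum (f := fun w => |log (T.chW z.1 z.2 w / T.pW P w)|)
      (fun _ _ => abs_nonneg _) (Finset.mem_univ w)).trans
      (Finset.single_le_sum (f := fun z : X × Y => ∑ w, |log (T.chW z.1 z.2 w / T.pW P w)|)
      (fun _ _ => by positivity) (Finset.mem_univ z))
    linarith
  · have := ((Finset.single_le_sum (f := fun b => |log (T.chX x w b / T.pXhGivenW P w b)|)
      (fun _ _ => abs_nonneg _) (Finset.mem_univ b)).trans
      (Finset.single_le_sum (f := fun w => ∑ b, |log (T.chX x w b / T.pXhGivenW P w b)|)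
      (fun _ _ => by positivity) (Finset.mem_univ w))).trans
      (Finset.single_le_sum (f := fun x => ∑ w, ∑ b, |log (T.chX x w b / T.pXhGivenW P w b)|)
      (fun _ _ => by positivity) (Finset.mem_univ x))
    linarith
  · have := ((Finset.single_le_sum (f := fun b => |log (T.chY y w b / T.pYhGivenW P w b)|)
      (fun _ _ => abs_nonneg _) (Finset.mem_univ b)).trans
      (Finset.single_le_sum (f := fun w => ∑ b, |log (T.chY y w b / T.pYhGivenW P w b)|)
      (fun _ _ => by positivity) (Finset.mem_univ w))).trans
      (Finset.single_le_sum (f := fun y => ∑ w, ∑ b, |log (T.chY y w b / T.pYhGivenW P w b)|)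
      (fun _ _ => by positivity) (Finset.mem_univ y))
    linarith
  · have := (Finset.single_le_sum (f := fun b => |dX x b|)
      (fun _ _ => abs_nonneg _) (Finset.mem_univ b)).trans
      (Finset.single_le_sum (f := fun x => ∑ b, |dX x b|)
      (fun _ _ => by positivity) (Finset.mem_univ x))
    linarith
  · have := (Finset.single_le_sum (f := fun b => |dY y b|)
      (fun _ _ => abs_nonneg _) (Finset.mem_univ b)).trans
      (Finset.single_le_sum (f := fun x => ∑ b, |dY x b|)
      (fun _ _ => by positivity) (Finset.mem_univ y))
    linarith

theorem logBound_nonneg (dX : X → Xh → ℝ) (dY : Y → Yh → ℝ) (P : X × Y → ℝ) :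
    0 ≤ T.logBound dX dY P := by
  unfold logBound; positivity

end TestChannel

/-- Codes for a set of source strings, from a finite family of test channels mixed with weights
that may depend on a label with polynomially many values. -/
theorem exists_code_of_family {J : Type*} [Fintype J] [Nonempty J] {k : J → ℕ}
    (T : ∀ j, TestChannel X Y Xh Yh (Fin (k j))) (dX : X → Xh → ℝ) (dY : Y → Yh → ℝ)
    {P : X × Y → ℝ} (hP : P ∈ stdSimplex ℝ (X × Y)) [Nonempty Xh] [Nonempty Yh] :
    ∃ K : ℝ, 0 ≤ K ∧ ∀ (n : ℕ) (G : Finset (Fin n → X × Y)), (∀ z ∈ G, ∀ i, 0 < P (z i)) →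
      ∀ (typ : (Fin n → X × Y) → (X × Y → Fin (n + 1))) (θ : (X × Y → Fin (n + 1)) → J → ℝ),
      (∀ t, θ t ∈ stdSimplex ℝ J) → ∀ (E₀ E₁ E₂ τ₁ τ₂ : ℝ), 0 ≤ E₀ → 0 ≤ E₁ → 0 ≤ E₂ →
      (∀ z ∈ G, ∑ i, ∑ j, θ (typ z) j * (T j).denW P (z i) ≤ E₀ ∧
        ∑ i, ∑ j, θ (typ z) j * (T j).rateX P (z i) ≤ E₁ ∧
        ∑ i, ∑ j, θ (typ z) j * (T j).rateY P (z i) ≤ E₂ ∧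
        ∑ i, ∑ j, θ (typ z) j * (T j).lossX dX (z i) ≤ τ₁ ∧
        ∑ i, ∑ j, θ (typ z) j * (T j).lossY dY (z i) ≤ τ₂) →
      ∃ (M₀ M₁ M₂ : ℕ) (c : Code X Y Xh Yh n M₀ M₁ M₂),
        log M₀ ≤ E₀ + K * (1 + log (n + 1)) ∧ log M₁ ≤ E₁ + K * (1 + log (n + 1)) ∧
        log M₂ ≤ E₂ + K * (1 + log (n + 1)) ∧
        ∀ z ∈ G, ∑ i, dX (z i).1 (c.outX (fun i => (z i).1) (fun i => (z i).2) i) ≤ τ₁ + K ∧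
          ∑ i, dY (z i).2 (c.outY (fun i => (z i).1) (fun i => (z i).2) i) ≤ τ₂ + K := by
  classical
  obtain ⟨⟨x₀, y₀⟩⟩ := nonempty_of_mem_stdSimplex hP
  have : Nonempty X := ⟨x₀⟩
  have : Nonempty Y := ⟨y₀⟩
  -- The auxiliary letter carries the index of the test channel, so the mixture is a single channel
  -- whose information quantities are averages with weights θ.
  set W := Σ j, Fin (k j) with hW
  have hWne : Nonempty W := by
    obtain ⟨w⟩ := nonempty_of_mem_stdSimplex ((T (Classical.arbitrary J)).pW_mem hP)
    exact ⟨⟨_, w⟩⟩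
  set β := ∑ j, (T j).logBound dX dY P with hβ
  have hβ0 : 0 ≤ β := Finset.sum_nonneg fun j _ => (T j).logBound_nonneg dX dY P
  have hβj : ∀ j, (T j).logBound dX dY P ≤ β := fun j =>
    Finset.single_le_sum (f := fun j => (T j).logBound dX dY P)
      (fun j _ => (T j).logBound_nonneg dX dY P) (Finset.mem_univ j)
  set K₀ : ℕ := Fintype.card (X × Y) * (Fintype.card W * Fintype.card W) +
      Fintype.card X * Fintype.card W * (Fintype.card Xh * Fintype.card Xh) +
      Fintype.card Y * Fintype.card W * (Fintype.card Yh * Fintype.card Yh) with hK₀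
  have lA : ∀ (c : ℕ), 0 < c → 0 ≤ log (c : ℝ) := fun c hc =>
    log_nonneg (by exact_mod_cast hc)
  have lX := lA _ (Fintype.card_pos (α := X))
  have lY := lA _ (Fintype.card_pos (α := Y))
  have lZ := lA _ (Fintype.card_pos (α := X × Y))
  have mX := log_nonneg (by linarith : 1 ≤ log (Fintype.card X : ℝ) + 2)
  have mY := log_nonneg (by linarith : 1 ≤ log (Fintype.card Y : ℝ) + 2)
  have mZ := log_nonneg (by linarith : 1 ≤ log (Fintype.card (X × Y) : ℝ) + 2)
  set K : ℝ := K₀ * (β + 1) + Fintype.card (X × Y) + 1 + log (log (Fintype.card X : ℝ) + 2) +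
    log (log (Fintype.card Y : ℝ) + 2) + log (log (Fintype.card (X × Y) : ℝ) + 2) with hK
  have hK₀0 : (0 : ℝ) ≤ K₀ := Nat.cast_nonneg _
  have hZ0 : (0 : ℝ) ≤ Fintype.card (X × Y) := Nat.cast_nonneg _
  refine ⟨K, by positivity, ?_⟩
  intro n G hG typ θ hθ E₀ E₁ E₂ τ₁ τ₂ hE₀ hE₁ hE₂ hz
  have hn : (0 : ℝ) ≤ n := Nat.cast_nonneg n
  have hln : 0 ≤ log ((n : ℝ) + 1) := log_nonneg (by linarith)
  have hov : 0 ≤ K₀ * (β + log (n + 1)) := by positivity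
  set V : (X × Y → Fin (n + 1)) → X × Y → W → ℝ := fun t z w =>
    θ t w.1 * (T w.1).chW z.1 z.2 w.2 with hV
  set q : (X × Y → Fin (n + 1)) → W → ℝ := fun t w => θ t w.1 * (T w.1).pW P w.2 with hq
  have hVmem : ∀ t z, V t z ∈ stdSimplex ℝ W := fun t z =>
    ⟨fun w => mul_nonneg ((hθ t).1 _) (((T _).chW_mem _ _).1 _), by
      simp only [hV]
      rw [Fintype.sum_sigma]
      simp only [← Finset.mul_sum, ((T _).chW_mem _ _).2, mul_one, (hθ t).2]⟩
  have hqmem : ∀ t, q t ∈ stdSimplex ℝ W := fun t =>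
    ⟨fun w => mul_nonneg ((hθ t).1 _) ((T _).pW_nonneg hP.1 _), by
      simp only [hq]
      rw [Fintype.sum_sigma]
      simp only [← Finset.mul_sum, ((T _).pW_mem hP).2, mul_one, (hθ t).2]⟩
  have hVpos : ∀ t z w, 0 < V t z w → 0 < θ t w.1 ∧ 0 < (T w.1).chW z.1 z.2 w.2 := fun t z w h =>
    ⟨((hθ t).1 _).lt_of_ne' (left_ne_zero_of_mul h.ne'),
      (((T _).chW_mem _ _).1 _).lt_of_ne' (right_ne_zero_of_mul h.ne')⟩
  -- The weight θ appears both in the channel and in the reference law and cancels: choosing the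
  -- mixture costs no rate beyond the number of labels.
  have hratio : ∀ t z w, 0 < θ t w.1 →
      V t z w / q t w = (T w.1).chW z.1 z.2 w.2 / (T w.1).pW P w.2 := fun t z w h =>
    mul_div_mul_left _ _ h.ne'
  have e0 : ∀ t z, ∑ w, V t z w * log (V t z w / q t w) = ∑ j, θ t j * (T j).denW P z := by
    intro t z
    rw [Fintype.sum_sigma]
    refine Finset.sum_congr rfl fun j _ => ?_
    rw [TestChannel.denW, Finset.mul_sum]
    refine Finset.sum_congr rfl fun w _ => ?_
    rcases ((hθ t).1 j).eq_or_lt with h | h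
    · simp [hV, ← h]
    · rw [hratio t z ⟨j, w⟩ h]
      simp only [hV]; ring
  have eg : ∀ t z (F : ∀ j, Fin (k j) → ℝ), ∑ w : W, V t z w * F w.1 w.2 =
      ∑ j, θ t j * ∑ w, (T j).chW z.1 z.2 w * F j w := by
    intro t z F
    rw [Fintype.sum_sigma]
    refine Finset.sum_congr rfl fun j _ => ?_
    rw [Finset.mul_sum]
    exact Finset.sum_congr rfl fun w _ => by simp only [hV]; ring
  obtain ⟨M₀, M₁, M₂, c, b0, b1, b2, hc⟩ := exists_code_of_cover (dX := dX) (dY := dY) q hqmem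
    (fun w : W => (T w.1).pXhGivenW P w.2) (fun w b => (T w.1).pXhGivenW_nonneg hP.1 w.2 b)
    (fun w => (T w.1).sum_pXhGivenW_le_one hP.1 w.2)
    (fun w : W => (T w.1).pYhGivenW P w.2) (fun w b => (T w.1).pYhGivenW_nonneg hP.1 w.2 b)
    (fun w => (T w.1).sum_pYhGivenW_le_one hP.1 w.2)
    (E₀ := E₀ + K₀ * (β + log (n + 1))) (E₁ := E₁ + K₀ * (β + log (n + 1)))
    (E₂ := E₂ + K₀ * (β + log (n + 1))) (τ₁ := τ₁ + K₀ * β) (τ₂ := τ₂ + K₀ * β)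
    (by linarith) (by linarith) (by linarith) G (fun z hzG => by
      obtain ⟨a0, a1, a2, a3, a4⟩ := hz z hzG
      refine ⟨typ z, ?_⟩
      refine exists_cover_point hβ0
        (fun x b => (((T (Classical.arbitrary J)).logBound_ge dX dY P).2.2.2.1 x b).trans (hβj _))
        (fun x b => (((T (Classical.arbitrary J)).logBound_ge dX dY P).2.2.2.2 x b).trans (hβj _))
        (V (typ z)) (hVmem _) (q (typ z)) (hqmem _).1
        (fun x w => (T w.1).chX x w.2) (fun x w => (T w.1).chX_mem x w.2) _
        (fun w b => (T w.1).pXhGivenW_nonneg hP.1 w.2 b)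
        (fun x w => (T w.1).chY x w.2) (fun x w => (T w.1).chY_mem x w.2) _
        (fun w b => (T w.1).pYhGivenW_nonneg hP.1 w.2 b) z ?_ ?_ ?_ hK₀ ?_ ?_ ?_ ?_ ?_
      · intro i w hw
        obtain ⟨h1, h2⟩ := hVpos _ _ _ hw
        refine ⟨mul_pos h1 ((mul_pos (hG z hzG i) h2).trans_le ((T _).mul_chW_le_pW hP.1 _ _)), ?_⟩
        rw [hratio _ _ _ h1]
        exact (((T w.1).logBound_ge dX dY P).1 _ _).trans (hβj _)
      · intro i w hw b hb
        obtain ⟨h1, h2⟩ := hVpos _ _ _ hw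
        exact ⟨(T w.1).pXhGivenW_pos hP.1 ((mul_pos (hG z hzG i) h2).trans_le
          ((T _).mul_chW_le_pXW hP.1 _ _ _)) hb,
          (((T w.1).logBound_ge dX dY P).2.1 _ _ _).trans (hβj _)⟩
      · intro i w hw b hb
        obtain ⟨h1, h2⟩ := hVpos _ _ _ hw
        exact ⟨(T w.1).pYhGivenW_pos hP.1 ((mul_pos (hG z hzG i) h2).trans_le
          ((T _).mul_chW_le_pYW hP.1 _ _ _)) hb,
          (((T w.1).logBound_ge dX dY P).2.2.1 _ _ _).trans (hβj _)⟩
      · simp only [e0]; linarith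
      · have := fun i => eg (typ z) (z i) (fun j w => (T j).denX P (z i).1 w)
        simp only [TestChannel.denX] at this
        simp only [this]
        exact add_le_add a1 le_rfl
      · have := fun i => eg (typ z) (z i) (fun j w => (T j).denY P (z i).2 w)
        simp only [TestChannel.denY] at this
        simp only [this]
        exact add_le_add a2 le_rfl
      · have := fun i => eg (typ z) (z i) (fun j w => (T j).avgDX dX (z i).1 w)
        simp only [TestChannel.avgDX] at this
        simp only [this]
        exact add_le_add a3 le_rfl
      · have := fun i => eg (typ z) (z i) (fun j w => (T j).avgDY dY (z i).2 w)
        simp only [TestChannel.avgDY] at this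
        simp only [this]
        exact add_le_add a4 le_rfl)
  -- The labels range over types, so their number contributes only a multiple of log(n+1).
  have hcard : log (Fintype.card (X × Y → Fin (n + 1)) : ℝ) =
      Fintype.card (X × Y) * log ((n : ℝ) + 1) := by
    rw [Fintype.card_fun, Fintype.card_fin]
    push_cast
    rw [log_pow]
  have hsplit : ∀ a : ℝ, 0 ≤ a → log (n * a + 2) ≤ log (n + 1) + log (a + 2) := by
    intro a ha
    rw [← log_mul (by linarith) (by linarith)]
    refine log_le_log (by positivity) ?_
    nlinarith
  have s1 := hsplit _ lX
  have s2 := hsplit _ lY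
  have s3 := hsplit _ lZ
  rw [hcard] at b0
  have hKmul : K * (1 + log (n + 1)) = K₀ * (β + log (n + 1)) + K₀ + K₀ * (β * log (n + 1)) +
    Fintype.card (X × Y) * log (n + 1) + Fintype.card (X × Y) + 1 + log (n + 1) +
    log (log (Fintype.card X : ℝ) + 2) + log (log (Fintype.card Y : ℝ) + 2) +
    log (log (Fintype.card (X × Y) : ℝ) + 2) + (log (log (Fintype.card X : ℝ) + 2) +
    log (log (Fintype.card Y : ℝ) + 2) + log (log (Fintype.card (X × Y) : ℝ) + 2)) * log (n + 1) := by
    rw [hK]; ring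
  have t1 : 0 ≤ K₀ * (β * log ((n : ℝ) + 1)) := by positivity
  have t2 : 0 ≤ (log (log (Fintype.card X : ℝ) + 2) +
    log (log (Fintype.card Y : ℝ) + 2) + log (log (Fintype.card (X × Y) : ℝ) + 2)) *
      log ((n : ℝ) + 1) := by positivity
  have t3 : 0 ≤ Fintype.card (X × Y) * log ((n : ℝ) + 1) := by positivity
  have hKβ : K₀ * β ≤ K := by rw [hK]; linarith
  refine ⟨M₀, M₁, M₂, c, ?_, ?_, ?_, fun z hzG => ?_⟩
  · rw [hKmul]; linarith
  · rw [hKmul]; linarith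
  · rw [hKmul]; linarith
  · obtain ⟨h1, h2⟩ := hc z hzG
    exact ⟨h1.trans (by linarith), h2.trans (by linarith)⟩

end FamilyCode

/-! ### The Gaussian tail function and its inverse. -/

section Gaussian

open MeasureTheory ProbabilityTheory Filter Topology

theorem gaussQ_sub {a b : ℝ} (hab : a ≤ b) :
    gaussQ a - gaussQ b = ∫ x in a..b, gaussianPDFReal 0 1 x := by
  have h1 : Set.Ioi a = Set.Ioc a b ∪ Set.Ioi b := (Set.Ioc_union_Ioi_eq_Ioi hab).symm
  have h2 : Disjoint (Set.Ioc a b) (Set.Ioi b) := Set.Ioc_disjoint_Ioi le_rfl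
  unfold gaussQ
  rw [h1, measureReal_union h2 measurableSet_Ioi, add_sub_cancel_right,
    intervalIntegral.integral_of_le hab, measureReal_def,
    gaussianReal_apply_eq_integral _ one_ne_zero, ENNReal.toReal_ofReal]
  exact integral_nonneg fun x => gaussianPDFReal_nonneg _ _ _

theorem continuous_gaussQ : Continuous gaussQ := by
  have h : gaussQ = fun t => gaussQ 0 - ∫ x in (0 : ℝ)..t, gaussianPDFReal 0 1 x := by
    ext t
    rcases le_total 0 t with ht | ht
    · rw [← gaussQ_sub ht]; ring
    · rw [intervalIntegral.integral_symm, ← gaussQ_sub ht]; ring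
  rw [h]
  exact continuous_const.sub (intervalIntegral.continuous_primitive
    (fun a b => (integrable_gaussianPDFReal 0 1).intervalIntegrable) 0)

theorem strictAnti_gaussQ : StrictAnti gaussQ := by
  intro a b hab
  have h := gaussQ_sub hab.le
  have hpos : 0 < ∫ x in a..b, gaussianPDFReal 0 1 x :=
    intervalIntegral.intervalIntegral_pos_of_pos
      ((integrable_gaussianPDFReal 0 1).intervalIntegrable)
      (fun x => gaussianPDFReal_pos 0 1 x one_ne_zero) hab
  linarith

theorem gaussQ_eq_one_sub_cdf (t : ℝ) : gaussQ t = 1 - cdf (gaussianReal 0 1) t := by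
  rw [cdf_eq_real, gaussQ, ← Set.compl_Iic, probReal_compl_eq_one_sub measurableSet_Iic]

/-- `gaussQInv` is a choice of preimage, so a preimage must exist: continuity and the limits 1 and 0
give one by the intermediate value theorem. -/
theorem gaussQ_gaussQInv {ε : ℝ} (h0 : 0 < ε) (h1 : ε < 1) : gaussQ (gaussQInv ε) = ε := by
  refine Function.invFun_eq ?_
  have hbot : Tendsto gaussQ atBot (𝓝 1) := by
    have := (tendsto_const_nhds (x := (1 : ℝ))).sub (tendsto_cdf_atBot (gaussianReal 0 1))
    rw [sub_zero] at this
    exact this.congr fun t => (gaussQ_eq_one_sub_cdf t).symm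
  have htop : Tendsto gaussQ atTop (𝓝 0) := by
    have := (tendsto_const_nhds (x := (1 : ℝ))).sub (tendsto_cdf_atTop (gaussianReal 0 1))
    rw [sub_self] at this
    exact this.congr fun t => (gaussQ_eq_one_sub_cdf t).symm
  obtain ⟨a, ha⟩ := (hbot.eventually (lt_mem_nhds h1)).exists
  obtain ⟨b, hb⟩ := (htop.eventually (gt_mem_nhds h0)).exists
  exact mem_range_of_exists_le_of_exists_ge continuous_gaussQ ⟨b, hb.le⟩ ⟨a, ha.le⟩

end Gaussian

/-! ### Chebyshev's inequality and the central limit theorem for finite sources. -/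

section Limit

open MeasureTheory ProbabilityTheory Filter Topology

variable {Z : Type*} [Fintype Z]

theorem sum_prod_mul_sum_sq {P : Z → ℝ} (hP : P ∈ stdSimplex ℝ Z) (g : Z → ℝ)
    (h0 : ∑ z, P z * g z = 0) (n : ℕ) :
    ∑ z : Fin n → Z, (∏ i, P (z i)) * (∑ i, g (z i)) ^ 2 = n * ∑ z, P z * g z ^ 2 := by
  induction n with
  | zero => simp
  | succ n ih =>
    rw [sum_cons]
    simp only [Fin.prod_univ_succ, Fin.sum_univ_succ, Fin.cons_zero, Fin.cons_succ]
    have e : ∀ a, ∑ z : Fin n → Z, P a * (∏ i, P (z i)) * (g a + ∑ i, g (z i)) ^ 2 =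
        P a * g a ^ 2 + P a * (n * ∑ z, P z * g z ^ 2) := by
      intro a
      have : ∀ z : Fin n → Z, P a * (∏ i, P (z i)) * (g a + ∑ i, g (z i)) ^ 2 =
          P a * g a ^ 2 * (∏ i, P (z i)) + 2 * P a * g a * ((∏ i, P (z i)) * ∑ i, g (z i)) +
          P a * ((∏ i, P (z i)) * (∑ i, g (z i)) ^ 2) := by intro z; ring
      simp only [this, Finset.sum_add_distrib, ← Finset.mul_sum]
      rw [ih, sum_prod_eq_one hP, sum_prod_mul_sum hP g, h0]
      ring
    simp only [e, Finset.sum_add_distrib]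
    rw [← Finset.sum_mul, hP.2]
    push_cast
    ring

open Classical in
/-- Chebyshev's inequality for block sums. -/
theorem sum_prod_chebyshev {P : Z → ℝ} (hP : P ∈ stdSimplex ℝ Z) (g : Z → ℝ)
    (h0 : ∑ z, P z * g z = 0) (n : ℕ) {a : ℝ} (ha : 0 < a) :
    ∑ z : Fin n → Z, (if a ≤ |∑ i, g (z i)| then ∏ i, P (z i) else 0) ≤
      n * (∑ z, P z * g z ^ 2) / a ^ 2 := by
  rw [le_div_iff₀ (by positivity), ← sum_prod_mul_sum_sq hP g h0, Finset.sum_mul]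
  refine Finset.sum_le_sum fun z _ => ?_
  have hp := prod_nonneg_of_mem hP.1 z
  split_ifs with h
  · refine mul_le_mul_of_nonneg_left ?_ hp
    rw [← sq_abs (∑ i, g (z i))]
    exact pow_le_pow_left₀ ha.le h 2
  · rw [zero_mul]; positivity

open Classical in
/-- The central limit theorem for block sums of a finite source. -/
theorem tendsto_sum_prod_gaussQ {P : Z → ℝ} (hP : P ∈ stdSimplex ℝ Z) (g : Z → ℝ)
    (h0 : ∑ z, P z * g z = 0) {V : ℝ} (hV : ∑ z, P z * g z ^ 2 = V) (hVpos : 0 < V) (t : ℝ) :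
    Tendsto (fun n : ℕ => ∑ z : Fin n → Z,
      if t < (∑ i, g (z i)) / √n then ∏ i, P (z i) else 0) atTop (𝓝 (gaussQ (t / √V))) := by
  let _ : MeasurableSpace Z := ⊤
  have hmeas : ∀ {β : Type} [MeasurableSpace β] (f : Z → β), Measurable f :=
    fun f => measurable_from_top
  set ν : Measure Z := ∑ z, ENNReal.ofReal (P z) • Measure.dirac z with hν
  have hν1 : ∀ z, ν {z} = ENNReal.ofReal (P z) := by
    intro z
    rw [hν, Measure.finsetSum_apply, Finset.sum_eq_single z]
    · simp
    · intro b _ hb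
      simp [Measure.dirac_apply' b (MeasurableSet.of_discrete (s := {z})), hb]
    · simp
  have hprob : IsProbabilityMeasure ν := by
    constructor
    rw [hν, Measure.finsetSum_apply]
    simp only [Measure.smul_apply, measure_univ, smul_eq_mul, mul_one]
    rw [← ENNReal.ofReal_sum_of_nonneg fun z _ => hP.1 z, hP.2, ENNReal.ofReal_one]
  have hint : ∀ f : Z → ℝ, ∫ z, f z ∂ν = ∑ z, P z * f z := by
    intro f
    rw [integral_fintype (Integrable.of_finite)]
    refine Finset.sum_congr rfl fun z _ => ?_
    rw [measureReal_def, hν1, ENNReal.toReal_ofReal (hP.1 z), smul_eq_mul]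
  -- The i.i.d. sequence is realized by the coordinates of an infinite product, so that the limit
  -- theorem applies; f is g scaled to unit variance.
  set μ := Measure.infinitePi (fun _ : ℕ => ν) with hμ
  have hVs : 0 < √V := Real.sqrt_pos.2 hVpos
  set f : Z → ℝ := fun z => g z / √V with hf
  set Xs : ℕ → (ℕ → Z) → ℝ := fun i ω => f (ω i) with hXs
  have hintμ : ∀ h : Z → ℝ, ∫ ω, h (ω 0) ∂μ = ∑ z, P z * h z := by
    intro h
    rw [← hint h, ← (measurePreserving_eval_infinitePi (fun _ : ℕ => ν) 0).map_eq,
      integral_map (measurable_pi_apply 0).aemeasurable (hmeas h).aestronglyMeasurable]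
  have hCLT := tendstoInDistribution_inv_sqrt_mul_sum (P := μ) (X := Xs) (Y := id)
    (P' := gaussianReal 0 1) HasLaw.id (by
      have := hintμ f
      simp only [hf] at this
      change ∫ ω, f (ω 0) ∂μ = 0
      rw [hintμ f]
      simp only [hf, ← mul_div_assoc]
      rw [← Finset.sum_div, h0, zero_div]) (by
      change ∫ ω, (f (ω 0)) ^ 2 ∂μ = 1
      rw [hintμ fun z => f z ^ 2]
      simp only [hf, div_pow, Real.sq_sqrt hVpos.le, ← mul_div_assoc]
      rw [← Finset.sum_div, hV, div_self hVpos.ne']) (by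
      exact iIndepFun_infinitePi (X := fun _ => f) fun _ => hmeas f) (by
      intro i
      refine ⟨((hmeas f).comp (measurable_pi_apply i)).aemeasurable,
        ((hmeas f).comp (measurable_pi_apply 0)).aemeasurable, ?_⟩
      have : ∀ j, μ.map (Xs j) = ν.map f := by
        intro j
        rw [← (measurePreserving_eval_infinitePi (fun _ : ℕ => ν) j).map_eq,
          Measure.map_map (hmeas f) (by fun_prop)]
        rfl
      rw [this, this])
  -- The portmanteau theorem applies because the boundary of the half-line is a single point, null
  -- for the Gaussian.
  have hlim := ProbabilityMeasure.tendsto_measure_of_null_frontier_of_tendsto' hCLT.tendsto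
    (E := Set.Ioi (t / √V)) (by
      rw [frontier_Ioi]
      simp only [ProbabilityMeasure.coe_mk, Measure.map_id]
      have := nullSingletonClass_gaussianReal (μ := 0) (v := 1) one_ne_zero
      exact measure_singleton _)
  simp only [ProbabilityMeasure.coe_mk, Measure.map_id] at hlim
  have hlim2 := (ENNReal.tendsto_toReal (measure_ne_top (gaussianReal 0 1) _)).comp hlim
  refine hlim2.congr fun n => ?_
  have hmX : Measurable fun ω : ℕ → Z => (√n)⁻¹ * ∑ k ∈ Finset.range n, Xs k ω :=
    (Finset.measurable_fun_sum _ fun k _ => (hmeas f).comp (measurable_pi_apply k)).const_mul _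
  rw [Function.comp_apply, Measure.map_apply hmX measurableSet_Ioi]
  -- The event depends on the first n coordinates only; splitting it into cylinders recovers the
  -- finite sum of the statement.
  set cyl : (Fin n → Z) → Set (ℕ → Z) := fun z => {ω | ∀ i : Fin n, ω i = z i} with hcyl
  have hcylμ : ∀ z, μ (cyl z) = ENNReal.ofReal (∏ i, P (z i)) := by
    intro z
    have : cyl z = Set.pi (Finset.range n) (fun i => if h : i < n then {z ⟨i, h⟩} else Set.univ) := by
      ext ω
      simp only [hcyl, Set.mem_ofPred_eq, Set.mem_pi, Finset.coe_range, Set.mem_Iio]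
      constructor
      · intro h i hi
        simpa [hi] using h ⟨i, hi⟩
      · intro h i
        simpa using h i i.2
    rw [this, hμ, Measure.infinitePi_pi _ (fun i _ => MeasurableSet.of_discrete),
      Finset.prod_range, ENNReal.ofReal_prod_of_nonneg fun i _ => hP.1 _]
    refine Finset.prod_congr rfl fun i _ => ?_
    simp [hν1]
  have hcylm : ∀ z, MeasurableSet (cyl z) := by
    intro z
    have : cyl z = ⋂ i : Fin n, (fun ω : ℕ → Z => ω i) ⁻¹' {z i} := by
      ext ω; simp [hcyl]
    rw [this]
    exact MeasurableSet.iInter fun i => (measurable_pi_apply _) MeasurableSet.of_discrete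
  have hpre : (fun ω : ℕ → Z => (√n)⁻¹ * ∑ k ∈ Finset.range n, Xs k ω) ⁻¹' Set.Ioi (t / √V) =
      ⋃ z ∈ Finset.univ.filter (fun z : Fin n → Z => t < (∑ i, g (z i)) / √n), cyl z := by
    have hiff : ∀ z : Fin n → Z, t / √V < (√n)⁻¹ * ∑ i, f (z i) ↔ t < (∑ i, g (z i)) / √n := by
      intro z
      simp only [hf]
      rw [← Finset.sum_div, div_lt_iff₀ hVs]
      have : (√n)⁻¹ * ((∑ i, g (z i)) / √V) * √V = (∑ i, g (z i)) / √n := by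
        rw [mul_assoc, div_mul_cancel₀ _ hVs.ne', inv_mul_eq_div]
      rw [this]
    ext ω
    simp only [Set.mem_preimage, Set.mem_Ioi, Finset.mem_filter, Finset.mem_univ, true_and,
      Set.mem_iUnion, exists_prop, hXs, Finset.sum_range]
    rw [hiff (fun i => ω i)]
    constructor
    · intro h
      exact ⟨fun i => ω i, h, fun i => rfl⟩
    · rintro ⟨z, hz, hω⟩
      have : (fun i : Fin n => ω i) = z := funext hω
      have h2 : ∑ i : Fin n, g (ω i) = ∑ i, g (z i) := by rw [← this]
      rwa [h2]
  rw [hpre, measure_biUnion_finset]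
  · rw [← Finset.sum_filter]
    simp only [hcylμ]
    rw [← ENNReal.ofReal_sum_of_nonneg fun z _ => prod_nonneg_of_mem hP.1 z,
      ENNReal.toReal_ofReal (Finset.sum_nonneg fun z _ => prod_nonneg_of_mem hP.1 z)]
  · intro z _ z' _ hzz'
    refine Set.disjoint_left.2 fun ω h h' => hzz' ?_
    ext i
    rw [← h i, ← h' i]
  · exact fun z _ => hcylm z

end Limit

/-! ### Typical strings, and upper limits in the extended reals. -/

section Typical

open Filter Topology

variable {Z : Type*} [Fintype Z]

open Classical in
/-- Deviation of the number of occurrences of a letter from its mean. -/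
def deviation (P : Z → ℝ) {n : ℕ} (z : Fin n → Z) (a : Z) : ℝ :=
  ∑ i, ((if z i = a then 1 else 0) - P a)

open Classical in
/-- Strings on the support of `P` whose letter counts are within `c` of their means. -/
def typicalSet (P : Z → ℝ) (n : ℕ) (c : ℝ) : Finset (Fin n → Z) :=
  Finset.univ.filter fun z => (∀ i, 0 < P (z i)) ∧ ∀ a, |deviation P z a| ≤ c

theorem mem_typicalSet {P : Z → ℝ} {n : ℕ} {c : ℝ} {z : Fin n → Z} :
    z ∈ typicalSet P n c ↔ (∀ i, 0 < P (z i)) ∧ ∀ a, |deviation P z a| ≤ c := by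
  simp [typicalSet]

theorem sum_sub_eq_sum_deviation (P : Z → ℝ) {n : ℕ} (z : Fin n → Z) (h : Z → ℝ) :
    ∑ i, h (z i) - n * ∑ a, P a * h a = ∑ a, deviation P z a * h a := by
  classical
  simp only [deviation, Finset.sum_mul, sub_mul]
  rw [Finset.sum_comm]
  simp only [Finset.sum_sub_distrib]
  simp

theorem abs_sum_sub_le {P : Z → ℝ} {n : ℕ} {c : ℝ} {z : Fin n → Z} (hz : z ∈ typicalSet P n c)
    (h : Z → ℝ) : |∑ i, h (z i) - n * ∑ a, P a * h a| ≤ c * ∑ a, |h a| := by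
  rw [sum_sub_eq_sum_deviation, Finset.mul_sum]
  refine (Finset.abs_sum_le_sum_abs _ _).trans (Finset.sum_le_sum fun a _ => ?_)
  rw [abs_mul]
  exact mul_le_mul_of_nonneg_right ((mem_typicalSet.1 hz).2 a) (abs_nonneg _)

theorem sum_ite_mem_zero {ι : Type*} [Fintype ι] (G : Finset ι) [∀ z, Decidable (z ∈ G)] (f : ι → ℝ) :
    ∑ z, (if z ∈ G then 0 else f z) = ∑ z, f z - ∑ z ∈ G, f z := by
  have h : ∑ z, (if z ∈ G then f z else 0) = ∑ z ∈ G, f z := by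
    rw [← Finset.sum_filter]
    congr 1
    ext z
    simp
  rw [eq_sub_iff_add_eq, ← h, ← Finset.sum_add_distrib]
  exact Finset.sum_congr rfl fun z _ => by split_ifs <;> simp

/-- Union bound over the letters, with Chebyshev for each count, whose variance per letter is at
most 1. Strings leaving the support have probability zero. -/
theorem one_sub_sum_typicalSet_le {P : Z → ℝ} (hP : P ∈ stdSimplex ℝ Z) (n : ℕ) {c : ℝ}
    (hc : 0 < c) : 1 - ∑ z ∈ typicalSet P n c, ∏ i, P (z i) ≤ Fintype.card Z * (n / c ^ 2) := by
  classical
  have hone : ∀ a, P a ≤ 1 := fun a => hP.2 ▸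
    Finset.single_le_sum (fun a _ => hP.1 a) (Finset.mem_univ a)
  set g : Z → Z → ℝ := fun a z => (if z = a then 1 else 0) - P a with hg
  have hg0 : ∀ a, ∑ z, P z * g a z = 0 := by
    intro a
    simp only [hg, mul_sub, Finset.sum_sub_distrib, ← Finset.sum_mul, hP.2]
    simp
  have hgsq : ∀ a, ∑ z, P z * g a z ^ 2 ≤ 1 := by
    intro a
    refine le_trans (Finset.sum_le_sum fun z _ => ?_) hP.2.le
    refine mul_le_of_le_one_right (hP.1 z) ?_
    have h1 := hP.1 a
    have h2 := hone a
    simp only [hg]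
    split_ifs
    · nlinarith
    · nlinarith
  rw [← sum_prod_eq_one hP n, ← sum_ite_mem_zero]
  calc ∑ z : Fin n → Z, (if z ∈ typicalSet P n c then 0 else ∏ i, P (z i))
      ≤ ∑ z : Fin n → Z, ∑ a, (if c ≤ |∑ i, g a (z i)| then ∏ i, P (z i) else 0) := by
        refine Finset.sum_le_sum fun z _ => ?_
        have hnn : ∀ a, 0 ≤ (if c ≤ |∑ i, g a (z i)| then ∏ i, P (z i) else 0) := by
          intro a
          split_ifs
          · exact prod_nonneg_of_mem hP.1 z
          · exact le_rfl
        split_ifs with hz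
        · exact Finset.sum_nonneg fun a _ => hnn a
        · rw [mem_typicalSet, not_and_or] at hz
          rcases hz with hz | hz
          · push Not at hz
            obtain ⟨i, hi⟩ := hz
            refine (Finset.prod_eq_zero (Finset.mem_univ i) (le_antisymm hi (hP.1 _))).trans_le ?_
            exact Finset.sum_nonneg fun a _ => hnn a
          · push Not at hz
            obtain ⟨a, ha⟩ := hz
            refine le_trans ?_ (Finset.single_le_sum (fun a _ => hnn a) (Finset.mem_univ a))
            rw [if_pos]
            exact ha.le
    _ = ∑ a, ∑ z : Fin n → Z, (if c ≤ |∑ i, g a (z i)| then ∏ i, P (z i) else 0) :=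
        Finset.sum_comm
    _ ≤ ∑ a : Z, (n / c ^ 2 : ℝ) := by
        refine Finset.sum_le_sum fun a _ => ?_
        refine (sum_prod_chebyshev hP (g a) (hg0 a) n hc).trans ?_
        gcongr
        exact mul_le_of_le_one_right (Nat.cast_nonneg n) (hgsq a)
    _ = _ := by simp

theorem limsup_coe_le_of_eventually {u : ℕ → ℝ} {a : ℝ}
    (h : ∀ b, a < b → ∀ᶠ n in atTop, u n ≤ b) : limsup (fun n => (u n : EReal)) atTop ≤ a := by
  refine le_of_forall_gt_imp_ge_of_dense fun b hb => ?_
  obtain ⟨r, hr1, hr2⟩ := EReal.lt_iff_exists_real_btwn.1 hb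
  refine le_trans (limsup_le_of_le (by isBoundedDefault) ?_) hr2.le
  filter_upwards [h r (EReal.coe_lt_coe_iff.1 hr1)] with n hn
  exact EReal.coe_le_coe_iff.2 hn

theorem limsup_coe_le_of_tendsto {u v : ℕ → ℝ} {a : ℝ} (h : ∀ᶠ n in atTop, u n ≤ v n)
    (hv : Tendsto v atTop (𝓝 a)) : limsup (fun n => (u n : EReal)) atTop ≤ a := by
  refine limsup_coe_le_of_eventually fun b hb => ?_
  filter_upwards [h, hv.eventually (gt_mem_nhds hb)] with n h1 h2
  exact h1.trans h2.le

theorem eventually_le_of_limsup_coe_le {u : ℕ → ℝ} {a b : ℝ}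
    (h : limsup (fun n => (u n : EReal)) atTop ≤ a) (hb : a < b) : ∀ᶠ n in atTop, u n ≤ b := by
  have := eventually_lt_of_limsup_lt (h.trans_lt (EReal.coe_lt_coe_iff.2 hb))
  filter_upwards [this] with n hn
  exact (EReal.coe_lt_coe_iff.1 hn).le

theorem tendsto_log_div_sqrt (K : ℝ) :
    Tendsto (fun n : ℕ => K * (1 + log ((n : ℝ) + 1)) / √n) atTop (𝓝 0) := by
  have h1 : Tendsto (fun n : ℕ => log (n : ℝ) / √n) atTop (𝓝 0) := by
    have := (isLittleO_log_rpow_atTop (one_half_pos (α := ℝ))).tendsto_div_nhds_zero.comp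
      (tendsto_natCast_atTop_atTop (R := ℝ))
    refine this.congr fun n => ?_
    rw [Function.comp_apply, sqrt_eq_rpow]
  have h2 : Tendsto (fun n : ℕ => (1 + log 2) / √(n : ℝ)) atTop (𝓝 0) :=
    tendsto_const_nhds.div_atTop (tendsto_sqrt_atTop.comp tendsto_natCast_atTop_atTop)
  have h3 : Tendsto (fun n : ℕ => (1 + log ((n : ℝ) + 1)) / √n) atTop (𝓝 0) := by
    refine squeeze_zero' (.of_forall fun n => ?_) ?_ (by simpa using h2.add h1)
    · have := log_nonneg (by linarith [Nat.cast_nonneg (α := ℝ) n] : (1 : ℝ) ≤ n + 1)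
      positivity
    · filter_upwards [eventually_ge_atTop 1] with n hn
      have hn' : (1 : ℝ) ≤ n := by exact_mod_cast hn
      rw [← add_div]
      refine (div_le_div_iff_of_pos_right (sqrt_pos.2 (by linarith))).2 ?_
      rw [add_assoc, ← log_mul two_ne_zero (by linarith)]
      gcongr
      linarith
  have := h3.const_mul K
  rw [mul_zero] at this
  exact this.congr fun n => (mul_div_assoc _ _ _).symm

end Typical

/-! ### Achievability of every test channel. -/

section FirstOrderDirect

open Filter Topology

variable {X Y Xh Yh : Type*} [Fintype X] [Fintype Y] [Fintype Xh] [Fintype Yh]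

theorem sum_single_le {Z : Type*} [Fintype Z] {f : Z → ℝ} (hf : ∀ z, 0 ≤ f z) (z : Z) :
    f z ≤ ∑ z, f z := Finset.single_le_sum (fun z _ => hf z) (Finset.mem_univ z)

/-- Outside G the distortion is bounded crudely by the sum of all its values, which is harmless once
G has probability tending to 1. -/
theorem sum_prod_mul_avgDist_le {A B Z : Type*} [Fintype A] [Fintype B] [Fintype Z] {P : Z → ℝ}
    (hP : P ∈ stdSimplex ℝ Z) {d : A → B → ℝ} (hd : ∀ a b, 0 ≤ d a b) {n : ℕ} (hn : 0 < n)
    (p : Z → A) (b : (Fin n → Z) → Fin n → B) (G : Finset (Fin n → Z)) {τ : ℝ} (hτ : 0 ≤ τ)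
    (hG : ∀ z ∈ G, ∑ i, d (p (z i)) (b z i) ≤ τ) :
    ∑ z : Fin n → Z, (∏ i, P (z i)) * avgDist d (fun i => p (z i)) (b z) ≤
      τ / n + (∑ a, ∑ b, d a b) * (1 - ∑ z ∈ G, ∏ i, P (z i)) := by
  classical
  have hn' : (0 : ℝ) < n := by exact_mod_cast hn
  have hmax : ∀ a b', d a b' ≤ ∑ a, ∑ b, d a b := fun a b' =>
    (sum_single_le (fun b => hd a b) b').trans
      (sum_single_le (f := fun a => ∑ b, d a b) (fun a => Finset.sum_nonneg fun b _ => hd a b) a)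
  have hpt : ∀ z : Fin n → Z, (∏ i, P (z i)) * avgDist d (fun i => p (z i)) (b z) ≤
      (∏ i, P (z i)) * (τ / n) + (∑ a, ∑ b, d a b) * (if z ∈ G then 0 else ∏ i, P (z i)) := by
    intro z
    have hp := prod_nonneg_of_mem hP.1 z
    split_ifs with hz
    · rw [mul_zero, add_zero]
      exact mul_le_mul_of_nonneg_left ((div_le_div_iff_of_pos_right hn').2 (hG z hz)) hp
    · have : avgDist d (fun i => p (z i)) (b z) ≤ ∑ a, ∑ b, d a b := by
        unfold avgDist
        rw [div_le_iff₀ hn']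
        refine (Finset.sum_le_sum fun i _ => hmax _ _).trans_eq ?_
        simp [mul_comm]
      have h1 := mul_le_mul_of_nonneg_left this hp
      have h2 : 0 ≤ (∏ i, P (z i)) * (τ / n) := by positivity
      linarith
  refine (Finset.sum_le_sum fun z _ => hpt z).trans_eq ?_
  rw [Finset.sum_add_distrib, ← Finset.sum_mul, sum_prod_eq_one hP, one_mul, ← Finset.mul_sum,
    sum_ite_mem_zero, sum_prod_eq_one hP]

/-- Every test channel is achievable. -/
theorem TestChannel.achievable {k : ℕ} (T : TestChannel X Y Xh Yh (Fin k)) {dX : X → Xh → ℝ}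
    {dY : Y → Yh → ℝ} (hdX : ∀ x xh, 0 ≤ dX x xh) (hdY : ∀ y yh, 0 ≤ dY y yh)
    {P : X × Y → ℝ} (hP : P ∈ stdSimplex ℝ (X × Y)) [Nonempty Xh] [Nonempty Yh] {D₁ D₂ R₀ R₁ R₂ : ℝ}
    (h0 : T.commonInfo P ≤ R₀) (h1 : T.infoX P ≤ R₁) (h2 : T.infoY P ≤ R₂)
    (h3 : T.distX dX P ≤ D₁) (h4 : T.distY dY P ≤ D₂) :
    Achievable dX dY D₁ D₂ P (R₀, R₁, R₂) := by
  classical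
  have hlog2 := log_pos one_lt_two
  -- A single channel needs no mixing: weight 1 and a constant label.
  obtain ⟨K, hK, hcode⟩ := exists_code_of_family (J := Unit) (fun _ => T) dX dY hP
  set B := ∑ z, |T.denW P z| + ∑ z, |T.rateX P z| + ∑ z, |T.rateY P z| + ∑ z, |T.lossX dX z| +
    ∑ z, |T.lossY dY z| with hB
  have hB' : 0 ≤ ∑ z, |T.denW P z| ∧ 0 ≤ ∑ z, |T.rateX P z| ∧ 0 ≤ ∑ z, |T.rateY P z| ∧
      0 ≤ ∑ z, |T.lossX dX z| ∧ 0 ≤ ∑ z, |T.lossY dY z| := by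
    refine ⟨?_, ?_, ?_, ?_, ?_⟩ <;> positivity
  have hB0 : 0 ≤ B := by linarith [hB'.1, hB'.2.1, hB'.2.2.1, hB'.2.2.2.1, hB'.2.2.2.2]
  -- The exponent lies strictly between 1/2 and 1: atypical strings become negligible while the
  -- deviations of block sums stay o(n).
  set c : ℕ → ℝ := fun n => (n : ℝ) ^ (3 / 4 : ℝ) with hc
  have hc0 : ∀ n, 0 ≤ c n := fun n => rpow_nonneg (Nat.cast_nonneg n) _
  have i0 := T.commonInfo_nonneg hP
  have i1 := T.infoX_nonneg hP.1
  have i2 := T.infoY_nonneg hP.1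
  have i3 := T.distX_nonneg hP.1 hdX
  have i4 := T.distY_nonneg hP.1 hdY
  have hcn : ∀ n : ℕ, ∃ (M₀ M₁ M₂ : ℕ) (C : Code X Y Xh Yh n M₀ M₁ M₂),
      log M₀ ≤ (n * (log 2 * T.commonInfo P) + c n * B) + K * (1 + log (n + 1)) ∧
      log M₁ ≤ (n * (log 2 * T.infoX P) + c n * B) + K * (1 + log (n + 1)) ∧
      log M₂ ≤ (n * (log 2 * T.infoY P) + c n * B) + K * (1 + log (n + 1)) ∧
      ∀ z ∈ typicalSet P n (c n),
        ∑ i, dX (z i).1 (C.outX (fun i => (z i).1) (fun i => (z i).2) i) ≤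
          (n * T.distX dX P + c n * B) + K ∧
        ∑ i, dY (z i).2 (C.outY (fun i => (z i).1) (fun i => (z i).2) i) ≤
          (n * T.distY dY P + c n * B) + K := by
    intro n
    have hn0 : (0 : ℝ) ≤ n := Nat.cast_nonneg n
    have hcB := mul_nonneg (hc0 n) hB0
    refine hcode n (typicalSet P n (c n)) (fun z hz => (mem_typicalSet.1 hz).1) (fun _ _ => 0)
      (fun _ _ => 1) (fun t => ⟨fun _ => zero_le_one, by simp⟩) _ _ _ _ _ (by positivity)
      (by positivity) (by positivity) fun z hz => ?_
    have key : ∀ (h : X × Y → ℝ) (m : ℝ), ∑ z, P z * h z = m → ∑ z, |h z| ≤ B →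
        ∑ i, ∑ _j : Unit, 1 * h (z i) ≤ n * m + c n * B := by
      intro h m hm hb
      have h5 := (le_abs_self _).trans (abs_sum_sub_le hz h)
      have h6 := mul_le_mul_of_nonneg_left hb (hc0 n)
      rw [hm] at h5
      simp only [one_mul, Finset.univ_unique, Finset.sum_const, Finset.card_singleton, one_smul]
      linarith
    refine ⟨key _ _ (T.log_two_mul_commonInfo P).symm (by linarith),
      key _ _ (T.log_two_mul_infoX' P).symm (by linarith),
      key _ _ (T.log_two_mul_infoY' P).symm (by linarith),
      key _ _ (T.distX_eq dX P).symm (by linarith), key _ _ (T.distY_eq dY P).symm (by linarith)⟩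
  choose M₀ M₁ M₂ C g0 g1 g2 g3 using hcn
  have hnn : Tendsto (fun n : ℕ => (n : ℝ)) atTop atTop := tendsto_natCast_atTop_atTop
  have hcn0 : Tendsto (fun n : ℕ => c n / n) atTop (𝓝 0) := by
    have := (tendsto_rpow_neg_atTop (by norm_num : (0 : ℝ) < 1 / 4)).comp hnn
    refine this.congr' ?_
    filter_upwards [eventually_gt_atTop 0] with n hn
    have hn' : (0 : ℝ) < n := by exact_mod_cast hn
    rw [Function.comp_apply, hc, eq_div_iff hn'.ne']
    nth_rw 2 [← rpow_one (n : ℝ)]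
    rw [← rpow_add hn']
    norm_num
  have hcn1 : Tendsto (fun n : ℕ => (n : ℝ) / c n ^ 2) atTop (𝓝 0) := by
    have := (tendsto_rpow_neg_atTop (by norm_num : (0 : ℝ) < 1 / 2)).comp hnn
    refine this.congr' ?_
    filter_upwards [eventually_gt_atTop 0] with n hn
    have hn' : (0 : ℝ) < n := by exact_mod_cast hn
    have : c n ≠ 0 := (rpow_pos_of_pos hn' _).ne'
    rw [Function.comp_apply, eq_div_iff (by positivity), hc, ← rpow_natCast, ← rpow_mul hn'.le,
      ← rpow_add hn']
    norm_num
  have hlg : Tendsto (fun n : ℕ => K * (1 + log ((n : ℝ) + 1)) / n) atTop (𝓝 0) := by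
    have h5 := (tendsto_log_div_sqrt K).mul
      ((tendsto_inv_atTop_zero.comp tendsto_sqrt_atTop).comp hnn)
    rw [mul_zero] at h5
    refine h5.congr fun n => ?_
    rw [Function.comp_apply, Function.comp_apply, div_mul_eq_mul_div, ← div_eq_mul_inv, div_div,
      mul_self_sqrt (Nat.cast_nonneg n)]
  have hrate : ∀ (I R : ℝ) (M : ℕ → ℕ), I ≤ R →
      (∀ n : ℕ, log (M n) ≤ (n * (log 2 * I) + c n * B) + K * (1 + log (n + 1))) →
      limsup (fun n : ℕ => ((Real.logb 2 (M n) / n : ℝ) : EReal)) atTop ≤ (R : EReal) := by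
    intro I R M hIR hM
    have hl : Tendsto (fun n : ℕ => I + ((c n / n) * B + K * (1 + log ((n : ℝ) + 1)) / n) / log 2)
        atTop (𝓝 I) := by
      have := (((hcn0.mul_const B).add hlg).div_const (log 2)).const_add I
      simpa using this
    refine (limsup_coe_le_of_tendsto ?_ hl).trans (EReal.coe_le_coe_iff.2 hIR)
    filter_upwards [eventually_gt_atTop 0] with n hn
    have hn' : (0 : ℝ) < n := by exact_mod_cast hn
    rw [logb, div_div, div_le_iff₀ (by positivity)]
    refine (hM n).trans_eq ?_
    field_simp
    ring
  have hdist : ∀ (δ D Δ : ℝ) (e : ℕ → ℝ), δ ≤ D → (∀ n : ℕ, 0 < n → e n ≤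
      ((n * δ + c n * B) + K) / n + Δ *
        (1 - ∑ z ∈ typicalSet P n (c n), ∏ i, P (z i))) → 0 ≤ Δ →
      limsup (fun n : ℕ => ((e n : ℝ) : EReal)) atTop ≤ (D : EReal) := by
    intro δ D Δ e hδ he hΔ
    have hl : Tendsto (fun n : ℕ => δ + (c n / n) * B + K / n +
        Δ * (Fintype.card (X × Y) * ((n : ℝ) / c n ^ 2))) atTop (𝓝 δ) := by
      have := (((hcn0.mul_const B).const_add δ).add (tendsto_const_nhds (x := K).div_atTop hnn)).add
        ((hcn1.const_mul (Fintype.card (X × Y) : ℝ)).const_mul Δ)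
      simpa using this
    refine (limsup_coe_le_of_tendsto ?_ hl).trans (EReal.coe_le_coe_iff.2 hδ)
    filter_upwards [eventually_gt_atTop 0] with n hn
    have hn' : (0 : ℝ) < n := by exact_mod_cast hn
    refine (he n hn).trans ?_
    have h5 := mul_le_mul_of_nonneg_left (one_sub_sum_typicalSet_le hP n
      (c := c n) (rpow_pos_of_pos hn' _)) hΔ
    have h6 : ((n * δ + c n * B) + K) / n = δ + (c n / n) * B + K / n := by field_simp
    rw [h6]
    linarith
  refine ⟨M₀, M₁, M₂, C, hrate _ _ _ h0 g0, hrate _ _ _ h1 g1, hrate _ _ _ h2 g2,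
    hdist _ _ (∑ a, ∑ b, dX a b) _ h3 (fun n hn => ?_)
      (Finset.sum_nonneg fun a _ => Finset.sum_nonneg fun b _ => hdX a b),
    hdist _ _ (∑ a, ∑ b, dY a b) _ h4 (fun n hn => ?_)
      (Finset.sum_nonneg fun a _ => Finset.sum_nonneg fun b _ => hdY a b)⟩
  · unfold Code.expDistX
    rw [sum_fun_prod]
    have hcB := mul_nonneg (hc0 n) hB0
    exact sum_prod_mul_avgDist_le hP hdX hn Prod.fst
      (fun z => (C n).outX (fun i => (z i).1) (fun i => (z i).2)) (typicalSet P n (c n))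
      (by positivity) fun z hz => (g3 n z hz).1
  · unfold Code.expDistY
    rw [sum_fun_prod]
    have hcB := mul_nonneg (hc0 n) hB0
    exact sum_prod_mul_avgDist_le hP hdY hn Prod.snd
      (fun z => (C n).outY (fun i => (z i).1) (fun i => (z i).2)) (typicalSet P n (c n))
      (by positivity) fun z hz => (g3 n z hz).2

end FirstOrderDirect

/-! ### Derivatives of the minimum common rate as a supporting hyperplane. -/

section Hyperplane

open Filter Topology

/-- A convex set whose constrained minimum has one-sided perturbations with slopes `-m` lies above
the hyperplane with normal `(1, m)`. -/
theorem le_lagrangian_of_perturbation {S : Set (Fin 5 → ℝ)} (hS : Convex ℝ S) {R₀ : ℝ}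
    {c m : Fin 4 → ℝ} (hmin : ∀ v ∈ S, (∀ a, v a.succ ≤ c a) → R₀ ≤ v 0)
    (hpert : ∀ κ > 0, ∃ δ > 0, ∀ a, ∀ σ : ℝ, |σ| = 1 → ∃ u ∈ S,
      u 0 ≤ R₀ - σ * m a * δ + κ * δ ∧ ∀ b, u b.succ ≤ c b + if b = a then σ * δ else 0)
    {v : Fin 5 → ℝ} (hv : v ∈ S) :
    R₀ + ∑ a, m a * c a ≤ v 0 + ∑ a, m a * v a.succ := by
  by_contra hcon
  push Not at hcon
  set N := ∑ a, |v (Fin.succ a) - c a| with hN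
  have hN0 : 0 ≤ N := Finset.sum_nonneg fun a _ => abs_nonneg _
  set gap := R₀ + ∑ a, m a * c a - (v 0 + ∑ a, m a * v a.succ) with hgap
  have hgap0 : 0 < gap := by linarith
  obtain ⟨δ, hδ, hu⟩ := hpert (gap / (2 * (1 + N))) (by positivity)
  -- Each perturbation is directed against the deviation of v: where v exceeds the constraint, a
  -- point with a stricter constraint is mixed in, elsewhere one with a relaxed constraint.
  set σ : Fin 4 → ℝ := fun a => if 0 < v a.succ - c a then -1 else 1 with hσ
  have hσ1 : ∀ a, |σ a| = 1 := by
    intro a; simp only [hσ]; split_ifs <;> simp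
  have hσ2 : ∀ a, σ a * |v a.succ - c a| = -(v a.succ - c a) := by
    intro a; simp only [hσ]; split_ifs with h
    · rw [abs_of_pos h]; ring
    · rw [abs_of_nonpos (not_lt.1 h)]; ring
  choose u huS hu0 hub using fun a => hu a (σ a) (hσ1 a)
  -- Normalizes the weights 1 on v and |v - c|/δ on the perturbed points; the resulting convex
  -- combination satisfies all constraints, so its first coordinate is at least R₀. The tolerance
  -- gap/(2(1+N)) is too small to compensate the assumed gap.
  set s := 1 / (1 + N / δ) with hs
  have hs0 : 0 < s := by positivity
  have hs1 : s * (1 + N / δ) = 1 := by rw [hs]; field_simp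
  have hw : s • v + ∑ a, (s * (|v a.succ - c a| / δ)) • u a ∈ S := by
    have := hS.sum_mem (t := Finset.univ) (w := fun o : Option (Fin 4) => o.elim s
      fun a => s * (|v a.succ - c a| / δ)) (z := fun o => o.elim v u) (by
        rintro (_ | a) _
        · exact hs0.le
        · simp only [Option.elim]; positivity) (by
        rw [Fintype.sum_option]
        simp only [Option.elim]
        rw [← Finset.mul_sum, ← Finset.sum_div, ← hN]
        linarith) (by
        rintro (_ | a) _
        · exact hv
        · exact huS a)
    rwa [Fintype.sum_option] at this
  have hsum : s + ∑ a, s * (|v (Fin.succ a) - c a| / δ) = 1 := by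
    rw [← Finset.mul_sum, ← Finset.sum_div, ← hN]; linarith
  have hcoef : ∀ a, 0 ≤ s * (|v (Fin.succ a) - c a| / δ) := fun a => by positivity
  have key := hmin _ hw (fun b => by
    simp only [Pi.add_apply, Pi.smul_apply, Finset.sum_apply, smul_eq_mul]
    calc s * v b.succ + ∑ a, s * (|v a.succ - c a| / δ) * u a b.succ
        ≤ s * v b.succ + ∑ a, s * (|v a.succ - c a| / δ) *
          (c b + if b = a then σ a * δ else 0) := by
          gcongr with a
          exact hub a b
      _ = s * v b.succ + (∑ a, s * (|v (Fin.succ a) - c a| / δ)) * c b +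
          s * (|v b.succ - c b| / δ) * (σ b * δ) := by
          simp only [mul_add, Finset.sum_add_distrib, Finset.sum_mul, mul_ite, mul_zero,
            Finset.sum_ite_eq, Finset.mem_univ, if_true]
          ring
      _ = s * v b.succ + (1 - s) * c b + s * (σ b * |v b.succ - c b|) := by
          rw [← hsum]; field_simp; ring
      _ = c b := by rw [hσ2]; ring)
  simp only [Pi.add_apply, Pi.smul_apply, Finset.sum_apply, smul_eq_mul] at key
  have h2 : ∑ a, s * (|v a.succ - c a| / δ) * u a 0 ≤ ∑ a, s * (|v a.succ - c a| / δ) *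
      (R₀ - σ a * m a * δ + gap / (2 * (1 + N)) * δ) :=
    Finset.sum_le_sum fun a _ => mul_le_mul_of_nonneg_left (hu0 a) (hcoef a)
  have h3 : ∑ a, s * (|v a.succ - c a| / δ) *
      (R₀ - σ a * m a * δ + gap / (2 * (1 + N)) * δ) =
      (1 - s) * R₀ + s * ∑ a, m a * (v (Fin.succ a) - c a) + s * (gap / (2 * (1 + N)) * N) := by
    have h4 : ∀ a, s * (|v (Fin.succ a) - c a| / δ) *
        (R₀ - σ a * m a * δ + gap / (2 * (1 + N)) * δ) =
        s * (|v (Fin.succ a) - c a| / δ) * R₀ + s * (m a * (v (Fin.succ a) - c a)) +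
        s * (gap / (2 * (1 + N))) * |v (Fin.succ a) - c a| := by
      intro a
      have := hσ2 a
      have e : v (Fin.succ a) - c a = -(σ a * |v (Fin.succ a) - c a|) := by linarith
      have e2 : s * (m a * (v (Fin.succ a) - c a)) =
        s * (m a * -(σ a * |v (Fin.succ a) - c a|)) := by rw [← e]
      rw [e2]
      field_simp
      ring
    simp only [h4, Finset.sum_add_distrib, ← Finset.sum_mul, ← Finset.mul_sum, ← Finset.sum_div]
    rw [← hN]
    have : s * (N / δ) = 1 - s := by linarith
    rw [this]
    ring
  have h5 : ∑ a, m a * (v (Fin.succ a) - c a) = ∑ a, m a * v a.succ - ∑ a, m a * c a := by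
    rw [← Finset.sum_sub_distrib]
    exact Finset.sum_congr rfl fun a _ => by ring
  have h6 : gap / (2 * (1 + N)) * N < gap := by
    rw [div_mul_eq_mul_div, div_lt_iff₀ (by positivity)]
    nlinarith
  rw [h3, h5] at h2
  have h7 : 0 ≤ s * (-gap + gap / (2 * (1 + N)) * N) := by
    have : s * (-gap + gap / (2 * (1 + N)) * N) = s * v 0 + ((1 - s) * R₀ +
      s * (∑ a, m a * v (Fin.succ a) - ∑ a, m a * c a) + s * (gap / (2 * (1 + N)) * N)) - R₀ := by
      rw [hgap]; ring
    linarith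
  have h8 : s * (-gap + gap / (2 * (1 + N)) * N) < 0 :=
    mul_neg_of_pos_of_neg hs0 (by linarith)
  linarith

/-- The derivative gives the first-order bound. Positivity is carried along because a positive
infimum certifies that the set of common rates is nonempty. -/
theorem eventually_perturbation {f : ℝ → ℝ} {m c κ : ℝ} (hf : HasDerivAt f (-m) c)
    (hpos : 0 < f c) (hκ : 0 < κ) : ∀ᶠ δ in 𝓝[>] (0 : ℝ), ∀ σ : ℝ, |σ| = 1 →
      0 < f (c + σ * δ) ∧ f (c + σ * δ) ≤ f c - σ * m * δ + κ * δ := by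
  have h1 : ∀ᶠ x in 𝓝 c, 0 < f x := hf.continuousAt.eventually (lt_mem_nhds hpos)
  have h2 := (hasDerivAt_iff_isLittleO.1 hf).def hκ
  have h3 : ∀ σ : ℝ, ∀ᶠ δ in 𝓝[>] (0 : ℝ),
      0 < f (c + σ * δ) ∧ ‖f (c + σ * δ) - f c - (c + σ * δ - c) • (-m)‖ ≤ κ * ‖c + σ * δ - c‖ := by
    intro σ
    have : Tendsto (fun δ : ℝ => c + σ * δ) (𝓝[>] 0) (𝓝 c) := by
      have h : Tendsto (fun δ : ℝ => c + σ * δ) (𝓝 0) (𝓝 (c + σ * 0)) :=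
        (Continuous.tendsto (by fun_prop) _)
      rw [mul_zero, add_zero] at h
      exact h.mono_left nhdsWithin_le_nhds
    exact this.eventually (h1.and h2)
  filter_upwards [h3 1, h3 (-1), self_mem_nhdsWithin] with δ hp hm hδ σ hσ
  have hδ' : 0 < δ := hδ
  have : σ = 1 ∨ σ = -1 := by
    rcases abs_choice σ with h | h <;> rw [h] at hσ
    · exact Or.inl hσ
    · right; linarith
  rcases this with rfl | rfl
  · refine ⟨hp.1, ?_⟩
    have h := (le_abs_self _).trans hp.2
    simp only [add_sub_cancel_left, one_mul, smul_eq_mul, norm_eq_abs, abs_of_pos hδ'] at h ⊢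
    linarith
  · refine ⟨hm.1, ?_⟩
    have h := (le_abs_self _).trans hm.2
    simp only [add_sub_cancel_left, neg_mul, one_mul, smul_eq_mul, norm_eq_abs, abs_neg,
      abs_of_pos hδ'] at h ⊢
    linarith

variable {X Y Xh Yh : Type*} [Fintype X] [Fintype Y] [Fintype Xh] [Fintype Yh]

/-- The minimum common rate as a function of the vector of constraints. -/
def minRateAt (dX : X → Xh → ℝ) (dY : Y → Yh → ℝ) (P : X × Y → ℝ) (c : Fin 4 → ℝ) : ℝ :=
  minCommonRate dX dY (c 0) (c 1) (c 2) (c 3) P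

/-- Achievability puts the first coordinate of v into the set of common rates, and the first-order
converse bounds that set below by 0, which `csInf_le` requires. -/
theorem minRateAt_le {dX : X → Xh → ℝ} {dY : Y → Yh → ℝ} (hdX : ∀ x xh, 0 ≤ dX x xh)
    (hdY : ∀ y yh, 0 ≤ dY y yh) {P : X × Y → ℝ} (hP : P ∈ stdSimplex ℝ (X × Y)) [Nonempty Xh]
    [Nonempty Yh] {c : Fin 4 → ℝ} {v : Fin 5 → ℝ} (hv : v ∈ valueSet dX dY P)
    (hc : ∀ a, v (Fin.succ a) ≤ c a) : minRateAt dX dY P c ≤ v 0 := by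
  refine csInf_le ⟨0, fun r hr => ?_⟩ ?_
  · obtain ⟨w, hw, hle⟩ := exists_valueSet_le_of_mem_rateRegion hdX hdY hP hr
    exact (valueSet_nonneg hP hdX hdY hw 0).trans (hle 0)
  · obtain ⟨k, T, rfl⟩ := hv
    exact subset_closure (T.achievable hdX hdY hP le_rfl (hc 0) (hc 1) (hc 2) (hc 3))

theorem exists_valueSet_le_of_minRateAt {dX : X → Xh → ℝ} {dY : Y → Yh → ℝ}
    (hdX : ∀ x xh, 0 ≤ dX x xh) (hdY : ∀ y yh, 0 ≤ dY y yh) {P : X × Y → ℝ}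
    (hP : P ∈ stdSimplex ℝ (X × Y)) [Nonempty Xh] [Nonempty Yh] {c : Fin 4 → ℝ}
    (hpos : 0 < minRateAt dX dY P c) {e : ℝ} (he : 0 < e) :
    ∃ v ∈ valueSet dX dY P, v 0 ≤ minRateAt dX dY P c + e ∧ ∀ a, v (Fin.succ a) ≤ c a := by
  -- An empty set would have infimum 0 by convention, contradicting positivity.
  have hne : {r : ℝ | (r, c 0, c 1) ∈ rateRegion dX dY (c 2) (c 3) P}.Nonempty := by
    by_contra h
    rw [Set.not_nonempty_iff_eq_empty] at h
    unfold minRateAt minCommonRate at hpos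
    rw [h, Real.sInf_empty] at hpos
    exact lt_irrefl _ hpos
  obtain ⟨r, hr, hlt⟩ := exists_lt_of_csInf_lt hne
    (show sInf _ < minRateAt dX dY P c + e from lt_add_of_pos_right _ he)
  obtain ⟨v, hv, hle⟩ := exists_valueSet_le_of_mem_rateRegion hdX hdY hP hr
  refine ⟨v, hv, (hle 0).trans hlt.le, fun a => ?_⟩
  have := hle a.succ
  fin_cases a <;> simpa using this

/-- One δ serves all four constraints and both signs, since there are finitely many eventual
conditions. Half of the tolerance κδ covers the derivative error and half the passage from the
infimum to an actual value vector. -/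
theorem exists_perturbation {dX : X → Xh → ℝ} {dY : Y → Yh → ℝ} (hdX : ∀ x xh, 0 ≤ dX x xh)
    (hdY : ∀ y yh, 0 ≤ dY y yh) {P : X × Y → ℝ} (hP : P ∈ stdSimplex ℝ (X × Y)) [Nonempty Xh]
    [Nonempty Yh] {c m : Fin 4 → ℝ} (hpos : 0 < minRateAt dX dY P c)
    (hder : ∀ a, HasDerivAt (fun t => minRateAt dX dY P (Function.update c a t)) (-m a) (c a))
    {κ : ℝ} (hκ : 0 < κ) : ∃ δ > 0, ∀ a, ∀ σ : ℝ, |σ| = 1 → ∃ u ∈ valueSet dX dY P,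
      u 0 ≤ minRateAt dX dY P c - σ * m a * δ + κ * δ ∧
        ∀ b, u (Fin.succ b) ≤ c b + if b = a then σ * δ else 0 := by
  have h := (eventually_all.2 fun a => eventually_perturbation (hder a)
    (by simpa using hpos) (half_pos hκ)).and self_mem_nhdsWithin
  obtain ⟨δ, h1, hδ⟩ := h.exists
  have hδ' : 0 < δ := hδ
  refine ⟨δ, hδ', fun a σ hσ => ?_⟩
  obtain ⟨h2, h3⟩ := h1 a σ hσ
  obtain ⟨u, hu, hu0, hub⟩ := exists_valueSet_le_of_minRateAt hdX hdY hP h2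
    (mul_pos (half_pos hκ) hδ')
  refine ⟨u, hu, ?_, fun b => ?_⟩
  · rw [Function.update_eq_self] at h3
    linarith
  · refine (hub b).trans_eq ?_
    by_cases hb : b = a
    · subst hb; simp
    · simp [hb]

end Hyperplane

/-! ### The tilted information density as a log-optimal feature mixture. -/

section Tilt

variable {X Y Xh Yh W : Type*} [Fintype X] [Fintype Y] [Fintype Xh] [Fintype Yh] [Fintype W]

theorem sum_mul_two_rpow_eq {A B : Type*} [Fintype B] (d : A → B → ℝ) {u : B → ℝ} (s D : ℝ) (a : A) :
    ∑ b, u b * (2 : ℝ) ^ (s * (D - d a b)) = 2 ^ (s * D) * expAvg d (s * log 2) u a := by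
  rw [expAvg, Finset.mul_sum]
  refine Finset.sum_congr rfl fun b _ => ?_
  rw [mul_left_comm, rpow_def_of_pos two_pos, rpow_def_of_pos two_pos, ← exp_add]
  congr 2
  ring

theorem two_rpow_mul_sub {R lam s D E : ℝ} (hE : 0 < E) :
    (2 : ℝ) ^ (lam * (R - logb 2 (1 / (2 ^ (s * D) * E)))) =
      2 ^ (lam * R + lam * s * D) * E ^ lam := by
  have h : logb 2 (1 / (2 ^ (s * D) * E)) = -(s * D) - logb 2 E := by
    rw [one_div, logb_inv, logb_mul (by positivity) hE.ne', logb_rpow two_pos (by norm_num)]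
    ring
  rw [h]
  have : lam * (R - (-(s * D) - logb 2 E)) = (lam * R + lam * s * D) + logb 2 E * lam := by ring
  rw [this, rpow_add two_pos, rpow_mul two_pos.le, rpow_logb two_pos (by norm_num) hE]

/-- Rates and distortion levels enter every summand through the same power of 2, which factors out;
what remains is the feature mixture with slopes converted to nats. -/
theorem TestChannel.tilt_eq (T : TestChannel X Y Xh Yh W) (dX : X → Xh → ℝ) (dY : Y → Yh → ℝ)
    {P : X × Y → ℝ} (hP : P ∈ stdSimplex ℝ (X × Y)) {R₁ R₂ D₁ D₂ lam₁ lam₂ γ₁ γ₂ : ℝ}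
    (h1 : lam₁ ≠ 0) (h2 : lam₂ ≠ 0) (z : X × Y) :
    T.tilt dX dY R₁ R₂ D₁ D₂ lam₁ lam₂ γ₁ γ₂ P z =
      -log (T.mixFeature dX dY lam₁ lam₂ (γ₁ / lam₁ * log 2) (γ₂ / lam₂ * log 2) P z) / log 2 -
        (lam₁ * R₁ + lam₂ * R₂ + γ₁ * D₁ + γ₂ * D₂) := by
  have hmix := featureHull_pos (T.mixFeature_mem dX dY lam₁ lam₂ (γ₁ / lam₁ * log 2)
    (γ₂ / lam₂ * log 2) hP) z
  have hsum : ∑ w, T.pW P w * (2 : ℝ) ^ (lam₁ * (R₁ - T.tiltX dX D₁ (γ₁ / lam₁) P z.1 w) +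
      lam₂ * (R₂ - T.tiltY dY D₂ (γ₂ / lam₂) P z.2 w)) =
      2 ^ (lam₁ * R₁ + lam₂ * R₂ + γ₁ * D₁ + γ₂ * D₂) *
        T.mixFeature dX dY lam₁ lam₂ (γ₁ / lam₁ * log 2) (γ₂ / lam₂ * log 2) P z := by
    rw [mixFeature, Finset.mul_sum]
    refine Finset.sum_congr rfl fun w _ => ?_
    rcases (T.pW_nonneg hP.1 w).eq_or_lt with h0 | h0
    · rw [← h0]; simp
    · have e1 := expAvg_pos dX (γ₁ / lam₁ * log 2) (T.pXhGivenW_mem hP.1 h0) z.1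
      have e2 := expAvg_pos dY (γ₂ / lam₂ * log 2) (T.pYhGivenW_mem hP.1 h0) z.2
      rw [tiltX, tiltY, sum_mul_two_rpow_eq, sum_mul_two_rpow_eq, rpow_add two_pos,
        two_rpow_mul_sub e1, two_rpow_mul_sub e2, mul_div_cancel₀ _ h1, mul_div_cancel₀ _ h2,
        feature, show lam₁ * R₁ + lam₂ * R₂ + γ₁ * D₁ + γ₂ * D₂ =
          (lam₁ * R₁ + γ₁ * D₁) + (lam₂ * R₂ + γ₂ * D₂) by ring,
        rpow_add two_pos (lam₁ * R₁ + γ₁ * D₁) (lam₂ * R₂ + γ₂ * D₂)]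
      ring
  rw [tilt, hsum, one_div, logb_inv, logb_mul (by positivity) hmix.ne',
    logb_rpow two_pos (by norm_num), logb]
  ring

/-- The Lagrangian of a test channel. -/
theorem TestChannel.sum_lagrDen_eq (T : TestChannel X Y Xh Yh W) (dX : X → Xh → ℝ) (dY : Y → Yh → ℝ)
    (P : X × Y → ℝ) {lam₁ lam₂ γ₁ γ₂ : ℝ} (h1 : lam₁ ≠ 0) (h2 : lam₂ ≠ 0) :
    ∑ z, P z * T.lagrDen dX dY lam₁ lam₂ (γ₁ / lam₁ * log 2) (γ₂ / lam₂ * log 2) P z =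
      log 2 * (T.commonInfo P + lam₁ * T.infoX P + lam₂ * T.infoY P + γ₁ * T.distX dX P +
        γ₂ * T.distY dY P) := by
  rw [sum_lagrDen]
  field_simp

/-- A minimizer of the Lagrangian is log-optimal, and its Lagrangian density is the logarithm of
its feature mixture. -/
theorem TestChannel.mixFeature_of_lagrangian_min {k : ℕ} (T : TestChannel X Y Xh Yh (Fin k))
    (dX : X → Xh → ℝ) (dY : Y → Yh → ℝ) {P : X × Y → ℝ} (hP : P ∈ stdSimplex ℝ (X × Y))
    {lam₁ lam₂ γ₁ γ₂ : ℝ} (h1 : 0 < lam₁) (h2 : 0 < lam₂)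
    (hmin : ∀ v ∈ valueSet dX dY P, T.commonInfo P + lam₁ * T.infoX P + lam₂ * T.infoY P +
      γ₁ * T.distX dX P + γ₂ * T.distY dY P ≤ v 0 + lam₁ * v 1 + lam₂ * v 2 + γ₁ * v 3 + γ₂ * v 4) :
    (∀ f ∈ featureHull dX dY lam₁ lam₂ (γ₁ / lam₁ * log 2) (γ₂ / lam₂ * log 2),
      ∑ z, P z * log (f z) ≤ ∑ z, P z *
        log (T.mixFeature dX dY lam₁ lam₂ (γ₁ / lam₁ * log 2) (γ₂ / lam₂ * log 2) P z)) ∧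
    ∀ z, 0 < P z → T.lagrDen dX dY lam₁ lam₂ (γ₁ / lam₁ * log 2) (γ₂ / lam₂ * log 2) P z =
      -log (T.mixFeature dX dY lam₁ lam₂ (γ₁ / lam₁ * log 2) (γ₂ / lam₂ * log 2) P z) := by
  set s₁ := γ₁ / lam₁ * log 2 with hs₁
  set s₂ := γ₂ / lam₂ * log 2 with hs₂
  have e1 : lam₁ * s₁ = γ₁ * log 2 := by rw [hs₁]; field_simp
  have e2 : lam₂ * s₂ = γ₂ * log 2 := by rw [hs₂]; field_simp
  have hlog2 := log_pos one_lt_two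
  -- Every f in the hull yields a test channel whose Lagrangian is at most -E log f, hence so is the
  -- minimal Lagrangian.
  have hlow : ∀ f ∈ featureHull dX dY lam₁ lam₂ s₁ s₂,
      ∑ z, P z * T.lagrDen dX dY lam₁ lam₂ s₁ s₂ P z ≤ -∑ z, P z * log (f z) := by
    intro f hf
    obtain ⟨v, hv, hle⟩ := exists_valueSet_le_of_mem_featureHull dX dY s₁ s₂ h1.le h2.le hP hf
    refine le_trans ?_ hle
    rw [T.sum_lagrDen_eq dX dY P h1.ne' h2.ne', e1, e2]
    have := mul_le_mul_of_nonneg_left (hmin v hv) hlog2.le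
    linarith
  have hpt : ∀ z, P z * -log (T.mixFeature dX dY lam₁ lam₂ s₁ s₂ P z) ≤
      P z * T.lagrDen dX dY lam₁ lam₂ s₁ s₂ P z := by
    intro z
    rcases (hP.1 z).eq_or_lt with h | h
    · simp [← h]
    · exact mul_le_mul_of_nonneg_left (T.neg_log_mixFeature_le dX dY s₁ s₂ h1.le h2.le hP h) h.le
  have hsumle := Finset.sum_le_sum fun z (_ : z ∈ Finset.univ) => hpt z
  have hself := hlow _ (T.mixFeature_mem dX dY lam₁ lam₂ s₁ s₂ hP)
  simp only [mul_neg, Finset.sum_neg_distrib] at hsumle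
  refine ⟨fun f hf => ?_, fun z hz => ?_⟩
  · have := hlow f hf
    linarith
  -- The averages agree while the letterwise inequality holds, so equality holds at each letter of
  -- positive probability.
  · have heq : ∑ z, P z * -log (T.mixFeature dX dY lam₁ lam₂ s₁ s₂ P z) =
        ∑ z, P z * T.lagrDen dX dY lam₁ lam₂ s₁ s₂ P z := by
      simp only [mul_neg, Finset.sum_neg_distrib]
      exact le_antisymm hsumle hself
    have := (Finset.sum_eq_sum_iff_of_le fun z _ => hpt z).1 heq z (Finset.mem_univ z)
    exact (mul_left_cancel₀ hz.ne' this).symm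

end Tilt

/-! ### Gaussian thresholds for block tails, including zero variance. -/

section TailLimit

open Filter Topology

variable {Z : Type*} [Fintype Z]

open Classical in
/-- The tail of a normalized block sum. -/
def blockTail (P h : Z → ℝ) (n : ℕ) (t : ℝ) : ℝ :=
  ∑ z : Fin n → Z, if √n * t < ∑ i, h (z i) then ∏ i, P (z i) else 0

theorem tendsto_blockTail {P : Z → ℝ} (hP : P ∈ stdSimplex ℝ Z) {h : Z → ℝ}
    (h0 : ∑ z, P z * h z = 0) (hV : 0 < ∑ z, P z * h z ^ 2) (t : ℝ) :
    Tendsto (fun n => blockTail P h n t) atTop (𝓝 (gaussQ (t / √(∑ z, P z * h z ^ 2)))) := by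
  classical
  refine (tendsto_sum_prod_gaussQ hP h h0 rfl hV t).congr' ?_
  filter_upwards [eventually_gt_atTop 0] with n hn
  have hs : (0 : ℝ) < √n := sqrt_pos.2 (by exact_mod_cast hn)
  refine Finset.sum_congr rfl fun z _ => ?_
  simp only [lt_div_iff₀ hs, mul_comm t]

theorem sum_eq_zero_of_variance_zero {P : Z → ℝ} (hP : P ∈ stdSimplex ℝ Z) {h : Z → ℝ}
    (hV : ∑ z, P z * h z ^ 2 = 0) {n : ℕ} {z : Fin n → Z} (hz : ∏ i, P (z i) ≠ 0) :
    ∑ i, h (z i) = 0 := by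
  have h1 := (Finset.sum_eq_zero_iff_of_nonneg
    (fun z _ => mul_nonneg (hP.1 z) (sq_nonneg (h z)))).1 hV
  refine Finset.sum_eq_zero fun i _ => ?_
  have h2 := h1 (z i) (Finset.mem_univ _)
  have h3 : P (z i) ≠ 0 := Finset.prod_ne_zero_iff.1 hz i (Finset.mem_univ i)
  simpa [h3] using h2

/-- With zero variance h vanishes on the support, the block sum is almost surely 0, and the tail is
a step function. This replaces the central limit theorem when the threshold degenerates to 0. -/
theorem blockTail_of_variance_zero {P : Z → ℝ} (hP : P ∈ stdSimplex ℝ Z) {h : Z → ℝ}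
    (hV : ∑ z, P z * h z ^ 2 = 0) {n : ℕ} (hn : 0 < n) (t : ℝ) :
    blockTail P h n t = if t < 0 then 1 else 0 := by
  classical
  have hs : (0 : ℝ) < √n := sqrt_pos.2 (by exact_mod_cast hn)
  have hiff : √n * t < 0 ↔ t < 0 := ⟨fun h1 => by
    by_contra hc
    linarith [mul_nonneg hs.le (not_lt.1 hc)], fun h1 => mul_neg_of_pos_of_neg hs h1⟩
  have : ∀ z : Fin n → Z, (if √n * t < ∑ i, h (z i) then ∏ i, P (z i) else 0) =
      (∏ i, P (z i)) * if t < 0 then 1 else 0 := by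
    intro z
    rcases eq_or_ne (∏ i, P (z i)) 0 with hz | hz
    · simp [hz]
    · rw [sum_eq_zero_of_variance_zero hP hV hz]
      simp only [hiff]
      split_ifs <;> simp
  unfold blockTail
  simp only [this]
  rw [← Finset.sum_mul, sum_prod_eq_one hP, one_mul]

/-- A threshold whose tail is eventually at most `ε` dominates the Gaussian approximation. -/
theorem le_of_eventually_blockTail_le {P : Z → ℝ} (hP : P ∈ stdSimplex ℝ Z) {h : Z → ℝ}
    (h0 : ∑ z, P z * h z = 0) {ε : ℝ} (hε0 : 0 < ε) (hε1 : ε < 1) {t : ℝ}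
    (ht : ∀ e > 0, ∀ᶠ n in atTop, blockTail P h n t ≤ ε + e) :
    √(∑ z, P z * h z ^ 2) * gaussQInv ε ≤ t := by
  have hV0 : 0 ≤ ∑ z, P z * h z ^ 2 :=
    Finset.sum_nonneg fun z _ => mul_nonneg (hP.1 z) (sq_nonneg _)
  rcases hV0.eq_or_lt with hV | hV
  · rw [← hV, sqrt_zero, zero_mul]
    by_contra hcon
    push Not at hcon
    obtain ⟨n, hn, hn0⟩ := ((ht ((1 - ε) / 2) (by linarith)).and (eventually_gt_atTop 0)).exists
    rw [blockTail_of_variance_zero hP hV.symm hn0, if_pos hcon] at hn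
    linarith
  · have hle : gaussQ (t / √(∑ z, P z * h z ^ 2)) ≤ ε :=
      le_of_forall_pos_le_add fun e he =>
        le_of_tendsto (tendsto_blockTail hP h0 hV t) (ht e he)
    rw [← gaussQ_gaussQInv hε0 hε1] at hle
    have := strictAnti_gaussQ.le_iff_ge.1 hle
    rw [le_div_iff₀ (sqrt_pos.2 hV)] at this
    linarith

/-- Above the Gaussian threshold, the tail is eventually strictly smaller than `ε`. -/
theorem exists_eventually_blockTail_le {P : Z → ℝ} (hP : P ∈ stdSimplex ℝ Z) {h : Z → ℝ}
    (h0 : ∑ z, P z * h z = 0) {ε : ℝ} (hε0 : 0 < ε) (hε1 : ε < 1) {t : ℝ}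
    (ht : √(∑ z, P z * h z ^ 2) * gaussQInv ε < t) :
    ∃ ε' < ε, ∀ᶠ n in atTop, blockTail P h n t ≤ ε' := by
  have hV0 : 0 ≤ ∑ z, P z * h z ^ 2 :=
    Finset.sum_nonneg fun z _ => mul_nonneg (hP.1 z) (sq_nonneg _)
  rcases hV0.eq_or_lt with hV | hV
  · rw [← hV, sqrt_zero, zero_mul] at ht
    refine ⟨0, hε0, ?_⟩
    filter_upwards [eventually_gt_atTop 0] with n hn
    rw [blockTail_of_variance_zero hP hV.symm hn, if_neg ht.le.not_gt]
  · have hlt : gaussQ (t / √(∑ z, P z * h z ^ 2)) < ε := by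
      rw [← gaussQ_gaussQInv hε0 hε1]
      refine strictAnti_gaussQ ?_
      rw [lt_div_iff₀ (sqrt_pos.2 hV)]
      linarith
    obtain ⟨ε', h1, h2⟩ := exists_between hlt
    exact ⟨ε', h2, ((tendsto_blockTail hP h0 hV t).eventually (gt_mem_nhds h1)).mono
      fun n hn => hn.le⟩

end TailLimit

/-! ### The second-order converse. -/

section SecondOrderConverse

open Filter Topology

variable {X Y Xh Yh : Type*} [Fintype X] [Fintype Y] [Fintype Xh] [Fintype Yh]

/-- One-shot converse for the excess-distortion probability. -/
theorem Code.blockTail_le_excessProb {dX : X → Xh → ℝ} {dY : Y → Yh → ℝ} {l₁ l₂ g₁ g₂ : ℝ}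
    (hl₁ : 0 < l₁) (hl₂ : 0 < l₂) (hg₁ : 0 ≤ g₁) (hg₂ : 0 ≤ g₂) {P : X × Y → ℝ}
    (hP : P ∈ stdSimplex ℝ (X × Y)) {g : X × Y → ℝ}
    (hg : g ∈ featureHull dX dY l₁ l₂ (g₁ / l₁ * log 2) (g₂ / l₂ * log 2))
    (hmax : ∀ f ∈ featureHull dX dY l₁ l₂ (g₁ / l₁ * log 2) (g₂ / l₂ * log 2),
      ∑ z, P z * log (f z) ≤ ∑ z, P z * log (g z)) {R₀ R₁ R₂ D₁ D₂ : ℝ}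
    {n M₀ M₁ M₂ : ℕ} (c : Code X Y Xh Yh n M₀ M₁ M₂) {t a : ℝ}
    (ht : (logb 2 M₀ - n * R₀) + l₁ * (logb 2 M₁ - n * R₁) + l₂ * (logb 2 M₂ - n * R₂) + a ≤
      √n * t) :
    blockTail P (fun z => -log (g z) / log 2 - (l₁ * R₁ + l₂ * R₂ + g₁ * D₁ + g₂ * D₂) - R₀) n t ≤
      c.excessProb dX dY D₁ D₂ P + exp (-(a * log 2)) := by
  classical
  obtain ⟨⟨x₀, y₀⟩⟩ := nonempty_of_mem_stdSimplex hP
  have : Nonempty X := ⟨x₀⟩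
  have : Nonempty Y := ⟨y₀⟩
  have hlog2 := log_pos one_lt_two
  have key := c.sum_prod_mul_exp_le_one hl₁ hl₂ hP hg hmax
  have e1 : l₁ * (g₁ / l₁ * log 2) = g₁ * log 2 := by field_simp
  have e2 : l₂ * (g₂ / l₂ * log 2) = g₂ * log 2 := by field_simp
  rw [e1, e2] at key
  unfold Code.excessProb blockTail
  rw [sum_fun_prod, ← sub_le_iff_le_add']
  -- Multiplying the normalized one-shot bound by 2^(-a) prepares a Markov-type estimate.
  have key2 := mul_le_mul_of_nonneg_right key (exp_pos (-(a * log 2))).le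
  rw [one_mul, Finset.sum_mul] at key2
  rw [← Finset.sum_sub_distrib]
  refine (Finset.sum_le_sum fun z _ => ?_).trans key2
  have hp := prod_nonneg_of_mem hP.1 z
  have hr : 0 ≤ (∏ i, P (z i)) * exp (∑ i, -log (g (z i)) +
      -(g₁ * log 2 * (n * avgDist dX (fun i => (z i).1)
        (c.outX (fun i => (z i).1) (fun i => (z i).2))) +
        g₂ * log 2 * (n * avgDist dY (fun i => (z i).2)
        (c.outY (fun i => (z i).1) (fun i => (z i).2)))) -
      (log M₀ + l₁ * log M₁ + l₂ * log M₂)) * exp (-(a * log 2)) := by positivity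
  split_ifs with h1 h2 h2
  · linarith
  -- The only case with content: the block sum is large and both distortions are within their
  -- levels. The exponent of the one-shot bound is then at least a in bits, so the factor 2^(-a) is
  -- compensated.
  · push Not at h2
    rw [sub_zero, mul_assoc, ← exp_add]
    refine le_mul_of_one_le_right hp (one_le_exp ?_)
    have d1 := mul_le_mul_of_nonneg_left h2.1 (by positivity : (0 : ℝ) ≤ g₁ * log 2 * n)
    have d2 := mul_le_mul_of_nonneg_left h2.2 (by positivity : (0 : ℝ) ≤ g₂ * log 2 * n)
    have h3 := ht.trans h1.le
    rw [Finset.sum_sub_distrib, Finset.sum_sub_distrib, ← Finset.sum_div] at h3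
    simp only [Finset.sum_const, Finset.card_univ, Fintype.card_fin, nsmul_eq_mul, logb] at h3
    have h4 := mul_le_mul_of_nonneg_right h3 hlog2.le
    have h5 : (log M₀ / log 2 - n * R₀ + l₁ * (log M₁ / log 2 - n * R₁) +
        l₂ * (log M₂ / log 2 - n * R₂) + a) * log 2 =
        log M₀ + l₁ * log M₁ + l₂ * log M₂ - n * (R₀ + l₁ * R₁ + l₂ * R₂) * log 2 + a * log 2 := by
      field_simp
      ring
    have h6 : ((∑ i, -log (g (z i))) / log 2 - n * (l₁ * R₁ + l₂ * R₂ + g₁ * D₁ + g₂ * D₂) -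
        n * R₀) * log 2 = (∑ i, -log (g (z i))) -
        n * (R₀ + l₁ * R₁ + l₂ * R₂ + g₁ * D₁ + g₂ * D₂) * log 2 := by
      field_simp
      ring
    rw [h5, h6] at h4
    linarith
  · linarith
  · linarith

/-- A margin a of order √n makes the error 2^(-a) vanish yet costs an arbitrarily small amount after
normalization by √n; the tail limit then compares thresholds. -/
theorem le_of_secondOrderAchievable {dX : X → Xh → ℝ} {dY : Y → Yh → ℝ} {l₁ l₂ g₁ g₂ : ℝ}
    (hl₁ : 0 < l₁) (hl₂ : 0 < l₂) (hg₁ : 0 ≤ g₁) (hg₂ : 0 ≤ g₂) {P : X × Y → ℝ}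
    (hP : P ∈ stdSimplex ℝ (X × Y)) {g : X × Y → ℝ}
    (hg : g ∈ featureHull dX dY l₁ l₂ (g₁ / l₁ * log 2) (g₂ / l₂ * log 2))
    (hmax : ∀ f ∈ featureHull dX dY l₁ l₂ (g₁ / l₁ * log 2) (g₂ / l₂ * log 2),
      ∑ z, P z * log (f z) ≤ ∑ z, P z * log (g z)) {R₀ R₁ R₂ D₁ D₂ : ℝ} {h : X × Y → ℝ}
    (hh : h = fun z => -log (g z) / log 2 - (l₁ * R₁ + l₂ * R₂ + g₁ * D₁ + g₂ * D₂) - R₀)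
    (h0 : ∑ z, P z * h z = 0) {ε : ℝ} (hε0 : 0 < ε) (hε1 : ε < 1) {L : ℝ × ℝ × ℝ}
    (hL : SecondOrderAchievable dX dY R₀ R₁ R₂ D₁ D₂ ε P L) :
    √(∑ z, P z * h z ^ 2) * gaussQInv ε ≤ L.1 + l₁ * L.2.1 + l₂ * L.2.2 := by
  obtain ⟨M₀, M₁, M₂, c, b0, b1, b2, b3⟩ := hL
  have hlog2 := log_pos one_lt_two
  refine le_of_forall_pos_le_add fun η hη => ?_
  -- The slack η is shared between the three upper limits (1 + l₁ + l₂) and the margin `√n * ρ` (1).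
  set ρ := η / (2 + l₁ + l₂) with hρ
  have hρ0 : 0 < ρ := by positivity
  have hρη : ρ * (2 + l₁ + l₂) = η := by rw [hρ]; field_simp
  refine le_of_eventually_blockTail_le hP h0 hε0 hε1 fun e he => ?_
  have hexp : Tendsto (fun n : ℕ => exp (-(√n * ρ * log 2))) atTop (𝓝 0) := by
    refine tendsto_exp_neg_atTop_nhds_zero.comp ?_
    exact ((tendsto_sqrt_atTop.comp tendsto_natCast_atTop_atTop).atTop_mul_const hρ0).atTop_mul_const
      hlog2
  filter_upwards [eventually_le_of_limsup_coe_le b0 (lt_add_of_pos_right _ hρ0),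
    eventually_le_of_limsup_coe_le b1 (lt_add_of_pos_right _ hρ0),
    eventually_le_of_limsup_coe_le b2 (lt_add_of_pos_right _ hρ0),
    eventually_le_of_limsup_coe_le b3 (lt_add_of_pos_right _ (half_pos he)),
    hexp.eventually (gt_mem_nhds (half_pos he)), eventually_gt_atTop 0] with n a0 a1 a2 a3 a4 hn
  have hs : (0 : ℝ) < √n := sqrt_pos.2 (by exact_mod_cast hn)
  rw [div_le_iff₀ hs] at a0 a1 a2
  have f1 := mul_le_mul_of_nonneg_left a1 hl₁.le
  have f2 := mul_le_mul_of_nonneg_left a2 hl₂.le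
  have := (c n).blockTail_le_excessProb hl₁ hl₂ hg₁ hg₂ hP hg hmax (R₀ := R₀) (R₁ := R₁) (R₂ := R₂)
    (D₁ := D₁) (D₂ := D₂) (t := L.1 + l₁ * L.2.1 + l₂ * L.2.2 + η) (a := √n * ρ) (by
      rw [← hρη]
      linarith)
  rw [← hh] at this
  linarith

end SecondOrderConverse

/-! ### Repairing constraint deviations by mixing. -/

section Mixing

/-- The sign attached to a Boolean. -/
def boolSign (β : Bool) : ℝ := if β then 1 else -1

theorem abs_boolSign (β : Bool) : |boolSign β| = 1 := by
  cases β <;> simp [boolSign]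

theorem abs_mul_boolSign (x : ℝ) : |x| * boolSign (decide (0 ≤ x)) = x := by
  unfold boolSign
  by_cases h : 0 ≤ x
  · simp [h, abs_of_nonneg h]
  · simp [h, abs_of_neg (not_le.1 h)]

/-- Mixing weights that move a base point along prescribed signed directions. -/
theorem exists_mixing_weights {r : ℝ} (hr : 0 < r) (b : Fin 4 → ℝ) :
    ∃ θ ∈ stdSimplex ℝ (Option (Fin 4 × Bool)), ∑ a, |b a| ≤ r →
      ∀ f : Option (Fin 4 × Bool) → ℝ, ∑ j, θ j * f j =
        f none + ∑ a, |b a| / r * (f (some (a, decide (0 ≤ b a))) - f none) := by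
  by_cases hb : ∑ a, |b a| ≤ r
  · have hs : ∀ f : Option (Fin 4 × Bool) → ℝ,
        ∑ j : Option (Fin 4 × Bool), (j.elim (1 - ∑ a, |b a| / r)
          fun p => if p.2 = decide (0 ≤ b p.1) then |b p.1| / r else 0) * f j =
        f none + ∑ a, |b a| / r * (f (some (a, decide (0 ≤ b a))) - f none) := by
      intro f
      have hin : ∀ a, ∑ β : Bool, (if β = decide (0 ≤ b a) then |b a| / r else 0) *
          f (some (a, β)) = |b a| / r * f (some (a, decide (0 ≤ b a))) := by
        intro a
        rw [Fintype.sum_bool]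
        cases decide (0 ≤ b a) <;> simp
      rw [Fintype.sum_option, Fintype.sum_prod_type]
      simp only [Option.elim, hin, mul_sub, Finset.sum_sub_distrib, ← Finset.sum_mul, sub_mul,
        one_mul]
      ring
    refine ⟨_, ⟨?_, ?_⟩, fun _ => hs⟩
    · rintro (_ | p)
      · simp only [Option.elim]
        rw [← Finset.sum_div, sub_nonneg, div_le_one hr]
        exact hb
      · simp only [Option.elim]
        split_ifs
        · positivity
        · exact le_rfl
    · have := hs fun _ => 1
      simpa using this
  -- For deviations too large to be repaired nothing is claimed; the base channel is a default that
  -- keeps the weights a pmf for every label.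
  · exact ⟨Pi.single none 1, single_mem_stdSimplex ℝ none, fun h => absurd h hb⟩

/-- Here b is the signed distance from the base channel to the budget B. Weight |b a|/(Nδ) on the
channel perturbed in coordinate a, with the sign of b a, moves that coordinate by b a and the common
rate by -m a · b a, up to κ|b a| and the fluctuation ω of block sums. That fluctuation is multiplied
by the small total weight, hence the bounded error E. -/
theorem mixing_bounds {N R₀ δ κ ω E : ℝ} (hN : 0 < N) (hδ : 0 < δ) {c m B : Fin 4 → ℝ}
    {S : Option (Fin 4 × Bool) → Fin 5 → ℝ}
    (u0 : ∀ a β, S (some (a, β)) 0 ≤ N * (R₀ - boolSign β * m a * δ + κ * δ) + ω)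
    (ub : ∀ a β b, S (some (a, β)) (Fin.succ b) ≤
      N * (c b + if b = a then boolSign β * δ else 0) + ω)
    (l0 : N * R₀ - ω ≤ S none 0) (lb : ∀ b, N * c b - ω ≤ S none (Fin.succ b))
    {θ : Option (Fin 4 × Bool) → ℝ} {b : Fin 4 → ℝ} (hbB : ∀ a, b a = B a - S none (Fin.succ a))
    (hθ : ∀ f : Option (Fin 4 × Bool) → ℝ, ∑ j, θ j * f j =
        f none + ∑ a, |b a| / (N * δ) * (f (some (a, decide (0 ≤ b a))) - f none))
    (hE : 2 * ω * (∑ a, |b a| / (N * δ)) ≤ E) :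
    (∀ a, ∑ j, θ j * S j (Fin.succ a) ≤ B a + E) ∧
      ∑ j, θ j * S j 0 ≤ S none 0 - ∑ a, m a * b a + κ * ∑ a, |b a| + E := by
  have hw : ∀ a, 0 ≤ |b a| / (N * δ) := fun a => by positivity
  have hNδ : N * δ ≠ 0 := by positivity
  constructor
  · intro d
    rw [hθ fun j => S j (Fin.succ d)]
    have h1 : ∀ a, |b a| / (N * δ) * (S (some (a, decide (0 ≤ b a))) d.succ - S none d.succ) ≤
        (if d = a then b d else 0) + 2 * ω * (|b a| / (N * δ)) := by
      intro a
      have h2 : S (some (a, decide (0 ≤ b a))) d.succ - S none d.succ ≤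
          N * (if d = a then boolSign (decide (0 ≤ b a)) * δ else 0) + 2 * ω := by
        have := ub a (decide (0 ≤ b a)) d
        have := lb d
        linarith
      refine (mul_le_mul_of_nonneg_left h2 (hw a)).trans_eq ?_
      split_ifs with hda
      · subst hda
        have := abs_mul_boolSign (b d)
        rw [mul_add]
        congr 1
        · calc _ = |b d| * boolSign (decide (0 ≤ b d)) * ((N * δ) / (N * δ)) := by ring
            _ = b d := by rw [this, div_self hNδ, mul_one]
        · ring
      · ring
    have h3 := Finset.sum_le_sum fun a (_ : a ∈ Finset.univ) => h1 a
    rw [Finset.sum_add_distrib, ← Finset.mul_sum, Finset.sum_ite_eq] at h3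
    simp only [Finset.mem_univ, if_true] at h3
    have := hbB d
    linarith
  · rw [hθ fun j => S j 0]
    have h1 : ∀ a, |b a| / (N * δ) * (S (some (a, decide (0 ≤ b a))) 0 - S none 0) ≤
        -(m a * b a) + κ * |b a| + 2 * ω * (|b a| / (N * δ)) := by
      intro a
      have h2 : S (some (a, decide (0 ≤ b a))) 0 - S none 0 ≤
          N * (-(boolSign (decide (0 ≤ b a)) * m a * δ) + κ * δ) + 2 * ω := by
        have := u0 a (decide (0 ≤ b a))
        linarith
      refine (mul_le_mul_of_nonneg_left h2 (hw a)).trans_eq ?_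
      have := abs_mul_boolSign (b a)
      calc _ = -(m a * (|b a| * boolSign (decide (0 ≤ b a)))) * ((N * δ) / (N * δ)) +
            κ * |b a| * ((N * δ) / (N * δ)) + 2 * ω * (|b a| / (N * δ)) := by ring
        _ = _ := by rw [this, div_self hNδ, mul_one, mul_one]
    have h3 := Finset.sum_le_sum fun a (_ : a ∈ Finset.univ) => h1 a
    simp only [Finset.sum_add_distrib, ← Finset.mul_sum, Finset.sum_neg_distrib] at h3
    linarith

end Mixing

/-! ### Densities in bits, letter counts and the excess event. -/

section Density

variable {X Y Xh Yh W : Type*} [Fintype X] [Fintype Y] [Fintype Xh] [Fintype Yh] [Fintype W]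

/-- The information densities (in bits) and distortions of a test channel given the source. -/
def TestChannel.density (T : TestChannel X Y Xh Yh W) (dX : X → Xh → ℝ) (dY : Y → Yh → ℝ)
    (P : X × Y → ℝ) : Fin 5 → X × Y → ℝ :=
  ![fun z => T.denW P z / log 2, fun z => T.rateX P z / log 2, fun z => T.rateY P z / log 2,
    T.lossX dX, T.lossY dY]

theorem TestChannel.sum_density (T : TestChannel X Y Xh Yh W) (dX : X → Xh → ℝ) (dY : Y → Yh → ℝ)
    (P : X × Y → ℝ) (a : Fin 5) : ∑ z, P z * T.density dX dY P a z = T.vals dX dY P a := by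
  have h2 : log 2 ≠ 0 := (log_pos one_lt_two).ne'
  have e : ∀ (f : X × Y → ℝ) (v : ℝ), log 2 * v = ∑ z, P z * f z →
      ∑ z, P z * (f z / log 2) = v := by
    intro f v h
    simp only [← mul_div_assoc]
    rw [← Finset.sum_div, ← h, mul_div_cancel_left₀ _ h2]
  fin_cases a
  · exact e _ _ (T.log_two_mul_commonInfo P)
  · exact e _ _ (T.log_two_mul_infoX' P)
  · exact e _ _ (T.log_two_mul_infoY' P)
  · exact (T.distX_eq dX P).symm
  · exact (T.distY_eq dY P).symm

theorem TestChannel.density_lagrangian (T : TestChannel X Y Xh Yh W) (dX : X → Xh → ℝ)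
    (dY : Y → Yh → ℝ) (P : X × Y → ℝ) {lam₁ lam₂ γ₁ γ₂ : ℝ} (h1 : lam₁ ≠ 0) (h2 : lam₂ ≠ 0)
    (z : X × Y) :
    T.density dX dY P 0 z + ∑ a, ![lam₁, lam₂, γ₁, γ₂] a * T.density dX dY P (Fin.succ a) z =
      T.lagrDen dX dY lam₁ lam₂ (γ₁ / lam₁ * log 2) (γ₂ / lam₂ * log 2) P z / log 2 := by
  have hl : log 2 ≠ 0 := (log_pos one_lt_two).ne'
  rw [Fin.sum_univ_four]
  change T.denW P z / log 2 + (lam₁ * (T.rateX P z / log 2) + lam₂ * (T.rateY P z / log 2) +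
    γ₁ * T.lossX dX z + γ₂ * T.lossY dY z) = (T.denW P z + lam₁ * T.rateX P z +
    lam₂ * T.rateY P z + lam₁ * (γ₁ / lam₁ * log 2) * T.lossX dX z +
    lam₂ * (γ₂ / lam₂ * log 2) * T.lossY dY z) / log 2
  field_simp
  ring

/-- The letter counts of a string. -/
def letterCount {Z : Type*} {n : ℕ} (z : Fin n → Z) : Z → Fin (n + 1) := by
  classical
  exact fun a => ⟨(Finset.univ.filter fun i => z i = a).card, Nat.lt_succ_of_le
    ((Finset.card_le_univ _).trans_eq (Fintype.card_fin n))⟩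

theorem sum_letterCount_mul {Z : Type*} [Fintype Z] {n : ℕ} (z : Fin n → Z) (h : Z → ℝ) :
    ∑ a, (letterCount z a : ℝ) * h a = ∑ i, h (z i) := by
  classical
  simp only [letterCount]
  have : ∀ a, (((Finset.univ.filter fun i => z i = a).card : ℕ) : ℝ) * h a =
      ∑ i, if z i = a then h a else 0 := by
    intro a
    rw [← Finset.sum_filter, Finset.sum_const, nsmul_eq_mul]
  simp only [this]
  rw [Finset.sum_comm]
  simp

/-- The distortion levels can be exceeded only on atypical strings or where the block sum of h is
above its threshold. -/
theorem Code.excessProb_le {dX : X → Xh → ℝ} {dY : Y → Yh → ℝ} {D₁ D₂ : ℝ} {P : X × Y → ℝ}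
    (hP : P ∈ stdSimplex ℝ (X × Y)) {n M₀ M₁ M₂ : ℕ} (hn : 0 < n) (C : Code X Y Xh Yh n M₀ M₁ M₂)
    {r t : ℝ} {h : X × Y → ℝ}
    (hC : ∀ z ∈ typicalSet P n r, ∑ i, h (z i) ≤ √n * t →
      ∑ i, dX (z i).1 (C.outX (fun i => (z i).1) (fun i => (z i).2) i) ≤ n * D₁ ∧
      ∑ i, dY (z i).2 (C.outY (fun i => (z i).1) (fun i => (z i).2) i) ≤ n * D₂) :
    C.excessProb dX dY D₁ D₂ P ≤
      (1 - ∑ z ∈ typicalSet P n r, ∏ i, P (z i)) + blockTail P h n t := by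
  classical
  have hn' : (0 : ℝ) < n := by exact_mod_cast hn
  unfold Code.excessProb blockTail
  rw [sum_fun_prod, ← sum_prod_eq_one hP n, ← sum_ite_mem_zero, ← Finset.sum_add_distrib]
  refine Finset.sum_le_sum fun z _ => ?_
  have hp := prod_nonneg_of_mem hP.1 z
  by_cases h1 : z ∈ typicalSet P n r
  · by_cases h2 : √n * t < ∑ i, h (z i)
    · rw [if_pos h1, if_pos h2, zero_add]
      split_ifs
      · exact le_rfl
      · exact hp
    · obtain ⟨h3, h4⟩ := hC z h1 (not_lt.1 h2)
      rw [if_pos h1, if_neg h2, if_neg]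
      · simp
      · push Not
        unfold avgDist
        rw [div_le_iff₀ hn', div_le_iff₀ hn', mul_comm, mul_comm D₂]
        exact ⟨h3, h4⟩
  · rw [if_neg h1]
    split_ifs <;> linarith

end Density

/-! ### The second-order direct part at finite blocklength. -/

section SecondOrderDirect

open Filter Topology

variable {X Y Xh Yh : Type*} [Fintype X] [Fintype Y] [Fintype Xh] [Fintype Yh]

theorem eventually_le_sqrt (x : ℝ) : ∀ᶠ n : ℕ in atTop, x ≤ √(n : ℝ) :=
  (tendsto_sqrt_atTop.comp tendsto_natCast_atTop_atTop).eventually (eventually_ge_atTop x)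

theorem eventually_linear_nonneg {c : ℝ} (hc : 0 < c) (x : ℝ) :
    ∀ᶠ n : ℕ in atTop, 0 ≤ n * c + √(n : ℝ) * x := by
  filter_upwards [eventually_le_sqrt (-x / c)] with n hn
  rw [div_le_iff₀ hc] at hn
  have h1 : (n : ℝ) = √n * √n := (mul_self_sqrt (Nat.cast_nonneg n)).symm
  have h2 : (n : ℝ) * c + √(n : ℝ) * x = √n * (√n * c + x) := by
    calc (n : ℝ) * c + √(n : ℝ) * x = (√n * √n) * c + √(n : ℝ) * x := by rw [← h1]
      _ = _ := by ring
  rw [h2]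
  exact mul_nonneg (sqrt_nonneg _) (by linarith)

theorem eventually_overhead_le (K E : ℝ) :
    ∀ᶠ n : ℕ in atTop, K * (1 + log ((n : ℝ) + 1)) + E ≤ √(n : ℝ) := by
  filter_upwards [(tendsto_log_div_sqrt K).eventually (gt_mem_nhds one_half_pos),
    eventually_le_sqrt (2 * E), eventually_gt_atTop 0] with n h1 h2 hn
  rw [div_lt_iff₀ (sqrt_pos.2 (by exact_mod_cast hn))] at h1
  linarith

/-- The absolute size of the densities of a test channel. -/
def TestChannel.densityBound {W : Type*} [Fintype W] (T : TestChannel X Y Xh Yh W) (dX : X → Xh → ℝ)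
    (dY : Y → Yh → ℝ) (P : X × Y → ℝ) : ℝ := ∑ a, ∑ z, |T.density dX dY P a z|

theorem TestChannel.sum_abs_density_le {W : Type*} [Fintype W] (T : TestChannel X Y Xh Yh W)
    (dX : X → Xh → ℝ) (dY : Y → Yh → ℝ) (P : X × Y → ℝ) (a : Fin 5) :
    ∑ z, |T.density dX dY P a z| ≤ T.densityBound dX dY P :=
  sum_single_le (f := fun a => ∑ z, |T.density dX dY P a z|)
    (fun a => Finset.sum_nonneg fun z _ => abs_nonneg _) a

theorem TestChannel.densityBound_nonneg {W : Type*} [Fintype W] (T : TestChannel X Y Xh Yh W)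
    (dX : X → Xh → ℝ) (dY : Y → Yh → ℝ) (P : X × Y → ℝ) : 0 ≤ T.densityBound dX dY P := by
  unfold densityBound; positivity

theorem TestChannel.abs_sum_density_sub_le {W : Type*} [Fintype W] (T : TestChannel X Y Xh Yh W)
    (dX : X → Xh → ℝ) (dY : Y → Yh → ℝ) {P : X × Y → ℝ} {n : ℕ} {r : ℝ} (hr : 0 ≤ r)
    {z : Fin n → X × Y} (hz : z ∈ typicalSet P n r) (a : Fin 5) :
    |∑ i, T.density dX dY P a (z i) - n * T.vals dX dY P a| ≤ r * T.densityBound dX dY P := by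
  rw [← T.sum_density]
  exact (abs_sum_sub_le hz _).trans (mul_le_mul_of_nonneg_left (T.sum_abs_density_le dX dY P a) hr)

set_option maxHeartbeats 1000000 in
/-- Codes at a fixed deviation of the private rates, near an optimal test channel. -/
theorem TestChannel.eventually_exists_code {k : ℕ} (T : TestChannel X Y Xh Yh (Fin k))
    {dX : X → Xh → ℝ} {dY : Y → Yh → ℝ} {P : X × Y → ℝ} (hP : P ∈ stdSimplex ℝ (X × Y))
    [Nonempty Xh] [Nonempty Yh] {R₀ : ℝ} {c m : Fin 4 → ℝ} (hm : ∀ a, 0 ≤ m a)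
    (hv0 : T.vals dX dY P 0 = R₀) (hv : ∀ a, T.vals dX dY P (Fin.succ a) = c a)
    (hR₀ : 0 < R₀) (hc0 : 0 < c 0) (hc1 : 0 < c 1) {κ δ : ℝ} (hκ : 0 < κ) (hδ : 0 < δ)
    (hpert : ∀ a, ∀ σ : ℝ, |σ| = 1 → ∃ u ∈ valueSet dX dY P,
      u 0 ≤ R₀ - σ * m a * δ + κ * δ ∧
        ∀ b, u (Fin.succ b) ≤ c b + if b = a then σ * δ else 0)
    {h : X × Y → ℝ} (hh : ∀ z, 0 < P z → T.density dX dY P 0 z +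
      ∑ a, m a * T.density dX dY P (Fin.succ a) z = h z + R₀ + ∑ a, m a * c a)
    (L₁ L₂ : ℝ) {K₁ : ℝ} (hK₁ : 0 < K₁) (t : ℝ) {A : ℝ}
    (hA : A = K₁ * T.densityBound dX dY P + |L₁| + |L₂| + 1) :
    ∃ C : ℝ, ∀ᶠ n : ℕ in atTop, ∃ (M₀ M₁ M₂ : ℕ) (cd : Code X Y Xh Yh n M₀ M₁ M₂),
      logb 2 M₀ ≤ n * R₀ + √n * (t - m 0 * L₁ - m 1 * L₂ + 4 * A * κ) +
        C * (1 + log ((n : ℝ) + 1)) ∧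
      logb 2 M₁ ≤ n * c 0 + √n * L₁ ∧ logb 2 M₂ ≤ n * c 1 + √n * L₂ ∧
      cd.excessProb dX dY (c 2) (c 3) P ≤ Fintype.card (X × Y) / K₁ ^ 2 + blockTail P h n t := by
  classical
  have hlog2 := log_pos one_lt_two
  have hlog2' : log 2 ≤ 1 := by linarith [log_two_lt_d9]
  have hBs := T.densityBound_nonneg dX dY P
  have hA0 : 0 < A := by rw [hA]; positivity
  -- Nine channels: `none` is the optimal one, `some (a, β)` the perturbation of constraint a by ±δ.
  have hfam : ∀ j : Option (Fin 4 × Bool), ∃ (k' : ℕ) (T' : TestChannel X Y Xh Yh (Fin k')),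
      (j = none → T'.density dX dY P = T.density dX dY P ∧ T'.vals dX dY P = T.vals dX dY P) ∧
      ∀ a β, j = some (a, β) → T'.vals dX dY P 0 ≤ R₀ - boolSign β * m a * δ + κ * δ ∧
        ∀ b, T'.vals dX dY P (Fin.succ b) ≤ c b + if b = a then boolSign β * δ else 0 := by
    rintro (_ | ⟨a, β⟩)
    · exact ⟨k, T, fun _ => ⟨rfl, rfl⟩, fun a β hj => by simp at hj⟩
    · obtain ⟨u, ⟨k', T', rfl⟩, h1, h2⟩ := hpert a _ (abs_boolSign β)
      refine ⟨k', T', fun hj => by simp at hj, fun a' β' hj => ?_⟩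
      simp only [Option.some.injEq, Prod.mk.injEq] at hj
      obtain ⟨rfl, rfl⟩ := hj
      exact ⟨h1, h2⟩
  choose kk TT hnone hsome using hfam
  obtain ⟨K, hK, hcode⟩ := exists_code_of_family TT dX dY hP
  obtain ⟨Bd, hBdj, hBd0⟩ : ∃ Bd, (∀ j, (TT j).densityBound dX dY P ≤ Bd) ∧ 0 ≤ Bd :=
    ⟨∑ j, (TT j).densityBound dX dY P,
      sum_single_le (f := fun j => (TT j).densityBound dX dY P)
        fun j => (TT j).densityBound_nonneg dX dY P,
      Finset.sum_nonneg fun j _ => (TT j).densityBound_nonneg dX dY P⟩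
  -- Fluctuation `K₁ * √n * Bd`, doubled, times total weight 4A√n/(nδ): the powers of n cancel and
  -- the error is a constant.
  obtain ⟨E, hE⟩ : ∃ E, E = 8 * K₁ * Bd * A / δ := ⟨_, rfl⟩
  have hE0 : 0 ≤ E := by rw [hE]; positivity
  obtain ⟨M, hM⟩ : ∃ M, M = ∑ a, m a := ⟨_, rfl⟩
  have hM0 : 0 ≤ M := hM ▸ Finset.sum_nonneg fun a _ => hm a
  -- The coding overhead in bits; since log 2 ≤ 1 it also dominates the overhead K in the
  -- distortions.
  obtain ⟨Kb, hKb⟩ : ∃ Kb, Kb = K / log 2 := ⟨_, rfl⟩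
  have hKb0 : 0 ≤ Kb := by rw [hKb]; positivity
  have hKb1 : K ≤ Kb := by rw [hKb, le_div_iff₀ hlog2]; nlinarith
  have hKb2 : log 2 * Kb = K := by rw [hKb]; field_simp
  refine ⟨M * (Kb + E) + E + Kb, ?_⟩
  filter_upwards [eventually_gt_atTop 0, eventually_overhead_le Kb E,
    eventually_le_sqrt (4 * A / δ),
    eventually_linear_nonneg hR₀ (t - m 0 * L₁ - m 1 * L₂ + 4 * A * κ),
    eventually_linear_nonneg hc0 (L₁ - 1), eventually_linear_nonneg hc1 (L₂ - 1)]
    with n hn hover hsq hp0 hp1 hp2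
  have hn' : (0 : ℝ) < n := by exact_mod_cast hn
  have hs : (0 : ℝ) < √n := sqrt_pos.2 hn'
  have hss : √(n : ℝ) * √n = n := mul_self_sqrt hn'.le
  obtain ⟨ℓ, hℓ⟩ : ∃ ℓ, ℓ = 1 + log ((n : ℝ) + 1) := ⟨_, rfl⟩
  rw [← hℓ] at hover ⊢
  have hℓ1 : 1 ≤ ℓ := by
    have := log_nonneg (by linarith : (1 : ℝ) ≤ n + 1)
    linarith
  rw [div_le_iff₀ hδ] at hsq
  have hroom : 4 * A * √n ≤ n * δ := by
    calc 4 * A * √n ≤ √n * δ * √n := mul_le_mul_of_nonneg_right hsq hs.le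
      _ = (√n * √n) * δ := by ring
      _ = n * δ := by rw [hss]
  -- Budgets for the four constraints, reduced in advance by the coding overhead and the mixing
  -- error so that the final code meets the targets exactly.
  set B : Fin 4 → ℝ := fun a => n * c a + √n * ![L₁, L₂, 0, 0] a - Kb * ℓ - E with hB
  choose Θ hΘ1 hΘ2 using exists_mixing_weights (mul_pos hn' hδ)
  -- The shortfall is written in terms of letter counts, so the mixing weights depend on the type
  -- alone, as `hcode` demands.
  set b : (X × Y → Fin (n + 1)) → Fin 4 → ℝ := fun y a =>
    B a - ∑ z, (y z : ℝ) * T.density dX dY P (Fin.succ a) z with hb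
  set G := (typicalSet P n (K₁ * √n)).filter fun z => ∑ i, h (z i) ≤ √n * t with hG
  obtain ⟨ω, hω⟩ : ∃ ω, ω = K₁ * √n * Bd := ⟨_, rfl⟩
  have hr0 : 0 ≤ K₁ * √n := by positivity
  have hKℓ : 0 ≤ Kb * ℓ := by positivity
  set S : (Fin n → X × Y) → Option (Fin 4 × Bool) → Fin 5 → ℝ := fun z j a =>
    ∑ i, (TT j).density dX dY P a (z i) with hS
  have main : ∀ z ∈ G, (∀ a, ∑ j, Θ (b (letterCount z)) j * S z j (Fin.succ a) ≤ B a + E) ∧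
      ∑ j, Θ (b (letterCount z)) j * S z j 0 ≤
        n * R₀ + √n * (t - m 0 * L₁ - m 1 * L₂ + 4 * A * κ) + (M * (Kb * ℓ + E) + E) := by
    intro z hzG
    obtain ⟨hz, hzt⟩ := Finset.mem_filter.1 hzG
    have hdev : ∀ j a, |S z j a - n * (TT j).vals dX dY P a| ≤ ω := fun j a =>
      ((TT j).abs_sum_density_sub_le dX dY hr0 hz a).trans
        (hω ▸ mul_le_mul_of_nonneg_left (hBdj j) hr0)
    have hSn : ∀ a, S z none a = ∑ i, T.density dX dY P a (z i) := by
      intro a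
      simp only [hS, (hnone none rfl).1]
    have hbz : ∀ a, b (letterCount z) a = B a - S z none (Fin.succ a) := by
      intro a
      simp only [hb, sum_letterCount_mul, hSn]
    have hℓabs : ∀ a, |(![L₁, L₂, 0, 0] : Fin 4 → ℝ) a| ≤ |L₁| + |L₂| := by
      have p1 := abs_nonneg L₁
      have p2 := abs_nonneg L₂
      intro a
      fin_cases a
      · change |L₁| ≤ _; linarith
      · change |L₂| ≤ _; linarith
      · change |(0 : ℝ)| ≤ _; rw [abs_zero]; linarith
      · change |(0 : ℝ)| ≤ _; rw [abs_zero]; linarith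
    -- Typicality contributes `K₁` times the density bound, the targets |L₁| + |L₂|, and the final 1
    -- in A absorbs the overhead, which is at most √n.
    have hbA : ∀ a, |b (letterCount z) a| ≤ A * √n := by
      intro a
      have h1 := T.abs_sum_density_sub_le dX dY hr0 hz (Fin.succ a)
      rw [hv, ← hSn] at h1
      have h2 := mul_le_mul_of_nonneg_left (hℓabs a) hs.le
      rw [← abs_of_pos hs, ← abs_mul, abs_of_pos hs] at h2
      have e : b (letterCount z) a = -(S z none (Fin.succ a) - n * c a) +
          √n * ![L₁, L₂, 0, 0] a - (Kb * ℓ + E) := by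
        rw [hbz]; simp only [hB]; ring
      rw [e, hA, abs_le]
      rw [abs_le] at h1 h2
      constructor
      · linarith
      · linarith
    have hbsum : ∑ a, |b (letterCount z) a| ≤ 4 * A * √n := by
      refine (Finset.sum_le_sum fun a _ => hbA a).trans_eq ?_
      simp
      ring
    obtain ⟨r1, r2⟩ := mixing_bounds (N := n) (R₀ := R₀) (δ := δ) (κ := κ) (ω := ω) (E := E) hn' hδ
      (c := c) (m := m) (B := B) (S := S z)
      (fun a β => by
        have h1 := (abs_le.1 (hdev (some (a, β)) 0)).2
        have h2 := mul_le_mul_of_nonneg_left ((hsome _ a β rfl).1) hn'.le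
        linarith)
      (fun a β d => by
        have h1 := (abs_le.1 (hdev (some (a, β)) (Fin.succ d))).2
        have h2 := mul_le_mul_of_nonneg_left ((hsome _ a β rfl).2 d) hn'.le
        linarith)
      (by
        have h1 := (abs_le.1 (hdev none 0)).1
        rw [(hnone none rfl).2, hv0] at h1
        linarith)
      (fun d => by
        have h1 := (abs_le.1 (hdev none (Fin.succ d))).1
        rw [(hnone none rfl).2, hv] at h1
        linarith) hbz (hΘ2 _ (hbsum.trans hroom)) (by
        rw [← Finset.sum_div]
        have h1 : 2 * ω * ((∑ a, |b (letterCount z) a|) / (n * δ)) ≤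
            2 * ω * ((4 * A * √n) / (n * δ)) := by
          have : 0 ≤ ω := by rw [hω]; positivity
          gcongr
        refine h1.trans_eq ?_
        rw [hω, hE]
        calc 2 * (K₁ * √n * Bd) * (4 * A * √n / (n * δ)) =
              8 * K₁ * Bd * A * (√n * √n) / (n * δ) := by ring
          _ = 8 * K₁ * Bd * A / δ := by rw [hss]; field_simp)
    refine ⟨r1, r2.trans ?_⟩
    -- The heart of the direct part: common rate plus weighted constraints of the optimal channel is
    -- the block sum of h plus its mean. Subtracting the weighted shortfalls cancels the
    -- fluctuations of the private rates and distortions, leaving only h in the common rate.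
    have hsumh : S z none 0 + ∑ a, m a * S z none (Fin.succ a) =
        ∑ i, h (z i) + n * (R₀ + ∑ a, m a * c a) := by
      have h1 : ∑ i, (T.density dX dY P 0 (z i) +
          ∑ a, m a * T.density dX dY P (Fin.succ a) (z i)) =
          ∑ i, (h (z i) + R₀ + ∑ a, m a * c a) :=
        Finset.sum_congr rfl fun i _ => hh _ ((mem_typicalSet.1 hz).1 i)
      simp only [Finset.sum_add_distrib] at h1
      rw [Finset.sum_comm] at h1
      simp only [← Finset.mul_sum, ← hSn, Finset.sum_const, Finset.card_univ, Fintype.card_fin,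
        nsmul_eq_mul] at h1
      rw [h1]
      ring
    have hmb : ∑ a, m a * b (letterCount z) a = n * (∑ a, m a * c a) +
        √n * (m 0 * L₁ + m 1 * L₂) - M * (Kb * ℓ + E) - ∑ a, m a * S z none (Fin.succ a) := by
      simp only [hbz, hB, hM, Fin.sum_univ_four]
      simp
      ring
    have hκb := mul_le_mul_of_nonneg_left hbsum hκ.le
    linarith
  have hconv : ∀ z (f : ∀ j, X × Y → ℝ) (x : ℝ), ∑ j, Θ (b (letterCount z)) j *
      ∑ i, f j (z i) ≤ x → ∑ i : Fin n, ∑ j, Θ (b (letterCount z)) j * f j (z i) ≤ x := by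
    intro z f x hx
    rw [Finset.sum_comm]
    simpa only [← Finset.mul_sum] using hx
  have hscale : ∀ z (f : ∀ j, X × Y → ℝ) (x : ℝ), ∑ j, Θ (b (letterCount z)) j *
      ∑ i, f j (z i) / log 2 ≤ x →
      ∑ i : Fin n, ∑ j, Θ (b (letterCount z)) j * f j (z i) ≤ log 2 * x := by
    intro z f x hx
    refine hconv z f _ ?_
    simp only [← Finset.sum_div, ← mul_div_assoc] at hx
    rw [div_le_iff₀ hlog2] at hx
    linarith
  have hB0 : B 0 = n * c 0 + √n * L₁ - Kb * ℓ - E := rfl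
  have hB1 : B 1 = n * c 1 + √n * L₂ - Kb * ℓ - E := rfl
  have hB2 : B 2 = n * c 2 - Kb * ℓ - E := by simp [hB]
  have hB3 : B 3 = n * c 3 - Kb * ℓ - E := by simp [hB]
  have hcode' := hcode n G
    (fun z hz => (mem_typicalSet.1 (Finset.mem_filter.1 hz).1).1) letterCount
    (fun y => Θ (b y)) (fun y => hΘ1 _)
    (log 2 * (n * R₀ + √n * (t - m 0 * L₁ - m 1 * L₂ + 4 * A * κ) + (M * (Kb * ℓ + E) + E)))
    (log 2 * (B 0 + E)) (log 2 * (B 1 + E)) (B 2 + E) (B 3 + E)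
    (by positivity)
    (mul_nonneg hlog2.le (by rw [hB0]; linarith)) (mul_nonneg hlog2.le (by rw [hB1]; linarith))
    (fun z hz => by
      obtain ⟨r1, r2⟩ := main z hz
      exact ⟨hscale z (fun j => (TT j).denW P) _ r2, hscale z (fun j => (TT j).rateX P) _ (r1 0),
        hscale z (fun j => (TT j).rateY P) _ (r1 1), hconv z (fun j => (TT j).lossX dX) _ (r1 2),
        hconv z (fun j => (TT j).lossY dY) _ (r1 3)⟩)
  rw [← hℓ] at hcode'
  obtain ⟨M₀, M₁, M₂, cd, b0, b1, b2, b3⟩ := hcode'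
  have hKℓ2 : K * ℓ = log 2 * (Kb * ℓ) := by rw [← hKb2]; ring
  have hKle : K ≤ Kb * ℓ := by nlinarith
  refine ⟨M₀, M₁, M₂, cd, ?_, ?_, ?_, ?_⟩
  · rw [logb, div_le_iff₀ hlog2]
    refine b0.trans ?_
    rw [hKℓ2, ← mul_add, mul_comm _ (log 2)]
    refine mul_le_mul_of_nonneg_left ?_ hlog2.le
    have : M * E + E ≤ (M * E + E) * ℓ := le_mul_of_one_le_right (by positivity) hℓ1
    linarith
  · rw [logb, div_le_iff₀ hlog2]
    refine b1.trans (le_of_eq ?_)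
    rw [hKℓ2, hB0]; ring
  · rw [logb, div_le_iff₀ hlog2]
    refine b2.trans (le_of_eq ?_)
    rw [hKℓ2, hB1]; ring
  · refine (cd.excessProb_le hP hn (r := K₁ * √n) (t := t) (h := h) fun z hz hzt => ?_).trans ?_
    · obtain ⟨h3, h4⟩ := b3 z (Finset.mem_filter.2 ⟨hz, hzt⟩)
      rw [hB2] at h3
      rw [hB3] at h4
      exact ⟨h3.trans (by linarith), h4.trans (by linarith)⟩
    · refine add_le_add ((one_sub_sum_typicalSet_le hP n (by positivity)).trans_eq ?_) le_rfl
      rw [mul_pow, sq_sqrt hn'.le]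
      field_simp

end SecondOrderDirect

/-! ### The second-order region. -/

section SecondOrderRegion

open Filter Topology

variable {X Y Xh Yh : Type*} [Fintype X] [Fintype Y] [Fintype Xh] [Fintype Yh]

/-- Strict inequality leaves room for a threshold t between the Gaussian value and the weighted sum
of L. The excess of the tail below ε pays for atypical strings, and the excess of the sum above t
pays for the first-order error of the mixing. -/
theorem TestChannel.secondOrderAchievable {k : ℕ} (T : TestChannel X Y Xh Yh (Fin k))
    {dX : X → Xh → ℝ} {dY : Y → Yh → ℝ} {P : X × Y → ℝ} (hP : P ∈ stdSimplex ℝ (X × Y))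
    [Nonempty Xh] [Nonempty Yh] {R₀ : ℝ} {c m : Fin 4 → ℝ} (hm : ∀ a, 0 ≤ m a)
    (hv0 : T.vals dX dY P 0 = R₀) (hv : ∀ a, T.vals dX dY P (Fin.succ a) = c a)
    (hR₀ : 0 < R₀) (hc0 : 0 < c 0) (hc1 : 0 < c 1)
    (hpert : ∀ κ > 0, ∃ δ > 0, ∀ a, ∀ σ : ℝ, |σ| = 1 → ∃ u ∈ valueSet dX dY P,
      u 0 ≤ R₀ - σ * m a * δ + κ * δ ∧
        ∀ b, u (Fin.succ b) ≤ c b + if b = a then σ * δ else 0)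
    {h : X × Y → ℝ} (hh : ∀ z, 0 < P z → T.density dX dY P 0 z +
      ∑ a, m a * T.density dX dY P (Fin.succ a) z = h z + R₀ + ∑ a, m a * c a)
    (h0 : ∑ z, P z * h z = 0) {ε : ℝ} (hε0 : 0 < ε) (hε1 : ε < 1) {L : ℝ × ℝ × ℝ}
    (hL : √(∑ z, P z * h z ^ 2) * gaussQInv ε < L.1 + m 0 * L.2.1 + m 1 * L.2.2) :
    SecondOrderAchievable dX dY R₀ (c 0) (c 1) (c 2) (c 3) ε P L := by
  obtain ⟨t, ht1, ht2⟩ := exists_between hL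
  obtain ⟨ε', hε', htail⟩ := exists_eventually_blockTail_le hP h0 hε0 hε1 ht1
  -- The typicality radius `K₁ * √n` leaves atypical strings a constant probability, which has only
  -- to fit into ε - ε'.
  obtain ⟨K₁, hK₁, hcard⟩ : ∃ K₁ : ℝ, 0 < K₁ ∧ Fintype.card (X × Y) / K₁ ^ 2 ≤ ε - ε' := by
    have hd : 0 < ε - ε' := by linarith
    refine ⟨√(Fintype.card (X × Y) / (ε - ε')) + 1, by positivity, ?_⟩
    rw [div_le_iff₀ (by positivity), ← div_le_iff₀' hd]
    have h1 : (Fintype.card (X × Y) : ℝ) / (ε - ε') = √(Fintype.card (X × Y) / (ε - ε')) ^ 2 :=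
      (sq_sqrt (by positivity)).symm
    have h2 := sqrt_nonneg ((Fintype.card (X × Y) : ℝ) / (ε - ε'))
    nlinarith
  obtain ⟨A, hA⟩ : ∃ A, A = K₁ * T.densityBound dX dY P + |L.2.1| + |L.2.2| + 1 := ⟨_, rfl⟩
  have hA0 : 0 < A := by
    have := T.densityBound_nonneg dX dY P
    rw [hA]; positivity
  have hgap : 0 < L.1 + m 0 * L.2.1 + m 1 * L.2.2 - t := by linarith
  -- Makes 4Aκ equal to the remaining gap, so the common rate of `eventually_exists_code` has
  -- second-order term exactly `L.1`.
  set κ := (L.1 + m 0 * L.2.1 + m 1 * L.2.2 - t) / (4 * A) with hκ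
  have hκ0 : 0 < κ := by positivity
  have hκA : 4 * A * κ = L.1 + m 0 * L.2.1 + m 1 * L.2.2 - t := by rw [hκ]; field_simp
  obtain ⟨δ, hδ, hu⟩ := hpert κ hκ0
  obtain ⟨C, hC⟩ := T.eventually_exists_code hP hm hv0 hv hR₀ hc0 hc1 hκ0 hδ hu hh L.2.1 L.2.2
    hK₁ t hA
  -- Codes are needed at every blocklength; a trivial code fills the blocklengths where the
  -- construction does not apply.
  have hex : ∀ n : ℕ, ∃ (M₀ M₁ M₂ : ℕ) (cd : Code X Y Xh Yh n M₀ M₁ M₂),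
      (∃ (M₀ M₁ M₂ : ℕ) (cd : Code X Y Xh Yh n M₀ M₁ M₂),
        logb 2 M₀ ≤ n * R₀ + √n * (t - m 0 * L.2.1 - m 1 * L.2.2 + 4 * A * κ) +
          C * (1 + log ((n : ℝ) + 1)) ∧
        logb 2 M₁ ≤ n * c 0 + √n * L.2.1 ∧ logb 2 M₂ ≤ n * c 1 + √n * L.2.2 ∧
        cd.excessProb dX dY (c 2) (c 3) P ≤
          Fintype.card (X × Y) / K₁ ^ 2 + blockTail P h n t) →
        logb 2 M₀ ≤ n * R₀ + √n * (t - m 0 * L.2.1 - m 1 * L.2.2 + 4 * A * κ) +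
          C * (1 + log ((n : ℝ) + 1)) ∧
        logb 2 M₁ ≤ n * c 0 + √n * L.2.1 ∧ logb 2 M₂ ≤ n * c 1 + √n * L.2.2 ∧
        cd.excessProb dX dY (c 2) (c 3) P ≤
          Fintype.card (X × Y) / K₁ ^ 2 + blockTail P h n t := by
    intro n
    by_cases hn : ∃ (M₀ M₁ M₂ : ℕ) (cd : Code X Y Xh Yh n M₀ M₁ M₂),
        logb 2 M₀ ≤ n * R₀ + √n * (t - m 0 * L.2.1 - m 1 * L.2.2 + 4 * A * κ) +
          C * (1 + log ((n : ℝ) + 1)) ∧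
        logb 2 M₁ ≤ n * c 0 + √n * L.2.1 ∧ logb 2 M₂ ≤ n * c 1 + √n * L.2.2 ∧
        cd.excessProb dX dY (c 2) (c 3) P ≤
          Fintype.card (X × Y) / K₁ ^ 2 + blockTail P h n t
    · obtain ⟨M₀, M₁, M₂, cd, hcd⟩ := hn
      exact ⟨M₀, M₁, M₂, cd, fun _ => hcd⟩
    · exact ⟨1, 1, 1, ⟨fun _ _ => 0, fun _ _ => 0, fun _ _ => 0,
        fun _ _ _ => Classical.arbitrary Xh, fun _ _ _ => Classical.arbitrary Yh⟩,
        fun h => absurd h hn⟩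
  choose M₀ M₁ M₂ cd hcd using hex
  have hev := hC.mono fun n hn => hcd n hn
  rw [hκA] at hev
  refine ⟨M₀, M₁, M₂, cd, ?_, ?_, ?_, ?_⟩
  · have hl : Tendsto (fun n : ℕ => L.1 + C * (1 + log ((n : ℝ) + 1)) / √n) atTop (𝓝 L.1) := by
      simpa using (tendsto_log_div_sqrt C).const_add L.1
    refine limsup_coe_le_of_tendsto ?_ hl
    filter_upwards [hev, eventually_gt_atTop 0] with n hn hn0
    have hs : (0 : ℝ) < √n := sqrt_pos.2 (by exact_mod_cast hn0)
    rw [div_le_iff₀ hs, add_mul, div_mul_cancel₀ _ hs.ne']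
    have := hn.1
    linarith
  · refine limsup_coe_le_of_tendsto ?_ tendsto_const_nhds
    filter_upwards [hev, eventually_gt_atTop 0] with n hn hn0
    have hs : (0 : ℝ) < √n := sqrt_pos.2 (by exact_mod_cast hn0)
    rw [div_le_iff₀ hs]
    linarith [hn.2.1]
  · refine limsup_coe_le_of_tendsto ?_ tendsto_const_nhds
    filter_upwards [hev, eventually_gt_atTop 0] with n hn hn0
    have hs : (0 : ℝ) < √n := sqrt_pos.2 (by exact_mod_cast hn0)
    rw [div_le_iff₀ hs]
    linarith [hn.2.2.1]
  · refine limsup_coe_le_of_tendsto ?_ tendsto_const_nhds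
    filter_upwards [hev, htail] with n hn hn2
    have := hn.2.2.2
    linarith

/-- The supporting hyperplane makes the given channel a Lagrangian minimizer, so its feature mixture
is log-optimal and feeds the converse, while its Lagrangian density equals the tilted density on the
support and feeds the direct part. Both bounds involve the same h, whose second moment is the
dispersion. -/
theorem TestChannel.secondOrderRegion_eq {k : ℕ} (T : TestChannel X Y Xh Yh (Fin k))
    {dX : X → Xh → ℝ} {dY : Y → Yh → ℝ} {P : X × Y → ℝ} (hP : P ∈ stdSimplex ℝ (X × Y))
    [Nonempty Xh] [Nonempty Yh] {R₀ R₁ R₂ D₁ D₂ lam₁ lam₂ γ₁ γ₂ : ℝ}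
    (hdX : ∀ x xh, 0 ≤ dX x xh) (hdY : ∀ y yh, 0 ≤ dY y yh)
    (h1 : 0 < lam₁) (h2 : 0 < lam₂) (h3 : 0 < γ₁) (h4 : 0 < γ₂)
    (hmin : ∀ v ∈ valueSet dX dY P, (∀ a, v (Fin.succ a) ≤ ![R₁, R₂, D₁, D₂] a) → R₀ ≤ v 0)
    (hR₀ : 0 < R₀)
    (hpert : ∀ κ > 0, ∃ δ > 0, ∀ a, ∀ σ : ℝ, |σ| = 1 → ∃ u ∈ valueSet dX dY P,
      u 0 ≤ R₀ - σ * ![lam₁, lam₂, γ₁, γ₂] a * δ + κ * δ ∧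
        ∀ b, u (Fin.succ b) ≤ ![R₁, R₂, D₁, D₂] b + if b = a then σ * δ else 0)
    (hT0 : T.commonInfo P = R₀) (hT1 : T.infoX P ≤ R₁) (hT2 : T.infoY P ≤ R₂)
    (hT3 : T.distX dX P ≤ D₁) (hT4 : T.distY dY P ≤ D₂)
    {ε : ℝ} (hε0 : 0 < ε) (hε1 : ε < 1) :
    secondOrderRegion dX dY R₀ R₁ R₂ D₁ D₂ ε P =
      {L : ℝ × ℝ × ℝ | L.1 + lam₁ * L.2.1 + lam₂ * L.2.2 ≥
        √(T.dispersion dX dY R₁ R₂ D₁ D₂ lam₁ lam₂ γ₁ γ₂ P) * gaussQInv ε} := by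
  have hlog2 := log_pos one_lt_two
  have hplane : ∀ v ∈ valueSet dX dY P, R₀ + lam₁ * R₁ + lam₂ * R₂ + γ₁ * D₁ + γ₂ * D₂ ≤
      v 0 + lam₁ * v 1 + lam₂ * v 2 + γ₁ * v 3 + γ₂ * v 4 := by
    intro v hv
    have := le_lagrangian_of_perturbation (convex_valueSet dX dY hP) hmin hpert hv
    rw [Fin.sum_univ_four, Fin.sum_univ_four] at this
    change R₀ + (lam₁ * R₁ + lam₂ * R₂ + γ₁ * D₁ + γ₂ * D₂) ≤
      v 0 + (lam₁ * v 1 + lam₂ * v 2 + γ₁ * v 3 + γ₂ * v 4) at this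
    linarith
  have hself := hplane _ (T.vals_mem_valueSet dX dY hP)
  change R₀ + lam₁ * R₁ + lam₂ * R₂ + γ₁ * D₁ + γ₂ * D₂ ≤ T.commonInfo P + lam₁ * T.infoX P +
    lam₂ * T.infoY P + γ₁ * T.distX dX P + γ₂ * T.distY dY P at hself
  have m1 := mul_le_mul_of_nonneg_left hT1 h1.le
  have m2 := mul_le_mul_of_nonneg_left hT2 h2.le
  have m3 := mul_le_mul_of_nonneg_left hT3 h3.le
  have m4 := mul_le_mul_of_nonneg_left hT4 h4.le
  -- Complementary slackness: the channel satisfies all constraints yet lies on or above the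
  -- hyperplane, and all multipliers are positive, so no constraint has slack.
  have e1 : T.infoX P = R₁ := mul_left_cancel₀ h1.ne' (by linarith)
  have e2 : T.infoY P = R₂ := mul_left_cancel₀ h2.ne' (by linarith)
  have e3 : T.distX dX P = D₁ := mul_left_cancel₀ h3.ne' (by linarith)
  have e4 : T.distY dY P = D₂ := mul_left_cancel₀ h4.ne' (by linarith)
  obtain ⟨hmax, hden⟩ := T.mixFeature_of_lagrangian_min dX dY hP h1 h2 (γ₁ := γ₁) (γ₂ := γ₂)
    fun v hv => by
      rw [hT0, e1, e2, e3, e4]; exact hplane v hv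
  have hmem := T.mixFeature_mem dX dY lam₁ lam₂ (γ₁ / lam₁ * log 2) (γ₂ / lam₂ * log 2) hP
  set g := T.mixFeature dX dY lam₁ lam₂ (γ₁ / lam₁ * log 2) (γ₂ / lam₂ * log 2) P with hg
  set h : X × Y → ℝ := fun z =>
    -log (g z) / log 2 - (lam₁ * R₁ + lam₂ * R₂ + γ₁ * D₁ + γ₂ * D₂) - R₀ with hh
  have htilt : ∀ z, T.tilt dX dY R₁ R₂ D₁ D₂ lam₁ lam₂ γ₁ γ₂ P z = h z + R₀ := by
    intro z
    rw [T.tilt_eq dX dY hP h1.ne' h2.ne']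
    simp only [hh, hg]
    ring
  have h0 : ∑ z, P z * h z = 0 := by
    have hs := T.sum_lagrDen_eq dX dY P (γ₁ := γ₁) (γ₂ := γ₂) h1.ne' h2.ne'
    rw [hT0, e1, e2, e3, e4] at hs
    have hpt : ∀ z, P z * h z = P z * T.lagrDen dX dY lam₁ lam₂ (γ₁ / lam₁ * log 2)
        (γ₂ / lam₂ * log 2) P z / log 2 -
        P z * (R₀ + lam₁ * R₁ + lam₂ * R₂ + γ₁ * D₁ + γ₂ * D₂) := by
      intro z
      rcases (hP.1 z).eq_or_lt with hz | hz
      · simp [← hz]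
      · rw [hden z hz]; simp only [hh]; ring
    simp only [hpt, Finset.sum_sub_distrib]
    rw [← Finset.sum_div, hs, ← Finset.sum_mul, hP.2]
    field_simp
    ring
  have hdisp : T.dispersion dX dY R₁ R₂ D₁ D₂ lam₁ lam₂ γ₁ γ₂ P = ∑ z, P z * h z ^ 2 := by
    unfold TestChannel.dispersion
    have hmean : ∑ z, P z * T.tilt dX dY R₁ R₂ D₁ D₂ lam₁ lam₂ γ₁ γ₂ P z = R₀ := by
      simp only [htilt, mul_add, Finset.sum_add_distrib]
      rw [h0, ← Finset.sum_mul, hP.2]; ring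
    rw [hmean]
    exact Finset.sum_congr rfl fun z _ => by rw [htilt]; ring
  rw [hdisp]
  -- Value vectors satisfying the constraint lowered by δ exist, and mutual information is
  -- nonnegative; hence each private rate is at least δ.
  have hpos : 0 < R₁ ∧ 0 < R₂ := by
    obtain ⟨δ, hδ, hu⟩ := hpert 1 one_pos
    constructor
    · obtain ⟨u, hu1, -, hu2⟩ := hu 0 (-1) (by simp)
      have a1 := hu2 0
      have a2 := valueSet_nonneg hP hdX hdY hu1 1
      simp at a1
      linarith
    · obtain ⟨u, hu1, -, hu2⟩ := hu 1 (-1) (by simp)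
      have a1 := hu2 1
      have a2 := valueSet_nonneg hP hdX hdY hu1 2
      simp at a1
      linarith
  refine Set.Subset.antisymm ?_ ?_
  · refine closure_minimal (fun L hL => ?_) (isClosed_le continuous_const (by fun_prop))
    exact le_of_secondOrderAchievable h1 h2 h3.le h4.le hP hmem hmax hh h0 hε0 hε1 hL
  · intro L hL
    -- Boundary points are limits of points strictly inside, obtained by raising the common
    -- coordinate.
    have hlim : Tendsto (fun j : ℕ => ((L.1 + 1 / ((j : ℝ) + 1), L.2) : ℝ × ℝ × ℝ)) atTop
        (𝓝 L) := by
      have : Tendsto (fun j : ℕ => L.1 + 1 / ((j : ℝ) + 1)) atTop (𝓝 L.1) := by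
        simpa using (tendsto_one_div_add_atTop_nhds_zero_nat (𝕜 := ℝ)).const_add L.1
      exact this.prodMk_nhds tendsto_const_nhds
    refine mem_closure_of_tendsto hlim (.of_forall fun j => ?_)
    have hj : (0 : ℝ) < 1 / ((j : ℝ) + 1) := by positivity
    refine T.secondOrderAchievable hP (c := ![R₁, R₂, D₁, D₂]) (m := ![lam₁, lam₂, γ₁, γ₂])
      (fun a => by fin_cases a <;> simp [h1.le, h2.le, h3.le, h4.le]) hT0
      (fun a => by fin_cases a; exacts [e1, e2, e3, e4]) hR₀ hpos.1 hpos.2 hpert (h := h)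
      (fun z hz => ?_) h0 hε0 hε1 ?_
    · rw [T.density_lagrangian dX dY P h1.ne' h2.ne', hden z hz, Fin.sum_univ_four]
      simp only [hh]
      simp
    · have hL' : √(∑ z, P z * h z ^ 2) * gaussQInv ε ≤ L.1 + lam₁ * L.2.1 + lam₂ * L.2.2 := hL
      change _ < (L.1 + 1 / ((j : ℝ) + 1)) + lam₁ * L.2.1 + lam₂ * L.2.2
      linarith

end SecondOrderRegion

end

end GrayWyner

/-! ### Assembly of the main theorem. -/

theorem theorem1 {X Y Xh Yh : Type*} [Fintype X] [Fintype Y] [Fintype Xh] [Fintype Yh]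
    -- the source and the distortion measures
    (P : X × Y → ℝ) (hP : P ∈ stdSimplex ℝ (X × Y))
    (dX : X → Xh → ℝ) (dY : Y → Yh → ℝ)
    (hdX : ∀ x xh, 0 ≤ dX x xh) (hdY : ∀ y yh, 0 ≤ dY y yh)
    (hdX0 : ∀ x, ∃ xh, dX x xh = 0) (hdY0 : ∀ y, ∃ yh, dY y yh = 0)
    (D₁ D₂ : ℝ) (hD₁ : 0 < D₁) (hD₂ : 0 < D₂)
    (ε : ℝ) (hε0 : 0 < ε) (hε1 : ε < 1)
    -- the rate triplet; its common rate is minimal, positive and finite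
    (R₀ R₁ R₂ : ℝ) (hR : (R₀, R₁, R₂) ∈ GrayWyner.rateRegion dX dY D₁ D₂ P)
    (hR₀ : R₀ = GrayWyner.minCommonRate dX dY R₁ R₂ D₁ D₂ P) (hR₀pos : 0 < R₀)
    -- the first derivatives exist and have the right sign
    (lam₁ lam₂ γ₁ γ₂ : ℝ)
    (hlam₁ : HasDerivAt (fun r => GrayWyner.minCommonRate dX dY r R₂ D₁ D₂ P) (-lam₁) R₁)
    (hlam₂ : HasDerivAt (fun r => GrayWyner.minCommonRate dX dY R₁ r D₁ D₂ P) (-lam₂) R₂)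
    (hγ₁ : HasDerivAt (fun D => GrayWyner.minCommonRate dX dY R₁ R₂ D D₂ P) (-γ₁) D₁)
    (hγ₂ : HasDerivAt (fun D => GrayWyner.minCommonRate dX dY R₁ R₂ D₁ D P) (-γ₂) D₂)
    (hlam₁pos : 0 < lam₁) (hlam₂pos : 0 < lam₂) (hγ₁pos : 0 < γ₁) (hγ₂pos : 0 < γ₂)
    -- second-order smoothness in the private rates and the source distribution
    (hsmooth : GrayWyner.TwiceDiffBoundedNear
      (fun u : ℝ × ℝ × GrayWyner.tangentSpace P =>
        GrayWyner.minCommonRate dX dY u.1 u.2.1 D₁ D₂ (P + (u.2.2 : X × Y → ℝ)))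
      (R₁, R₂, 0)) :
    -- an optimal test channel exists, and each one describes the second-order region
    (∃ (k : ℕ) (T : GrayWyner.TestChannel X Y Xh Yh (Fin k)),
      T.IsOptimal dX dY R₁ R₂ D₁ D₂ P) ∧
    ∀ (k : ℕ) (T : GrayWyner.TestChannel X Y Xh Yh (Fin k)),
      T.IsOptimal dX dY R₁ R₂ D₁ D₂ P →
      GrayWyner.secondOrderRegion dX dY R₀ R₁ R₂ D₁ D₂ ε P =
        {L : ℝ × ℝ × ℝ | L.1 + lam₁ * L.2.1 + lam₂ * L.2.2 ≥
          √(T.dispersion dX dY R₁ R₂ D₁ D₂ lam₁ lam₂ γ₁ γ₂ P) * GrayWyner.gaussQInv ε} := by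
  obtain ⟨⟨x₀, y₀⟩⟩ := GrayWyner.nonempty_of_mem_stdSimplex hP
  -- The reproduction alphabets are nonempty because each source letter has a reproduction with zero
  -- distortion.
  have hXh : Nonempty Xh := ⟨(hdX0 x₀).choose⟩
  have hYh : Nonempty Yh := ⟨(hdY0 y₀).choose⟩
  have hmin : ∀ v ∈ GrayWyner.valueSet dX dY P,
      (∀ a, v (Fin.succ a) ≤ ![R₁, R₂, D₁, D₂] a) → R₀ ≤ v 0 := by
    intro v hv hc
    rw [hR₀]
    exact GrayWyner.minRateAt_le hdX hdY hP (c := ![R₁, R₂, D₁, D₂]) hv hc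
  have hval : GrayWyner.minRateAt dX dY P ![R₁, R₂, D₁, D₂] = R₀ := hR₀.symm
  have hpert : ∀ κ > 0, ∃ δ > 0, ∀ a, ∀ σ : ℝ, |σ| = 1 → ∃ u ∈ GrayWyner.valueSet dX dY P,
      u 0 ≤ R₀ - σ * ![lam₁, lam₂, γ₁, γ₂] a * δ + κ * δ ∧
        ∀ b, u (Fin.succ b) ≤ ![R₁, R₂, D₁, D₂] b + if b = a then σ * δ else 0 := by
    intro κ hκ
    have := GrayWyner.exists_perturbation hdX hdY hP (c := ![R₁, R₂, D₁, D₂])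
      (m := ![lam₁, lam₂, γ₁, γ₂]) (hR₀pos.trans_eq hval.symm)
      (fun a => by
        fin_cases a
        exacts [hlam₁, hlam₂, hγ₁, hγ₂]) hκ
    rwa [hval] at this
  refine ⟨?_, fun k T hT => T.secondOrderRegion_eq hP hdX hdY hlam₁pos hlam₂pos hγ₁pos hγ₂pos hmin
    hR₀pos hpert (hT.2.2.2.2.trans hR₀.symm) hT.2.2.1 hT.2.2.2.1 hT.1 hT.2.1 hε0 hε1⟩
  -- The given triple dominates the vector of some test channel; minimality of R₀ forces its common
  -- information to equal R₀, so this channel is optimal.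
  obtain ⟨v, ⟨k, T, rfl⟩, hle⟩ := GrayWyner.exists_valueSet_le_of_mem_rateRegion hdX hdY hP hR
  have hlow := hmin _ (T.vals_mem_valueSet dX dY hP) fun a => by
    fin_cases a
    exacts [hle 1, hle 2, hle 3, hle 4]
  exact ⟨k, T, hle 3, hle 4, hle 1, hle 2, (le_antisymm (hle 0) hlow).trans hR₀⟩
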